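/- For $P\subset\mathbb{R}^d$ let $\mathrm{pos}(P)$ be the set of finite nonnegative combinations of points of $P$; $P$ \emph{ray-embraces} $b$ if $b\in\mathrm{pos}(P)$. A \emph{colorful choice} for $C_1,\dots,C_d$ picks one point from each $C_i$. \textbf{Setting.} Let $C_1,\dots,C_d\subset\mathbb{Z}^d$ be sets of $d$ points each and $0\neq b\in\mathbb{Z}^d$, such that every $C_i$ ray-embraces $b$ and no set of $d-1$ points of $\bigcup_i C_i$ ray-embraces $b$. Let $A=(C_1\,C_2\cdots C_d)\in\mathbb{Z}^{d\times d^2}$; a column coming from $C_i$ has color $i$. Let $m$ be the largest absolute value of an entry of $A$ and $b$, and let $N=d!\,m^d$. For $\varepsilon>0$ and $\mu\in\mathbb{R}^d$ let $(c_\mu)_j=1+(1-\mu_i)\,dN^2+\varepsilon^j$ for $j\in[d^2]$, where $i$ is the color of column $j$. Let $\mathcal P=\{x\in\mathbb{R}^{d^2}: Ax=b,\ x\ge 0\}$. Call $\varepsilon$ \emph{suitable} if for every feasible basis $B$ the hyperplanes $\{\mu : (r_{B,c_\mu})_j=0\}$, $j\notin B$, where $r_{B,c_\mu}$ is the reduced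 cost vector, together with the hyperplanes $\mu_i=0$ and $\mu_i=1$, $i\in[d]$, are in general position: any $k$ of them have either no common point or an intersection of dimension $d-k$. For a nonempty face $f$ of $\mathcal P$ let $\Phi(f)$ be the set of all $\mu\in\mathbb{R}^d$ such that every point of $f$ minimizes $c_\mu^Tx$ over $\mathcal P$, and let $\mathrm{supp}(f)=\{j : x_j\ne 0\text{ for some }x\in f\}$. Let $\mathcal M=\{\mu\ge 0:\|\mu\|_\infty=1\}$, whose faces are the faces of the cube $[0,1]^d$ that fix some coordinate to $1$. Let $\Delta=\mathrm{conv}\{e_1,\dots,e_d\}$, let $\Delta(\mu)=\mu/\|\mu\|_1$, and let $$\mathcal F=\{f : \Phi(f)\cap\mathcal M\ne\emptyset\},\quad \mathcal S=\{\Delta(g): g\text{ a nonempty face of }\mathcal M\},\quad \Phi_\Delta(f)=\Delta(\Phi(f)\cap\mathcal M).$$ Let $\mathcal Q_\Delta$ be the family of nonempty sets $\Delta(\Phi(f)\cap g)$ with $f\in\mathcal F$ and $g$ a face of $\mathcal M$. Let $\mathrm{sd}\,\mathcal Q_\Delta$ be its barycentric subdivision: its simplices are spanned by the barycenters of the members of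 chains $q_0\subset\dots\subset q_k$ in $\mathcal Q_\Delta$ with $\dim q_{i-1}<\dim q_i$. If a vertex $v$ is the barycenter of $\Phi_\Delta(f)\cap g\neq\emptyset$ with $f\in\mathcal F$, $g\in\mathcal S$, its label $\lambda(v)$ is the color that occurs most often among the columns with index in $\mathrm{supp}(f)$ (the smallest such color in case of a tie). A $(d-1)$-simplex is \emph{fully-labeled} if all $d$ labels occur on its vertices. \textbf{Statement.} (1) For every such instance, all sufficiently small $\varepsilon>0$ are suitable. For every suitable $\varepsilon$ with $0<\varepsilon\le N^{-3}$: (a) every vertex $v$ of $\mathrm{sd}\,\mathcal Q_\Delta$ is the barycenter of $\Phi_\Delta(f)\cap g\neq\emptyset$ for exactly one pair $(f,g)\in\mathcal F\times\mathcal S$, and so $\lambda$ is well defined; (b) $\lambda$ is a Sperner labeling: if $v\in\mathrm{conv}\{e_i: i\in T\}$, $T\subseteq[d]$, then $\lambda(v)\in T$; (c) there is a fully-labeled $(d-1)$-simplex in $\mathrm{sd}\,\mathcal Q_\Delta$; (d) every fully-labeled $(d-1)$-simplex $\sigma\in\mathrm{sd}\,\mathcal Q_\Delta$ has a vertex $v_{d-1}$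 that is the barycenter of a $(d-1)$-dimensional $q_{d-1}=\Phi_\Delta(f_{d-1})\cap g_{d-1}\in\mathcal Q_\Delta$, $f_{d-1}\in\mathcal F$, $g_{d-1}\in\mathcal S$; and for every such vertex and pair, the columns of $A$ with index in $\mathrm{supp}(f_{d-1})$ are a colorful choice for $C_1,\dots,C_d$ that ray-embraces $b$. (2) (Colorful Carath\'eodory theorem, cone version.) If $C_1,\dots,C_d\subset\mathbb{R}^d$ are nonempty sets and $b\in\mathrm{pos}(C_i)$ for all $i\in[d]$, then some colorful choice for $C_1,\dots,C_d$ ray-embraces $b$. -/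

import Mathlib

/-- `P` ray-embraces `p`: `p` is a finite nonnegative combination of points of `P`. -/
def RayEmbraces {d : ℕ} (P : Set (Fin d → ℝ)) (p : Fin d → ℝ) : Prop :=
  p ∈ PointedCone.hull ℝ P

/-- `d` color classes in `ℤ^d`, each listed as `d` points, and a target point in `ℤ^d`. -/
structure ColorInstance (d : ℕ) where
  pts : Fin d → Fin d → Fin d → ℤ
  target : Fin d → ℤ

namespace ColorInstance

variable {d : ℕ} (I : ColorInstance d)

/-- The column of `A` with index `k = (i, j)`: the `j`-th point of color `i`. -/
def column (k : Fin d × Fin d) : Fin d → ℝ := fun r => (I.pts k.1 k.2 r : ℝ)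

/-- The right-hand side `b`. -/
def b : Fin d → ℝ := fun r => (I.target r : ℝ)

/-- The `d × d²` matrix `A = (C₁ C₂ … C_d)`. -/
def A : Matrix (Fin d) (Fin d × Fin d) ℝ := Matrix.of fun r k => I.column k r

/-- A valid instance in general position: `b ≠ 0`, every color class consists of `d` points and
ray-embraces `b`, and no `d - 1` of all the points ray-embrace `b`. -/
structure InGeneralPosition : Prop where
  target_ne_zero : I.target ≠ 0
  pts_injective : ∀ i, Function.Injective (I.pts i)
  class_embraces : ∀ i, RayEmbraces (Set.range fun j => I.column (i, j)) I.b
  generic : ∀ T : Finset (Fin d → ℝ), (T : Set (Fin d → ℝ)) ⊆ Set.range I.column →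
    T.card + 1 = d → ¬ RayEmbraces (T : Set (Fin d → ℝ)) I.b

/-- The largest absolute value of an entry of `A` and `b`. -/
def maxEntry : ℕ :=
  max (Finset.univ.sup fun k : Fin d × Fin d => Finset.univ.sup fun r => (I.pts k.1 k.2 r).natAbs)
    (Finset.univ.sup fun r => (I.target r).natAbs)

/-- `N = d! m^d`. -/
def N : ℕ := d.factorial * I.maxEntry ^ d

/-- The cost vector `c_μ`; the column `(i, j)` is number `i * d + j + 1` among all the columns
(`i` and `j` count from zero). -/
noncomputable def cost (ε : ℝ) (μ : Fin d → ℝ) (k : Fin d × Fin d) : ℝ :=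
  1 + (1 - μ k.1) * d * (I.N : ℝ) ^ 2 + ε ^ ((k.1 : ℕ) * d + (k.2 : ℕ) + 1)

/-- The polyhedron of feasible solutions of `A x = b`, `x ≥ 0`. -/
def polyhedron : Set (Fin d × Fin d → ℝ) := {x | I.A.mulVec x = I.b ∧ 0 ≤ x}

/-- The nonempty faces of the polyhedron. -/
def IsFace (f : Set (Fin d × Fin d → ℝ)) : Prop :=
  f.Nonempty ∧ IsExposed ℝ I.polyhedron f

/-- The parameter region `Φ(f)`: the parameters `μ` for which every point of `f` is an optimal
solution of `min c_μᵀ x` subject to `A x = b`, `x ≥ 0`. -/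
def paramRegion (ε : ℝ) (f : Set (Fin d × Fin d → ℝ)) : Set (Fin d → ℝ) :=
  {μ | ∀ x ∈ f, x ∈ I.polyhedron ∧
    ∀ y ∈ I.polyhedron, ∑ k, I.cost ε μ k * x k ≤ ∑ k, I.cost ε μ k * y k}

/-- `β` lists the indices of a feasible basis. -/
def IsFeasibleBasis (β : Fin d → Fin d × Fin d) : Prop :=
  IsUnit (I.A.submatrix id β).det ∧ 0 ≤ (I.A.submatrix id β)⁻¹.mulVec I.b

/-- The coordinate `k` of the (extended) reduced cost vector of the basis `β` and the cost
vector `c`. -/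
noncomputable def reducedCost (β : Fin d → Fin d × Fin d) (c : Fin d × Fin d → ℝ)
    (k : Fin d × Fin d) : ℝ :=
  c k - (c ∘ β) ⬝ᵥ ((I.A.submatrix id β)⁻¹.mulVec (I.column k))

end ColorInstance

/-- The dimension of a nonempty convex set. -/
noncomputable def setDim {d : ℕ} (q : Set (Fin d → ℝ)) : ℕ :=
  Module.finrank ℝ (vectorSpan ℝ q)

namespace ColorInstance

variable {d : ℕ} (I : ColorInstance d)

/-- The perturbation `ε` makes the reduced costs non-degenerate: for every feasible basis, the
hyperplanes of vanishing reduced cost of the non-basic columns together with the supporting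
hyperplanes of the facets of the unit cube are in general position, that is, any `k` of them have
either no common point or an intersection of dimension `d - k`. -/
def IsSuitable (ε : ℝ) : Prop :=
  ∀ β : Fin d → Fin d × Fin d, I.IsFeasibleBasis β →
    ∀ J : Finset (Fin d × Fin d), (∀ k ∈ J, k ∉ Set.range β) → ∀ I₀ I₁ : Finset (Fin d),
      let S : Set (Fin d → ℝ) := {μ | (∀ k ∈ J, I.reducedCost β (I.cost ε μ) k = 0) ∧
        (∀ i ∈ I₀, μ i = 0) ∧ ∀ i ∈ I₁, μ i = 1}
      S.Nonempty → setDim S + (J.card + I₀.card + I₁.card) = d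

end ColorInstance

/-- `M`: the nonnegative vectors of maximum norm `1` (the norm of `Fin d → ℝ` is the maximum
norm), i.e. the union of the faces of the unit cube that fix some coordinate to `1`. -/
def cubeM (d : ℕ) : Set (Fin d → ℝ) := {μ | 0 ≤ μ ∧ ‖μ‖ = 1}

/-- The nonempty faces of `M`: the faces of the unit cube, given by the coordinates fixed to `0`
and to `1`, that fix at least one coordinate to `1`. -/
def facesM (d : ℕ) : Set (Set (Fin d → ℝ)) :=
  {g | ∃ I₀ I₁ : Finset (Fin d), Disjoint I₀ I₁ ∧ I₁.Nonempty ∧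
    g = {μ | 0 ≤ μ ∧ μ ≤ 1 ∧ (∀ i ∈ I₀, μ i = 0) ∧ ∀ i ∈ I₁, μ i = 1}}

/-- The central projection `μ ↦ μ / ‖μ‖₁` onto the standard simplex. -/
noncomputable def simplexProj {d : ℕ} (μ : Fin d → ℝ) : Fin d → ℝ := (∑ i, |μ i|)⁻¹ • μ

/-- The projections onto the standard simplex of the faces of `M`. -/
def facesS (d : ℕ) : Set (Set (Fin d → ℝ)) := {g | ∃ g' ∈ facesM d, g = simplexProj '' g'}

/-- The barycenter (mean of the vertices) of a polytope. -/
noncomputable def polytopeBarycenter {d : ℕ} (q : Set (Fin d → ℝ)) : Fin d → ℝ :=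
  ((q.extremePoints ℝ).ncard : ℝ)⁻¹ • ∑ᶠ v ∈ q.extremePoints ℝ, v

/-- The barycentric subdivision of a family `Q` of polytopes; a simplex is given by its vertex
set. The simplices correspond to the chains `q₀ ⊂ … ⊂ q_k` in `Q` with increasing dimensions, the
vertices being the barycenters of the `q_i`. -/
def barycentricSubdivision {d : ℕ} (Q : Set (Set (Fin d → ℝ))) : Set (Finset (Fin d → ℝ)) :=
  {σ | ∃ (k : ℕ) (q : Fin (k + 1) → Set (Fin d → ℝ)), (∀ i, q i ∈ Q) ∧ StrictMono q ∧
    StrictMono (fun i => setDim (q i)) ∧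
    (σ : Set (Fin d → ℝ)) = Set.range fun i => polytopeBarycenter (q i)}

/-- The support of a face. -/
def faceSupport {d : ℕ} (f : Set (Fin d × Fin d → ℝ)) : Set (Fin d × Fin d) :=
  {k | ∃ x ∈ f, x k ≠ 0}

/-- The number of indices of color `i` in `s`. -/
noncomputable def colorCount {d : ℕ} (s : Set (Fin d × Fin d)) (i : Fin d) : ℕ :=
  (s ∩ {k | k.1 = i}).ncard

/-- `i` is the color that appears most often in `s`, the smallest one in case of a tie. -/
def IsMajorityColor {d : ℕ} (s : Set (Fin d × Fin d)) (i : Fin d) : Prop :=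
  (∀ j, colorCount s j ≤ colorCount s i) ∧ ∀ j < i, colorCount s j < colorCount s i

namespace ColorInstance

variable {d : ℕ} (I : ColorInstance d)

/-- `F`: the faces of the polyhedron that are optimal for some parameter vector in `M`. -/
def facesF (ε : ℝ) : Set (Set (Fin d × Fin d → ℝ)) :=
  {f | I.IsFace f ∧ (I.paramRegion ε f ∩ cubeM d).Nonempty}

/-- `Φ_Δ(f)`. -/
def paramRegionProj (ε : ℝ) (f : Set (Fin d × Fin d → ℝ)) : Set (Fin d → ℝ) :=
  simplexProj '' (I.paramRegion ε f ∩ cubeM d)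

/-- The nonempty elements of `Q_Δ`, the projections of the sets `Φ(f) ∩ g`. -/
def complexQ (ε : ℝ) : Set (Set (Fin d → ℝ)) :=
  {q | q.Nonempty ∧ ∃ f ∈ I.facesF ε, ∃ g ∈ facesM d, q = simplexProj '' (I.paramRegion ε f ∩ g)}

/-- `sd Q_Δ`. -/
def sdQ (ε : ℝ) : Set (Finset (Fin d → ℝ)) := barycentricSubdivision (I.complexQ ε)

/-- `v` is the barycenter of the nonempty polytope `Φ_Δ(f) ∩ g` with `f ∈ F` and `g ∈ S`. -/
def IsBarycenterOf (ε : ℝ) (v : Fin d → ℝ) (f : Set (Fin d × Fin d → ℝ))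
    (g : Set (Fin d → ℝ)) : Prop :=
  f ∈ I.facesF ε ∧ g ∈ facesS d ∧ (I.paramRegionProj ε f ∩ g).Nonempty ∧
    v = polytopeBarycenter (I.paramRegionProj ε f ∩ g)

/-- The vertex `v` of `sd Q_Δ` has the label `i`: the majority color in the support of the face
`f` that belongs to `v`. -/
def HasLabel (ε : ℝ) (v : Fin d → ℝ) (i : Fin d) : Prop :=
  ∃ f g, I.IsBarycenterOf ε v f g ∧ IsMajorityColor (faceSupport f) i

/-- The vertices of `σ` have all the `d` labels. -/
def FullyLabeled (ε : ℝ) (σ : Finset (Fin d → ℝ)) : Prop :=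
  ∀ i : Fin d, ∃ v ∈ σ, I.HasLabel ε v i

end ColorInstance

/-- The columns with index in `s` are a colorful choice: exactly one from each color class. -/
def IsColorfulChoice {d : ℕ} (s : Set (Fin d × Fin d)) : Prop :=
  ∀ i : Fin d, ∃! k, k ∈ s ∧ k.1 = i

/-! General position makes the linear program nondegenerate: every feasible solution has at least
`d` nonzero entries, so basic solutions are positive on their basis, and a feasible basis is optimal
exactly when its reduced costs are nonnegative. The parameter regions can then be handled
combinatorially. At a parameter vector `μ`, record which of the constraints "reduced cost of `k` is
nonnegative", `0 ≤ μ i`, `μ i ≤ 1` are tight; this set is the same for all optimal bases. The tight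
sets containing some `μ i ≤ 1` are the cells (`IsCell`). They correspond to the pairs of a face of
the polyhedron and a face of `M` with nonempty `Φ(f) ∩ g` (`exists_isCell`). Suitability makes the
tight nonbasic constraints independent. As the `d` basic ones hold identically, a cell `a` has
dimension `2 * d - a.card`, and constraints can be dropped freely while a basis and one upper bound
remain (`IsCell.of_subset`).

The Sperner condition comes from the size of the costs. By Cramer's rule the positive entries of a
basic solution lie between `1 / N` and `N`, so a column of parameter `0` is too expensive as soon as
some color has parameter `1` (`color_ne_of_optimal`).

Sperner's lemma is proved for complete flags of cells, by parity and induction on the dimension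
(`odd_card_isFull`). Its local hypotheses follow by counting: a cell contains at least `d` columns
and at least one upper bound, so few constraints are free. The remaining case, `d + 1` tight
columns, is an edge of the polyhedron; positive cost bounds it, and a pivot gives its two end bases
(`exists_pivot`). Flags become simplices of the subdivision because the barycenter of a projected
cell is the projection of a point whose tight set is exactly that cell (`cellBarycenter_spec`).

Along a fully labeled flag the column set loses at most one index per step while its majority color
changes at every step. Each removed index therefore has the majority color being left, and these
colors are distinct. So the color counts of the top cell differ by at most one; with `d` columns and
`d` colors they all equal one (`isColorfulChoice_of_majority`).

Small `ε` are suitable because a dependent system of hyperplanes can have a common point only at a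
root of a nonzero polynomial in `ε`. The general cone theorem is proved separately by Bárány's
nearest-cone argument. -/

open Finset

/-! ### Ratio tests and conic combinations -/

/-- The first parameter at which one of finitely many affine functions of a parameter vanishes. -/
theorem exists_first_zero {ι : Type*} [Fintype ι] (α s : ι → ℝ) (h0 : ∀ i, 0 ≤ α i)
    (hpos : ∀ i, s i < 0 → 0 < α i) (hs : ∃ i, s i < 0) :
    ∃ t : ℝ, 0 < t ∧ (∀ i, 0 ≤ α i + t * s i) ∧ ∃ i, s i < 0 ∧ α i + t * s i = 0 := by
  classical
  obtain ⟨i₀, hi₀⟩ := hs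
  obtain ⟨i, hi, hmin⟩ := (univ.filter fun i => s i < 0).exists_min_image
    (fun i => α i / (-s i)) ⟨i₀, by simp [hi₀]⟩
  simp only [mem_filter, mem_univ, true_and] at hi hmin
  have hsi : 0 < -s i := by linarith
  refine ⟨α i / (-s i), div_pos (hpos i hi) hsi, fun j => ?_, i, hi, ?_⟩
  · by_cases hj : s j < 0
    · have h1 := hmin j hj
      rw [le_div_iff₀ (by linarith)] at h1
      linarith
    · push Not at hj
      have := h0 j
      have h2 : 0 ≤ α i / (-s i) := (div_pos (hpos i hi) hsi).le
      positivity
  · have := hi.ne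
    field_simp
    simp

/-- Small enough parameters keep finitely many affine functions of a parameter positive. -/
theorem exists_pos_forall_add_mul_pos {ι : Type*} [Finite ι] (α s : ι → ℝ) (p : ι → Prop)
    (h : ∀ i, p i → 0 < α i) :
    ∃ t : ℝ, 0 < t ∧ ∀ i, p i → 0 < α i + t * s i := by
  have h1 : ∀ i, ∀ᶠ t in nhdsWithin (0 : ℝ) (Set.Ioi 0), p i → 0 < α i + t * s i := by
    intro i
    by_cases hp : p i
    · have hc : Filter.Tendsto (fun t : ℝ => α i + t * s i) (nhdsWithin 0 (Set.Ioi 0))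
          (nhds (α i + 0 * s i)) := by
        apply Filter.Tendsto.mono_left _ nhdsWithin_le_nhds
        exact Continuous.tendsto (by fun_prop) 0
      have := hc.eventually (lt_mem_nhds (a := 0) (by simpa using h i hp))
      filter_upwards [this] with t ht _ using ht
    · exact Filter.Eventually.of_forall fun t hpt => absurd hpt hp
  obtain ⟨t, ht, ht0⟩ := ((Filter.eventually_all.2 h1).and self_mem_nhdsWithin).exists
  exact ⟨t, ht0, ht⟩

/-- Conic Carathéodory theorem: a nonnegative combination can be replaced by one with linearly
independent support. -/
theorem exists_nonneg_independent_support {ι V : Type*} [Fintype ι] [AddCommGroup V] [Module ℝ V]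
    (v : ι → V) (x : ι → ℝ) (hx : 0 ≤ x) :
    ∃ y : ι → ℝ, 0 ≤ y ∧ (∀ i, x i = 0 → y i = 0) ∧ ∑ i, y i • v i = ∑ i, x i • v i ∧
      ∀ z : ι → ℝ, (∀ i, y i = 0 → z i = 0) → ∑ i, z i • v i = 0 → z = 0 := by
  classical
  induction hn : (univ.filter fun i => x i ≠ 0).card using Nat.strong_induction_on
    generalizing x with
  | _ n ih =>
    by_cases hind : ∀ z : ι → ℝ, (∀ i, x i = 0 → z i = 0) → ∑ i, z i • v i = 0 → z = 0
    · exact ⟨x, hx, fun _ h => h, rfl, hind⟩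
    push Not at hind
    obtain ⟨z, hz0, hzv, hz⟩ := hind
    obtain ⟨s, hs0, hsv, hs⟩ : ∃ s : ι → ℝ, (∀ i, x i = 0 → s i = 0) ∧ ∑ i, s i • v i = 0 ∧
        ∃ i, s i < 0 := by
      -- The relation or its negative has a negative coefficient, so moving along it removes an
      -- index from the support.
      obtain ⟨i, hi⟩ := Function.ne_iff.1 hz
      rcases lt_or_gt_of_ne hi with h | h
      · exact ⟨z, hz0, hzv, i, h⟩
      · refine ⟨-z, fun i hi => by simp [hz0 i hi], by simp [hzv], i, by simpa using h⟩
    obtain ⟨t, -, ht, i, hsi, hti⟩ := exists_first_zero x s hx (fun i hi => by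
      rcases (hx i).eq_or_lt with h | h
      · exact absurd (hs0 i h.symm) hi.ne
      · exact h) hs
    have hsupp : ∀ i, x i = 0 → x i + t * s i = 0 := fun i hi => by simp [hi, hs0 i hi]
    obtain ⟨y, hy, hxy, hyv, hyi⟩ := ih _ (by
      rw [← hn]
      refine card_lt_card (Finset.ssubset_iff_of_subset ?_ |>.2 ⟨i, ?_, ?_⟩)
      · intro j
        simp only [mem_filter, mem_univ, true_and]
        exact mt (hsupp j)
      · simp only [mem_filter, mem_univ, true_and]
        exact fun h => hsi.ne (hs0 i h)
      · simp [hti]) (fun i => x i + t * s i) ht rfl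
    refine ⟨y, hy, fun i hi => hxy i (hsupp i hi), ?_, hyi⟩
    rw [hyv]
    simp [add_smul, sum_add_distrib, mul_smul, ← smul_sum, hsv]

theorem rayEmbraces_mono {d : ℕ} {P Q : Set (Fin d → ℝ)} {p : Fin d → ℝ} (h : P ⊆ Q)
    (hP : RayEmbraces P p) : RayEmbraces Q p :=
  Submodule.span_mono h hP

theorem rayEmbraces_of_sum {d : ℕ} {ι : Type*} [Fintype ι] {P : Set (Fin d → ℝ)}
    (v : ι → Fin d → ℝ) (x : ι → ℝ) (hx : 0 ≤ x) (hP : ∀ i, x i ≠ 0 → v i ∈ P) :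
    RayEmbraces P (∑ i, x i • v i) := by
  refine Submodule.sum_mem _ fun i _ => ?_
  by_cases hi : x i = 0
  · simp [hi]
  · exact (PointedCone.hull ℝ P).smul_mem (hx i) (Submodule.subset_span (hP i hi))

theorem rayEmbraces_range_iff {d : ℕ} {ι : Type*} [Fintype ι] (v : ι → Fin d → ℝ)
    (p : Fin d → ℝ) :
    RayEmbraces (Set.range v) p ↔ ∃ x : ι → ℝ, 0 ≤ x ∧ ∑ i, x i • v i = p := by
  constructor
  · intro h
    obtain ⟨c, hc⟩ := (Submodule.mem_span_range_iff_exists_fun _).1 h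
    exact ⟨fun i => (c i : ℝ), fun i => (c i).2, hc⟩
  · rintro ⟨x, hx, rfl⟩
    exact rayEmbraces_of_sum v x hx fun i _ => Set.mem_range_self i

/-! ### Bases, basic solutions and nondegeneracy -/

namespace ColorInstance

variable {d : ℕ} (I : ColorInstance d)

theorem mulVec_A (x : Fin d × Fin d → ℝ) : I.A.mulVec x = ∑ k, x k • I.column k := by
  ext r
  simp [Matrix.mulVec, dotProduct, A, mul_comm]

theorem mem_polyhedron {x : Fin d × Fin d → ℝ} :
    x ∈ I.polyhedron ↔ ∑ k, x k • I.column k = I.b ∧ 0 ≤ x := by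
  rw [← mulVec_A]
  rfl

/-- The vector that has the entries of `u` at the indices listed by `β`. -/
noncomputable def extendBasis (β : Fin d → Fin d × Fin d) (u : Fin d → ℝ)
    (k : Fin d × Fin d) : ℝ :=
  ∑ l, if β l = k then u l else 0

theorem extendBasis_apply {β : Fin d → Fin d × Fin d} (hβ : Function.Injective β)
    (u : Fin d → ℝ) (l : Fin d) : extendBasis β u (β l) = u l := by
  simp [extendBasis, hβ.eq_iff]

theorem extendBasis_of_notMem {β : Fin d → Fin d × Fin d} (u : Fin d → ℝ) {k : Fin d × Fin d}
    (hk : k ∉ Set.range β) : extendBasis β u k = 0 :=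
  sum_eq_zero fun l _ => if_neg fun h => hk ⟨l, h⟩

theorem sum_extendBasis (β : Fin d → Fin d × Fin d) (u : Fin d → ℝ) :
    ∑ k, extendBasis β u k • I.column k = (I.A.submatrix id β).mulVec u := by
  simp only [extendBasis, sum_smul]
  rw [sum_comm]
  ext r
  simp [Matrix.mulVec, dotProduct, A, ite_smul, mul_comm]

theorem injective_of_isUnit_det {β : Fin d → Fin d × Fin d}
    (h : IsUnit (I.A.submatrix id β).det) : Function.Injective β := by
  intro l l' hl
  by_contra hne
  apply h.ne_zero
  exact Matrix.det_zero_of_column_eq hne fun r => by simp [hl]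

/-- The basic solution of the basis `β`. -/
noncomputable def basicSol (β : Fin d → Fin d × Fin d) : Fin d × Fin d → ℝ :=
  extendBasis β ((I.A.submatrix id β)⁻¹.mulVec I.b)

/-- The dual vector of the basis `β`. -/
noncomputable def dualVec (β : Fin d → Fin d × Fin d) (c : Fin d × Fin d → ℝ) : Fin d → ℝ :=
  Matrix.vecMul (c ∘ β) (I.A.submatrix id β)⁻¹

theorem reducedCost_eq (β : Fin d → Fin d × Fin d) (c : Fin d × Fin d → ℝ)
    (k : Fin d × Fin d) : I.reducedCost β c k = c k - I.dualVec β c ⬝ᵥ I.column k := by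
  rw [reducedCost, dualVec, Matrix.dotProduct_mulVec]

theorem vecMul_submatrix (β : Fin d → Fin d × Fin d) (y : Fin d → ℝ) (l : Fin d) :
    Matrix.vecMul y (I.A.submatrix id β) l = y ⬝ᵥ I.column (β l) := rfl

theorem dualVec_dotProduct {β : Fin d → Fin d × Fin d} (h : IsUnit (I.A.submatrix id β).det)
    (c : Fin d × Fin d → ℝ) (l : Fin d) : I.dualVec β c ⬝ᵥ I.column (β l) = c (β l) := by
  rw [← vecMul_submatrix, dualVec, Matrix.vecMul_vecMul, Matrix.nonsing_inv_mul _ h,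
    Matrix.vecMul_one]
  rfl

theorem reducedCost_basis {β : Fin d → Fin d × Fin d} (h : IsUnit (I.A.submatrix id β).det)
    (c : Fin d × Fin d → ℝ) (l : Fin d) : I.reducedCost β c (β l) = 0 := by
  rw [reducedCost_eq, dualVec_dotProduct I h, sub_self]

theorem sum_cost_eq (β : Fin d → Fin d × Fin d) (c x : Fin d × Fin d → ℝ) :
    ∑ k, c k * x k =
      I.dualVec β c ⬝ᵥ (∑ k, x k • I.column k) + ∑ k, I.reducedCost β c k * x k := by
  simp only [reducedCost_eq, dotProduct_sum, dotProduct_smul, sub_mul, sum_sub_distrib,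
    smul_eq_mul]
  simp only [mul_comm]
  ring

theorem dotProduct_column_unique {β : Fin d → Fin d × Fin d}
    (h : IsUnit (I.A.submatrix id β).det) {y y' : Fin d → ℝ}
    (hy : ∀ l, y ⬝ᵥ I.column (β l) = y' ⬝ᵥ I.column (β l)) : y = y' := by
  have : Matrix.vecMul y (I.A.submatrix id β) = Matrix.vecMul y' (I.A.submatrix id β) :=
    funext hy
  exact Matrix.vecMul_injective_of_isUnit ((Matrix.isUnit_iff_isUnit_det _).2 h) this

/-- The reduced costs do not change if the basis is replaced by one whose columns have reduced
cost zero. -/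
theorem reducedCost_congr {β β' : Fin d → Fin d × Fin d}
    (h : IsUnit (I.A.submatrix id β').det) {c : Fin d × Fin d → ℝ}
    (hr : ∀ l, I.reducedCost β c (β' l) = 0) : I.reducedCost β' c = I.reducedCost β c := by
  have : I.dualVec β' c = I.dualVec β c := by
    apply dotProduct_column_unique I h
    intro l
    have := hr l
    rw [reducedCost_eq] at this
    rw [dualVec_dotProduct I h]
    linarith
  ext k
  rw [reducedCost_eq, reducedCost_eq, this]

theorem solution_unique {β : Fin d → Fin d × Fin d}
    (h : IsUnit (I.A.submatrix id β).det) {x y : Fin d × Fin d → ℝ}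
    (hxy : ∑ k, x k • I.column k = ∑ k, y k • I.column k) (he : ∀ k, k ∉ Set.range β → x k = y k) :
    x = y := by
  have hinj := I.injective_of_isUnit_det h
  have key : (fun l => x (β l)) = fun l => y (β l) := by
    apply Matrix.mulVec_injective_of_isUnit ((Matrix.isUnit_iff_isUnit_det _).2 h)
    rw [← sub_eq_zero, ← Matrix.mulVec_sub, ← sum_extendBasis]
    rw [← sub_eq_zero, ← sum_sub_distrib] at hxy
    rw [← hxy]
    refine sum_congr rfl fun k _ => ?_
    rw [← sub_smul]
    congr 1
    by_cases hk : k ∈ Set.range β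
    · obtain ⟨l, rfl⟩ := hk
      rw [extendBasis_apply hinj]
      rfl
    · rw [extendBasis_of_notMem _ hk, he k hk, sub_self]
  ext k
  by_cases hk : k ∈ Set.range β
  · obtain ⟨l, rfl⟩ := hk
    exact congrFun key l
  · exact he k hk

variable {I}

theorem IsFeasibleBasis.injective {β : Fin d → Fin d × Fin d} (h : I.IsFeasibleBasis β) :
    Function.Injective β := I.injective_of_isUnit_det h.1

theorem IsFeasibleBasis.sum_basicSol {β : Fin d → Fin d × Fin d} (h : I.IsFeasibleBasis β) :
    ∑ k, I.basicSol β k • I.column k = I.b := by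
  rw [basicSol, sum_extendBasis, Matrix.mulVec_mulVec, Matrix.mul_nonsing_inv _ h.1,
    Matrix.one_mulVec]

theorem IsFeasibleBasis.basicSol_mem {β : Fin d → Fin d × Fin d} (h : I.IsFeasibleBasis β) :
    I.basicSol β ∈ I.polyhedron := by
  refine I.mem_polyhedron.2 ⟨h.sum_basicSol, fun k => ?_⟩
  change 0 ≤ ∑ l, if β l = k then (I.A.submatrix id β)⁻¹.mulVec I.b l else 0
  refine sum_nonneg fun l _ => ?_
  split_ifs
  · exact h.2 l
  · exact le_rfl

theorem basicSol_of_notMem {β : Fin d → Fin d × Fin d} {k : Fin d × Fin d}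
    (hk : k ∉ Set.range β) : I.basicSol β k = 0 := extendBasis_of_notMem _ hk

theorem InGeneralPosition.d_pos (hI : I.InGeneralPosition) : 0 < d := by
  rcases Nat.eq_zero_or_pos d with rfl | h
  · exact absurd (Subsingleton.elim _ _) hI.target_ne_zero
  · exact h

theorem InGeneralPosition.column_injective (hI : I.InGeneralPosition) (i : Fin d) :
    Function.Injective fun j => I.column (i, j) := by
  intro j j' h
  apply hI.pts_injective i
  ext r
  have := congrFun h r
  simpa [column] using this

/-- Every feasible solution has at least `d` nonzero entries. -/
theorem InGeneralPosition.le_card_support (hI : I.InGeneralPosition)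
    {x : Fin d × Fin d → ℝ} (hx : x ∈ I.polyhedron) {s : Finset (Fin d × Fin d)}
    (hs : ∀ k, x k ≠ 0 → k ∈ s) : d ≤ s.card := by
  classical
  by_contra hlt
  push Not at hlt
  have hd := hI.d_pos
  have h1 : (s.image I.column).card ≤ d - 1 := by
    have := card_image_le (s := s) (f := I.column)
    omega
  -- Genericity speaks of exactly `d - 1` points, so a smaller set has to be padded; one color class
  -- alone supplies `d` distinct points.
  have h2 : d - 1 ≤ (univ.image I.column).card := by
    have h3 : (univ.image fun j => I.column (⟨0, hd⟩, j)).card = d := by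
      rw [card_image_of_injective _ (hI.column_injective _), card_univ, Fintype.card_fin]
    have h4 : (univ.image fun j => I.column (⟨0, hd⟩, j)) ⊆ univ.image I.column := by
      intro p
      simp only [mem_image, mem_univ, true_and]
      rintro ⟨j, rfl⟩
      exact ⟨_, rfl⟩
    have := card_le_card h4
    omega
  obtain ⟨T, hT1, hT2, hT3⟩ := exists_subsuperset_card_eq
    (image_subset_image (subset_univ s)) h1 h2
  refine hI.generic T ?_ (by omega) ?_
  · intro p hp
    have := hT2 hp
    simpa using this
  · rw [← (I.mem_polyhedron.1 hx).1]
    exact rayEmbraces_of_sum _ _ (I.mem_polyhedron.1 hx).2 fun k hk =>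
      hT1 (mem_image_of_mem _ (hs k hk))

/-- A vanishing basic entry would leave a feasible solution with at most `d - 1` nonzero entries. -/
theorem IsFeasibleBasis.basicSol_pos (hI : I.InGeneralPosition) {β : Fin d → Fin d × Fin d}
    (h : I.IsFeasibleBasis β) (l : Fin d) : 0 < I.basicSol β (β l) := by
  classical
  refine lt_of_le_of_ne ((I.mem_polyhedron.1 h.basicSol_mem).2 _) fun h0 => ?_
  have := hI.le_card_support h.basicSol_mem (s := (univ.image β).erase (β l)) (by
    intro k hk
    rw [mem_erase]
    refine ⟨fun hkl => hk (hkl ▸ h0.symm), ?_⟩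
    by_contra hk'
    exact hk (basicSol_of_notMem (by simpa using hk')))
  rw [card_erase_of_mem (by simp), card_image_of_injective _ h.injective, card_univ,
    Fintype.card_fin] at this
  have := hI.d_pos
  omega

/-- Every feasible solution contains a feasible basis in its support. -/
theorem InGeneralPosition.exists_feasibleBasis (hI : I.InGeneralPosition)
    {x : Fin d × Fin d → ℝ} (hx : x ∈ I.polyhedron) :
    ∃ β, I.IsFeasibleBasis β ∧ ∀ l, x (β l) ≠ 0 := by
  classical
  obtain ⟨hxb, hx0⟩ := I.mem_polyhedron.1 hx
  obtain ⟨y, hy0, hxy, hyb, hind⟩ := exists_nonneg_independent_support I.column x hx0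
  have hyP : y ∈ I.polyhedron := I.mem_polyhedron.2 ⟨hyb.trans hxb, hy0⟩
  set s := univ.filter fun k => y k ≠ 0 with hs
  -- The support of `y` has at least `d` elements by nondegeneracy and at most `d` by independence,
  -- so it is itself a basis.
  have hle := hI.le_card_support hyP (s := s) (by simp [hs])
  have hli : LinearIndependent ℝ fun k : s => I.column k := by
    rw [Fintype.linearIndependent_iff]
    intro g hg k
    have := hind (fun j => if h : j ∈ s then g ⟨j, h⟩ else 0) (fun j hj => by simp [hs, hj]) (by
      rw [← hg, ← sum_subset (subset_univ s) (fun j _ hj => by simp [hj]), ← sum_coe_sort]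
      exact sum_congr rfl fun j _ => by simp)
    simpa using congrFun this k
  have hge : s.card ≤ d := by
    simpa using hli.fintype_card_le_finrank
  have hcard : Fintype.card s = d := by
    rw [Fintype.card_coe]
    omega
  let e : Fin d ≃ s := (Fintype.equivFinOfCardEq hcard).symm
  let β : Fin d → Fin d × Fin d := fun l => (e l : Fin d × Fin d)
  have hβs : ∀ k, y k ≠ 0 → k ∈ Set.range β := fun k hk =>
    ⟨e.symm ⟨k, by simp [hs, hk]⟩, by simp [β]⟩
  have hβ : IsUnit (I.A.submatrix id β).det := by
    rw [← Matrix.isUnit_iff_isUnit_det, ← Matrix.linearIndependent_cols_iff_isUnit]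
    exact hli.comp e e.injective
  have hyβ : (I.A.submatrix id β).mulVec (fun l => y (β l)) = I.b := by
    rw [← hxb, ← hyb, ← sum_extendBasis]
    refine sum_congr rfl fun k _ => ?_
    congr 1
    by_cases hk : k ∈ Set.range β
    · obtain ⟨l, rfl⟩ := hk
      rw [extendBasis_apply (I.injective_of_isUnit_det hβ)]
    · rw [extendBasis_of_notMem _ hk]
      by_contra h
      exact hk (hβs k (Ne.symm h))
  refine ⟨β, ⟨hβ, ?_⟩, fun l h => ?_⟩
  · rw [← hyβ, Matrix.mulVec_mulVec, Matrix.nonsing_inv_mul _ hβ, Matrix.one_mulVec]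
    exact fun l => hy0 _
  · have := (mem_filter.1 (e l).2).2
    exact this (hxy _ h)

end ColorInstance

/-! ### Optimality, reduced costs and pivots -/

namespace ColorInstance

variable {d : ℕ} {I : ColorInstance d}

/-- `x` minimizes the cost `c` over the polyhedron. -/
def IsOptimal (I : ColorInstance d) (c x : Fin d × Fin d → ℝ) : Prop :=
  x ∈ I.polyhedron ∧ ∀ y ∈ I.polyhedron, ∑ k, c k * x k ≤ ∑ k, c k * y k

theorem sum_cost_of_mem (β : Fin d → Fin d × Fin d) (c : Fin d × Fin d → ℝ)
    {x : Fin d × Fin d → ℝ} (hx : x ∈ I.polyhedron) :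
    ∑ k, c k * x k = I.dualVec β c ⬝ᵥ I.b + ∑ k, I.reducedCost β c k * x k := by
  rw [I.sum_cost_eq β, (I.mem_polyhedron.1 hx).1]

theorem IsFeasibleBasis.sum_reducedCost {β : Fin d → Fin d × Fin d} (h : I.IsFeasibleBasis β)
    (c : Fin d × Fin d → ℝ) : ∑ k, I.reducedCost β c k * I.basicSol β k = 0 := by
  refine sum_eq_zero fun k _ => ?_
  by_cases hk : k ∈ Set.range β
  · obtain ⟨l, rfl⟩ := hk
    rw [I.reducedCost_basis h.1, zero_mul]
  · rw [basicSol_of_notMem hk, mul_zero]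

theorem IsFeasibleBasis.sum_cost_sub {β : Fin d → Fin d × Fin d} (h : I.IsFeasibleBasis β)
    (c : Fin d × Fin d → ℝ) {x : Fin d × Fin d → ℝ} (hx : x ∈ I.polyhedron) :
    ∑ k, c k * x k = ∑ k, c k * I.basicSol β k + ∑ k, I.reducedCost β c k * x k := by
  rw [sum_cost_of_mem β c hx, sum_cost_of_mem β c h.basicSol_mem, h.sum_reducedCost, add_zero]

/-- A basis with nonnegative reduced costs is optimal, and the optimal solutions are those that
vanish where the reduced costs do not. -/
theorem IsFeasibleBasis.isOptimal_iff {β : Fin d → Fin d × Fin d} (h : I.IsFeasibleBasis β)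
    {c : Fin d × Fin d → ℝ} (hr : ∀ k, 0 ≤ I.reducedCost β c k) {x : Fin d × Fin d → ℝ} :
    I.IsOptimal c x ↔ x ∈ I.polyhedron ∧ ∀ k, x k ≠ 0 → I.reducedCost β c k = 0 := by
  constructor
  · rintro ⟨hx, hopt⟩
    refine ⟨hx, fun k hk => ?_⟩
    have h1 := hopt _ h.basicSol_mem
    rw [h.sum_cost_sub c hx] at h1
    have h0 : ∀ k ∈ univ, 0 ≤ I.reducedCost β c k * x k := fun k _ =>
      mul_nonneg (hr k) ((I.mem_polyhedron.1 hx).2 k)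
    have h2 : ∑ k, I.reducedCost β c k * x k = 0 :=
      le_antisymm (by linarith) (sum_nonneg h0)
    have := (sum_eq_zero_iff_of_nonneg h0).1 h2 k (mem_univ k)
    exact (mul_eq_zero.1 this).resolve_right hk
  · rintro ⟨hx, hz⟩
    refine ⟨hx, fun y hy => ?_⟩
    rw [h.sum_cost_sub c hx, h.sum_cost_sub c hy]
    have h1 : ∑ k, I.reducedCost β c k * x k = 0 := sum_eq_zero fun k _ => by
      by_cases hk : x k = 0
      · simp [hk]
      · simp [hz k hk]
    have h2 : 0 ≤ ∑ k, I.reducedCost β c k * y k := sum_nonneg fun k _ =>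
      mul_nonneg (hr k) ((I.mem_polyhedron.1 hy).2 k)
    linarith

/-- The direction in which the nonbasic index `k` enters the basis `β`. -/
noncomputable def edgeDir (I : ColorInstance d) (β : Fin d → Fin d × Fin d) (k : Fin d × Fin d) :
    Fin d × Fin d → ℝ :=
  Pi.single k 1 - extendBasis β ((I.A.submatrix id β)⁻¹.mulVec (I.column k))

theorem edgeDir_self {β : Fin d → Fin d × Fin d} {k : Fin d × Fin d} (hk : k ∉ Set.range β) :
    I.edgeDir β k k = 1 := by
  simp [edgeDir, extendBasis_of_notMem _ hk]

theorem edgeDir_of_notMem {β : Fin d → Fin d × Fin d} {k j : Fin d × Fin d} (hj : j ∉ Set.range β)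
    (hjk : j ≠ k) : I.edgeDir β k j = 0 := by
  simp [edgeDir, extendBasis_of_notMem _ hj, hjk]

theorem IsFeasibleBasis.sum_edgeDir {β : Fin d → Fin d × Fin d} (h : I.IsFeasibleBasis β)
    (k : Fin d × Fin d) : ∑ j, I.edgeDir β k j • I.column j = 0 := by
  simp only [edgeDir, Pi.sub_apply, sub_smul, sum_sub_distrib]
  rw [sum_extendBasis, Matrix.mulVec_mulVec, Matrix.mul_nonsing_inv _ h.1, Matrix.one_mulVec,
    sum_eq_single k]
  · simp
  · intro j _ hj
    simp [hj]
  · simp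

theorem IsFeasibleBasis.sum_edge {β : Fin d → Fin d × Fin d} (h : I.IsFeasibleBasis β)
    (k : Fin d × Fin d) (t : ℝ) :
    ∑ j, (I.basicSol β j + t * I.edgeDir β k j) • I.column j = I.b := by
  simp only [add_smul, sum_add_distrib, mul_smul, ← smul_sum, h.sum_edgeDir, smul_zero, add_zero,
    h.sum_basicSol]

/-- A nonbasic index can enter the support of the basic solution. -/
theorem IsFeasibleBasis.exists_enter (hI : I.InGeneralPosition) {β : Fin d → Fin d × Fin d}
    (h : I.IsFeasibleBasis β) {k : Fin d × Fin d} (hk : k ∉ Set.range β) :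
    ∃ x ∈ I.polyhedron, 0 < x k ∧ (∀ l, 0 < x (β l)) ∧ ∀ j, j ∉ Set.range β → j ≠ k → x j = 0 := by
  obtain ⟨t, ht, hpos⟩ := exists_pos_forall_add_mul_pos (fun j => I.basicSol β j) (I.edgeDir β k)
    (fun j => j ∈ Set.range β) (by rintro _ ⟨l, rfl⟩; exact h.basicSol_pos hI l)
  have hxk : 0 < I.basicSol β k + t * I.edgeDir β k k := by
    rw [basicSol_of_notMem hk, edgeDir_self hk]
    linarith
  have hz : ∀ j, j ∉ Set.range β → j ≠ k → I.basicSol β j + t * I.edgeDir β k j = 0 := by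
    intro j hj hjk
    rw [basicSol_of_notMem hj, edgeDir_of_notMem hj hjk]
    simp
  refine ⟨fun j => I.basicSol β j + t * I.edgeDir β k j,
    I.mem_polyhedron.2 ⟨h.sum_edge k t, fun j => ?_⟩, hxk, fun l => hpos _ ⟨l, rfl⟩, hz⟩
  by_cases hj : j ∈ Set.range β
  · exact (hpos j hj).le
  · by_cases hjk : j = k
    · exact hjk ▸ hxk.le
    · exact (hz j hj hjk).ge

/-- By nondegeneracy the reduced costs of an optimal basis are nonnegative. -/
theorem IsFeasibleBasis.reducedCost_nonneg (hI : I.InGeneralPosition) {β : Fin d → Fin d × Fin d}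
    (h : I.IsFeasibleBasis β) {c : Fin d × Fin d → ℝ} (hopt : I.IsOptimal c (I.basicSol β))
    (k : Fin d × Fin d) : 0 ≤ I.reducedCost β c k := by
  by_cases hk : k ∈ Set.range β
  · obtain ⟨l, rfl⟩ := hk
    exact (I.reducedCost_basis h.1 c l).ge
  obtain ⟨x, hx, hxk, -, hz⟩ := h.exists_enter hI hk
  have h1 := hopt.2 x hx
  rw [h.sum_cost_sub c hx, le_add_iff_nonneg_right, sum_eq_single k] at h1
  · by_contra hneg
    push Not at hneg
    have := mul_neg_of_neg_of_pos hneg hxk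
    linarith
  · intro j _ hj
    by_cases hjβ : j ∈ Set.range β
    · obtain ⟨l, rfl⟩ := hjβ
      rw [I.reducedCost_basis h.1, zero_mul]
    · rw [hz j hjβ hj, mul_zero]
  · simp

/-- A feasible solution supported in the support of an optimal solution is optimal. -/
theorem IsOptimal.of_support {c x y : Fin d × Fin d → ℝ} (hx : I.IsOptimal c x)
    (hy : y ∈ I.polyhedron) (hs : ∀ k, y k ≠ 0 → x k ≠ 0) : I.IsOptimal c y := by
  refine ⟨hy, fun w hw => le_trans ?_ (hx.2 w hw)⟩
  obtain ⟨hxb, hx0⟩ := I.mem_polyhedron.1 hx.1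
  obtain ⟨hyb, -⟩ := I.mem_polyhedron.1 hy
  -- A short step from `x` away from `y` stays feasible; optimality of `x` then bounds the cost of
  -- `y` by that of `x`.
  obtain ⟨t, ht, hpos⟩ := exists_pos_forall_add_mul_pos x (fun k => x k - y k) (fun k => x k ≠ 0)
    fun k hk => lt_of_le_of_ne (hx0 k) (Ne.symm hk)
  have hmem : (fun k => x k + t * (x k - y k)) ∈ I.polyhedron := by
    refine I.mem_polyhedron.2 ⟨?_, fun k => ?_⟩
    · simp [add_smul, sub_smul, sum_add_distrib, mul_smul, ← smul_sum, hxb, hyb]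
    · by_cases hk : x k = 0
      · have : y k = 0 := by
          by_contra h
          exact hs k h hk
        simp [hk, this]
      · exact (hpos k hk).le
  have h1 := hx.2 _ hmem
  have h2 : ∑ k, c k * (x k + t * (x k - y k)) =
      ∑ k, c k * x k + t * (∑ k, c k * x k - ∑ k, c k * y k) := by
    rw [← sum_sub_distrib, mul_sum, ← sum_add_distrib]
    exact sum_congr rfl fun k _ => by ring
  rw [h2] at h1
  have : 0 ≤ t * (∑ k, c k * x k - ∑ k, c k * y k) := by linarith
  have := (mul_nonneg_iff_of_pos_left ht).1 this
  linarith

/-- An optimal solution contains an optimal basis in its support. -/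
theorem IsOptimal.exists_basis (hI : I.InGeneralPosition) {c x : Fin d × Fin d → ℝ}
    (hx : I.IsOptimal c x) :
    ∃ β, I.IsFeasibleBasis β ∧ (∀ l, x (β l) ≠ 0) ∧ ∀ k, 0 ≤ I.reducedCost β c k := by
  obtain ⟨β, hβ, hs⟩ := hI.exists_feasibleBasis hx.1
  refine ⟨β, hβ, hs, hβ.reducedCost_nonneg hI (hx.of_support hβ.basicSol_mem fun k hk => ?_)⟩
  by_cases hkβ : k ∈ Set.range β
  · obtain ⟨l, rfl⟩ := hkβ
    exact hs l
  · exact absurd (basicSol_of_notMem hkβ) hk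

theorem isClosed_polyhedron (I : ColorInstance d) : IsClosed I.polyhedron := by
  have h1 : Continuous fun x : Fin d × Fin d → ℝ => I.A.mulVec x :=
    Continuous.matrix_mulVec continuous_const continuous_id
  exact (isClosed_eq h1 continuous_const).inter isClosed_Ici

/-- A positive cost vector has an optimal basis. -/
theorem InGeneralPosition.exists_optimal_basis (hI : I.InGeneralPosition)
    {c : Fin d × Fin d → ℝ} (hc : ∀ k, 0 < c k) :
    ∃ β, I.IsFeasibleBasis β ∧ ∀ k, 0 ≤ I.reducedCost β c k := by
  have hcont : Continuous fun x : Fin d × Fin d → ℝ => ∑ k, c k * x k := by fun_prop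
  obtain ⟨x₀, hx₀⟩ : I.polyhedron.Nonempty := by
    obtain ⟨u, hu0, hu⟩ := (rayEmbraces_range_iff _ _).1 (hI.class_embraces ⟨0, hI.d_pos⟩)
    refine ⟨fun k => if k.1 = ⟨0, hI.d_pos⟩ then u k.2 else 0, I.mem_polyhedron.2 ⟨?_, fun k => ?_⟩⟩
    · rw [← hu, Fintype.sum_prod_type, sum_eq_single ⟨0, hI.d_pos⟩]
      · simp
      · intro i _ hi
        simp [hi]
      · simp
    · dsimp only
      split_ifs
      · exact hu0 _
      · exact le_rfl
  -- Positive costs make this sublevel set bounded, so the minimum is attained.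
  let K : Set (Fin d × Fin d → ℝ) :=
    {x | x ∈ I.polyhedron ∧ ∑ k, c k * x k ≤ ∑ k, c k * x₀ k}
  have hK : IsCompact K := by
    refine Metric.isCompact_of_isClosed_isBounded
      (I.isClosed_polyhedron.inter (isClosed_le hcont continuous_const)) ?_
    refine (Metric.isBounded_Icc (0 : Fin d × Fin d → ℝ)
      fun k => (∑ j, c j * x₀ j) / c k).subset ?_
    rintro x ⟨hx, hle⟩
    have hx0 := (I.mem_polyhedron.1 hx).2
    refine ⟨hx0, fun k => ?_⟩
    rw [le_div_iff₀ (hc k), mul_comm]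
    exact (single_le_sum (f := fun k => c k * x k)
      (fun j _ => mul_nonneg (hc j).le (hx0 j)) (mem_univ k)).trans hle
  obtain ⟨x, hx, hmin⟩ := hK.exists_isMinOn ⟨x₀, hx₀, le_rfl⟩ hcont.continuousOn
  have hopt : I.IsOptimal c x := by
    refine ⟨hx.1, fun y hy => ?_⟩
    by_cases hle : ∑ k, c k * y k ≤ ∑ k, c k * x₀ k
    · exact hmin ⟨hy, hle⟩
    · exact hx.2.trans (le_of_not_ge hle)
  obtain ⟨β, hβ, -, hr⟩ := hopt.exists_basis hI
  exact ⟨β, hβ, hr⟩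

/-- Two optimal bases have the same reduced costs. -/
theorem IsFeasibleBasis.reducedCost_eq_of_nonneg (hI : I.InGeneralPosition)
    {β β' : Fin d → Fin d × Fin d} (h : I.IsFeasibleBasis β) (h' : I.IsFeasibleBasis β')
    {c : Fin d × Fin d → ℝ} (hr : ∀ k, 0 ≤ I.reducedCost β c k)
    (hr' : ∀ k, 0 ≤ I.reducedCost β' c k) : I.reducedCost β' c = I.reducedCost β c := by
  have hopt : I.IsOptimal c (I.basicSol β') := (h'.isOptimal_iff hr').2
    ⟨h'.basicSol_mem, fun k hk => by
      by_cases hkβ : k ∈ Set.range β'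
      · obtain ⟨l, rfl⟩ := hkβ
        exact I.reducedCost_basis h'.1 c l
      · exact absurd (basicSol_of_notMem hkβ) hk⟩
  exact I.reducedCost_congr h'.1 fun l =>
    ((h.isOptimal_iff hr).1 hopt).2 _ (h'.basicSol_pos hI l).ne'

/-- The pivot step: if the cost is positive and the reduced cost of `k` is zero, then
there is exactly one other basis within `range β ∪ {k}`; it contains `k`. -/
theorem IsFeasibleBasis.exists_pivot (hI : I.InGeneralPosition)
    {β : Fin d → Fin d × Fin d} (h : I.IsFeasibleBasis β) {c : Fin d × Fin d → ℝ}
    (hc : ∀ k, 0 < c k) {k : Fin d × Fin d} (hk : k ∉ Set.range β)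
    (hrk : I.reducedCost β c k = 0) :
    ∃ l, (∃ β', I.IsFeasibleBasis β' ∧ Set.range β' = insert k (Set.range β) \ {β l}) ∧
      ∀ β' l', I.IsFeasibleBasis β' → Set.range β' ⊆ insert k (Set.range β) \ {β l'} → l' = l := by
  classical
  have hinj := h.injective
  have hzero : ∀ j, j ∉ Set.range β → j ≠ k → ∀ t : ℝ,
      I.basicSol β j + t * I.edgeDir β k j = 0 := by
    intro j hj hjk t
    rw [basicSol_of_notMem hj, edgeDir_of_notMem hj hjk]
    simp
  have hcost : ∑ j, c j * I.edgeDir β k j = 0 := by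
    rw [I.sum_cost_eq β c, h.sum_edgeDir, dotProduct_zero, zero_add]
    refine sum_eq_zero fun j _ => ?_
    by_cases hj : j ∈ Set.range β
    · obtain ⟨l, rfl⟩ := hj
      rw [I.reducedCost_basis h.1, zero_mul]
    · by_cases hjk : j = k
      · rw [hjk, hrk, zero_mul]
      · rw [edgeDir_of_notMem hj hjk, mul_zero]
  -- The edge direction has total cost zero but entry `1` at `k`; positive costs force a negative
  -- entry, so the edge is bounded.
  have hneg : ∃ j, I.edgeDir β k j < 0 := by
    by_contra hcon
    push Not at hcon
    have h1 := (sum_eq_zero_iff_of_nonneg (fun j _ => mul_nonneg (hc j).le (hcon j))).1 hcost k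
      (mem_univ k)
    rw [edgeDir_self hk, mul_one] at h1
    exact (hc k).ne' h1
  have hnegβ : ∀ j, I.edgeDir β k j < 0 → j ∈ Set.range β := by
    intro j hj
    by_contra hjβ
    by_cases hjk : j = k
    · rw [hjk, edgeDir_self hk] at hj
      linarith
    · rw [edgeDir_of_notMem hjβ hjk] at hj
      exact hj.false
  obtain ⟨t, ht, hnn, j, hj, hjt⟩ := exists_first_zero (I.basicSol β) (I.edgeDir β k)
    (I.mem_polyhedron.1 h.basicSol_mem).2 (by
      intro j hj
      obtain ⟨l, rfl⟩ := hnegβ j hj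
      exact h.basicSol_pos hI l) hneg
  obtain ⟨l, rfl⟩ := hnegβ j hj
  refine ⟨l, ?_, ?_⟩
  · have hmem : (fun j => I.basicSol β j + t * I.edgeDir β k j) ∈ I.polyhedron :=
      I.mem_polyhedron.2 ⟨h.sum_edge k t, hnn⟩
    obtain ⟨β', hβ', hs⟩ := hI.exists_feasibleBasis hmem
    refine ⟨β', hβ', ?_⟩
    have hsub : univ.image β' ⊆ (insert k (univ.image β)).erase (β l) := by
      intro j
      simp only [mem_image, mem_univ, true_and, mem_erase, mem_insert]
      rintro ⟨l', rfl⟩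
      refine ⟨fun hl' => hs l' (by rw [hl']; exact hjt), ?_⟩
      by_contra hcon
      push Not at hcon
      exact hs l' (hzero _ (by simpa using hcon.2) hcon.1 t)
    have heq := eq_of_subset_of_card_le hsub (by
      rw [card_erase_of_mem (by simp), card_insert_of_notMem (by simpa using hk),
        card_image_of_injective _ hinj, card_image_of_injective _ hβ'.injective]
      simp)
    have := congrArg (fun s : Finset (Fin d × Fin d) => (s : Set (Fin d × Fin d))) heq
    simpa using this
  · intro β' l' hβ' hsub
    set x := I.basicSol β' with hx
    have hxβ : ∀ j, j ∉ Set.range β → j ≠ k → x j = 0 := fun j hj hjk =>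
      basicSol_of_notMem fun hj' => by
        rcases (hsub hj').1 with h1 | h1
        · exact hjk h1
        · exact hj h1
    -- Any solution supported in `range β ∪ {k}` lies on the line of the edge; the vanishing entry
    -- at `β l'` then forces the parameter `t`.
    have hline : x = fun j => I.basicSol β j + x k * I.edgeDir β k j := by
      refine I.solution_unique h.1 ?_ fun j hj => ?_
      · rw [h.sum_edge, hβ'.sum_basicSol]
      · by_cases hjk : j = k
        · rw [hjk, basicSol_of_notMem hk, edgeDir_self hk]
          ring
        · rw [hxβ j hj hjk, hzero j hj hjk]
    have hl0 : x (β l') = 0 := basicSol_of_notMem fun hl' => (hsub hl').2 rfl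
    have hxl : 0 ≤ x (β l) := (I.mem_polyhedron.1 hβ'.basicSol_mem).2 _
    have hxk : 0 ≤ x k := (I.mem_polyhedron.1 hβ'.basicSol_mem).2 _
    have h1 : I.basicSol β (β l') + x k * I.edgeDir β k (β l') = 0 := by
      rw [← hl0]; exact (congrFun hline _).symm
    have h2 : 0 ≤ I.basicSol β (β l) + x k * I.edgeDir β k (β l) := by
      rw [← congrFun hline (β l)]; exact hxl
    have hp' := h.basicSol_pos hI l'
    have hneg' : I.edgeDir β k (β l') < 0 := by
      by_contra hcon
      push Not at hcon
      have := mul_nonneg hxk hcon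
      linarith
    have hle : x k ≤ t := by nlinarith
    have hge : t ≤ x k := by
      have := hnn (β l')
      nlinarith
    have hxt : x k = t := le_antisymm hle hge
    -- Two different entries vanishing together would leave only `d - 1` possible nonzero ones.
    by_contra hne
    have hlz : x (β l) = 0 := by
      rw [congrFun hline (β l), hxt]; exact hjt
    have := hI.le_card_support hβ'.basicSol_mem
      (s := ((insert k (univ.image β)).erase (β l)).erase (β l')) (by
        intro j hj
        simp only [mem_erase, mem_insert, mem_image, mem_univ, true_and]
        refine ⟨fun hjl => hj (by rw [hjl]; exact hl0), fun hjl => hj (by rw [hjl]; exact hlz), ?_⟩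
        by_contra hcon
        push Not at hcon
        exact hj (hxβ j (by simpa using hcon.2) hcon.1))
    rw [card_erase_of_mem (by simp [hinj.ne hne]), card_erase_of_mem (by simp),
      card_insert_of_notMem (by simpa using hk), card_image_of_injective _ hinj] at this
    have hd := hI.d_pos
    simp at this
    omega

end ColorInstance

/-! ### Size estimates: expensive colors are never used -/

namespace ColorInstance

variable {d : ℕ} {I : ColorInstance d}

theorem abs_pts_le (I : ColorInstance d) (k : Fin d × Fin d) (r : Fin d) :
    |I.pts k.1 k.2 r| ≤ (I.maxEntry : ℤ) := by
  rw [Int.abs_eq_natAbs]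
  norm_cast
  refine le_trans ?_ (le_max_left _ _)
  exact (le_sup (f := fun r => (I.pts k.1 k.2 r).natAbs) (mem_univ r)).trans
    (le_sup (f := fun k : Fin d × Fin d => univ.sup fun r => (I.pts k.1 k.2 r).natAbs)
      (mem_univ k))

theorem abs_target_le (I : ColorInstance d) (r : Fin d) : |I.target r| ≤ (I.maxEntry : ℤ) := by
  rw [Int.abs_eq_natAbs]
  norm_cast
  refine le_trans ?_ (le_max_right _ _)
  exact le_sup (f := fun r => (I.target r).natAbs) (mem_univ r)

theorem InGeneralPosition.N_pos (hI : I.InGeneralPosition) : 0 < I.N := by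
  obtain ⟨r, hr⟩ := Function.ne_iff.1 hI.target_ne_zero
  have h1 := I.abs_target_le r
  have h2 : 0 < |I.target r| := abs_pos.2 hr
  have : 0 < I.maxEntry := by omega
  exact Nat.mul_pos (Nat.factorial_pos d) (pow_pos this d)

theorem abs_det_le_N (I : ColorInstance d) {M : Matrix (Fin d) (Fin d) ℤ}
    (hM : ∀ i j, |M i j| ≤ (I.maxEntry : ℤ)) : |M.det| ≤ (I.N : ℤ) := by
  have := Matrix.det_le (abv := (AbsoluteValue.abs : AbsoluteValue ℤ ℤ)) (A := M)
    (x := (I.maxEntry : ℤ)) hM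
  simpa [N] using this

/-- By Cramer's rule the entries of a basic solution are quotients of bounded integers. -/
theorem IsFeasibleBasis.basicSol_bounds (hI : I.InGeneralPosition) {β : Fin d → Fin d × Fin d}
    (h : I.IsFeasibleBasis β) (l : Fin d) :
    I.basicSol β (β l) ≤ I.N ∧ 1 ≤ I.N * I.basicSol β (β l) := by
  set M : Matrix (Fin d) (Fin d) ℤ := Matrix.of fun r l => I.pts (β l).1 (β l).2 r with hM
  have hAM : I.A.submatrix id β = M.map (Int.cast : ℤ → ℝ) := rfl
  have hx : I.basicSol β (β l) = (I.A.submatrix id β)⁻¹.mulVec I.b l :=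
    extendBasis_apply h.injective _ _
  have hcr := congrFun (Matrix.det_smul_inv_mulVec_eq_cramer _ I.b h.1) l
  rw [Matrix.cramer_apply, Pi.smul_apply, ← hx, smul_eq_mul] at hcr
  have h1 : (I.A.submatrix id β).det = ((M.det : ℤ) : ℝ) := by
    rw [hAM]
    exact ((Int.castRingHom ℝ).map_det M).symm
  have h2 : ((I.A.submatrix id β).updateCol l I.b).det =
      (((M.updateCol l I.target).det : ℤ) : ℝ) := by
    refine Eq.trans ?_ ((Int.castRingHom ℝ).map_det _).symm
    congr 1
    ext r j
    by_cases hj : j = l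
    · subst hj
      simp [b]
    · simp [hj, hAM]
  have b1 : |M.det| ≤ (I.N : ℤ) := I.abs_det_le_N fun i j => I.abs_pts_le (β j) i
  have b2 : |(M.updateCol l I.target).det| ≤ (I.N : ℤ) := I.abs_det_le_N fun i j => by
    by_cases hj : j = l
    · subst hj
      simpa using I.abs_target_le i
    · simpa [hj, hM] using I.abs_pts_le (β j) i
  have hpos := h.basicSol_pos hI l
  rw [h1, h2] at hcr
  set x := I.basicSol β (β l)
  set D := M.det
  set D' := (M.updateCol l I.target).det
  have hD : D ≠ 0 := by
    have := h.1.ne_zero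
    rw [h1] at this
    exact_mod_cast this
  have hD' : D' ≠ 0 := by
    have : (D : ℝ) * x ≠ 0 := mul_ne_zero (by exact_mod_cast hD) hpos.ne'
    rw [hcr] at this
    exact_mod_cast this
  have e1 : (1 : ℝ) ≤ |(D : ℝ)| := by exact_mod_cast Int.one_le_abs hD
  have e2 : (1 : ℝ) ≤ |(D' : ℝ)| := by exact_mod_cast Int.one_le_abs hD'
  have e3 : |(D : ℝ)| ≤ I.N := by exact_mod_cast b1
  have e4 : |(D' : ℝ)| ≤ I.N := by exact_mod_cast b2
  have e5 : |(D : ℝ)| * x = |(D' : ℝ)| := by rw [← hcr, abs_mul, abs_of_pos hpos]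
  constructor <;> nlinarith

theorem cost_pos {ε : ℝ} (hε : 0 < ε) {μ : Fin d → ℝ} (hμ : ∀ i, μ i ≤ 1)
    (k : Fin d × Fin d) : 0 < I.cost ε μ k := by
  have h1 : 0 ≤ 1 - μ k.1 := by linarith [hμ k.1]
  rw [cost]
  positivity

theorem InGeneralPosition.exists_class_basis (hI : I.InGeneralPosition) (i : Fin d) :
    ∃ β, I.IsFeasibleBasis β ∧ ∀ l, (β l).1 = i := by
  obtain ⟨u, hu0, hu⟩ := (rayEmbraces_range_iff _ _).1 (hI.class_embraces i)
  have hmem : extendBasis (fun l => (i, l)) u ∈ I.polyhedron := by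
    refine I.mem_polyhedron.2 ⟨?_, fun k => ?_⟩
    · rw [sum_extendBasis, ← hu]
      ext r
      simp [Matrix.mulVec, dotProduct, A, mul_comm]
    · change 0 ≤ ∑ l, if (i, l) = k then u l else 0
      exact sum_nonneg fun l _ => by split_ifs; exacts [hu0 l, le_rfl]
  obtain ⟨β, hβ, hs⟩ := hI.exists_feasibleBasis hmem
  refine ⟨β, hβ, fun l => ?_⟩
  by_contra hne
  exact hs l (extendBasis_of_notMem _ (by rintro ⟨j, hj⟩; exact hne (hj ▸ rfl)))

/-- If the color `i` is cheap, then an optimal basis does not contain columns of an expensive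
color. -/
theorem IsFeasibleBasis.color_ne_of_optimal (hI : I.InGeneralPosition) {ε : ℝ} (hε : 0 < ε)
    (hεN : ε ≤ ((I.N : ℝ) ^ 3)⁻¹) {μ : Fin d → ℝ} (hμ : ∀ i, μ i ≤ 1) {i : Fin d}
    (hi : μ i = 1) {β : Fin d → Fin d × Fin d} (h : I.IsFeasibleBasis β)
    (hr : ∀ k, 0 ≤ I.reducedCost β (I.cost ε μ) k) (l : Fin d) : μ (β l).1 ≠ 0 := by
  intro h0
  have hN1 : (1 : ℝ) ≤ I.N := by exact_mod_cast hI.N_pos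
  have hd1 : (1 : ℝ) ≤ d := by exact_mod_cast hI.d_pos
  have hε1 : ε ≤ 1 := hεN.trans (inv_le_one_of_one_le₀ (one_le_pow₀ hN1))
  have hopt : I.IsOptimal (I.cost ε μ) (I.basicSol β) := (h.isOptimal_iff hr).2
    ⟨h.basicSol_mem, fun k hk => by
      by_cases hkβ : k ∈ Set.range β
      · obtain ⟨l, rfl⟩ := hkβ
        exact I.reducedCost_basis h.1 _ l
      · exact absurd (basicSol_of_notMem hkβ) hk⟩
  -- The competitor: a basis inside the cheap color costs at most `d (1 + ε) N`, whereas each column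
  -- of `β` contributes at least `1 / N` times its cost.
  obtain ⟨β', hβ', hβi⟩ := hI.exists_class_basis i
  have hle := hopt.2 _ hβ'.basicSol_mem
  have hsum : ∀ γ : Fin d → Fin d × Fin d, I.IsFeasibleBasis γ →
      ∑ k, I.cost ε μ k * I.basicSol γ k = ∑ l, I.cost ε μ (γ l) * I.basicSol γ (γ l) := by
    intro γ hγ
    rw [← sum_image (f := fun k => I.cost ε μ k * I.basicSol γ k) (s := univ) (g := γ)
      fun a _ b _ hab => hγ.injective hab]
    refine (sum_subset (subset_univ _) fun k _ hk => ?_).symm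
    rw [basicSol_of_notMem (by simpa using hk), mul_zero]
  rw [hsum β h, hsum _ hβ'] at hle
  have hup : ∑ l, I.cost ε μ (β' l) * I.basicSol β' (β' l) ≤ ∑ _l : Fin d, (1 + ε) * I.N := by
    refine sum_le_sum fun l _ => ?_
    have hb := (hβ'.basicSol_bounds hI l).1
    have hp := hβ'.basicSol_pos hI l
    refine mul_le_mul ?_ hb hp.le (by positivity)
    have : ε ^ (((β' l).1 : ℕ) * d + ((β' l).2 : ℕ) + 1) ≤ ε :=
      pow_le_of_le_one hε.le hε1 (by omega)
    rw [cost, hβi l, hi, ← hβi l]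
    linarith
  have hlow : ∑ j, (1 + if j = l then d * (I.N : ℝ) ^ 2 +
      ε ^ (((β l).1 : ℕ) * d + ((β l).2 : ℕ) + 1) else 0) ≤
      I.N * ∑ l, I.cost ε μ (β l) * I.basicSol β (β l) := by
    rw [mul_sum]
    refine sum_le_sum fun j _ => ?_
    have h1 := (h.basicSol_bounds hI j).2
    have h2 := I.cost_pos hε hμ (β j)
    have h3 : I.cost ε μ (β j) ≤ I.N * (I.cost ε μ (β j) * I.basicSol β (β j)) := by nlinarith
    refine le_trans ?_ h3
    split_ifs with hj
    · subst hj
      rw [cost, h0]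
      linarith
    · have h4 : 0 ≤ 1 - μ (β j).1 := by linarith [hμ (β j).1]
      have h5 : 0 ≤ (1 - μ (β j).1) * d * (I.N : ℝ) ^ 2 := by positivity
      rw [cost]
      have := pow_pos hε (((β j).1 : ℕ) * d + ((β j).2 : ℕ) + 1)
      linarith
  simp only [sum_add_distrib, sum_const, card_univ, Fintype.card_fin, nsmul_eq_mul, mul_one,
    sum_ite_eq', mem_univ, if_true] at hup hlow
  have hε3 : ε * (I.N : ℝ) ^ 3 ≤ 1 := by
    rwa [← le_div_iff₀ (by positivity), one_div]
  have hε2 : ε * (I.N : ℝ) ^ 2 ≤ 1 := by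
    refine le_trans ?_ hε3
    exact mul_le_mul_of_nonneg_left (pow_le_pow_right₀ hN1 (by norm_num)) hε.le
  have hεk := pow_pos hε (((β l).1 : ℕ) * d + ((β l).2 : ℕ) + 1)
  -- Multiplied by `N`, the estimates give `d + d N² + ε^j ≤ d N² + d ε N²`. Since `ε N² ≤ 1`, the
  -- positive term `ε^j` yields the contradiction, even in the borderline case.
  have h6 := mul_le_mul_of_nonneg_left (hle.trans hup) (by positivity : (0 : ℝ) ≤ I.N)
  have h7 : (d : ℝ) * (ε * (I.N : ℝ) ^ 2) ≤ d * 1 :=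
    mul_le_mul_of_nonneg_left hε2 (by positivity)
  linarith

end ColorInstance

/-! ### Cells as sets of tight constraints -/

/-- The indices of the constraints on a parameter vector: the reduced costs of the columns, the
lower bounds `0 ≤ μ i`, and the upper bounds `μ i ≤ 1`. -/
abbrev ConstraintIdx (d : ℕ) := (Fin d × Fin d) ⊕ (Fin d ⊕ Fin d)

/-- The index of the constraint that the column `k` has nonnegative reduced cost. -/
abbrev redIdx {d : ℕ} (k : Fin d × Fin d) : ConstraintIdx d := Sum.inl k

/-- The index of the constraint `0 ≤ μ i`. -/
abbrev zeroIdx {d : ℕ} (i : Fin d) : ConstraintIdx d := Sum.inr (Sum.inl i)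

/-- The index of the constraint `μ i ≤ 1`. -/
abbrev oneIdx {d : ℕ} (i : Fin d) : ConstraintIdx d := Sum.inr (Sum.inr i)

/-- Computes a dimension from one relatively interior point: a short move in any direction of `K`
stays in `X`, and rescaling puts the direction into the span. -/
theorem vectorSpan_eq_of_relative_interior {d : ℕ} {X : Set (Fin d → ℝ)}
    {K : Submodule ℝ (Fin d → ℝ)} {μ : Fin d → ℝ} (hμ : μ ∈ X) (h1 : ∀ ν ∈ X, ν - μ ∈ K)
    (h2 : ∀ w ∈ K, ∃ t : ℝ, 0 < t ∧ μ + t • w ∈ X) : vectorSpan ℝ X = K := by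
  apply le_antisymm
  · rw [vectorSpan_eq_span_vsub_set_right ℝ hμ, Submodule.span_le]
    rintro _ ⟨ν, hν, rfl⟩
    exact h1 ν hν
  · intro w hw
    obtain ⟨t, ht, hX⟩ := h2 w hw
    have := vsub_mem_vectorSpan ℝ hX hμ
    rw [vsub_eq_sub, add_sub_cancel_left] at this
    exact (Submodule.smul_mem_iff _ ht.ne').1 this

namespace ColorInstance

variable {d : ℕ} (I : ColorInstance d)

theorem reducedCost_add (β : Fin d → Fin d × Fin d) (c c' : Fin d × Fin d → ℝ)
    (k : Fin d × Fin d) :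
    I.reducedCost β (c + c') k = I.reducedCost β c k + I.reducedCost β c' k := by
  have : (c + c') ∘ β = c ∘ β + c' ∘ β := rfl
  rw [reducedCost, reducedCost, reducedCost, this, add_dotProduct, Pi.add_apply]
  ring

theorem reducedCost_smul (β : Fin d → Fin d × Fin d) (t : ℝ) (c : Fin d × Fin d → ℝ)
    (k : Fin d × Fin d) : I.reducedCost β (t • c) k = t * I.reducedCost β c k := by
  have : (t • c) ∘ β = t • (c ∘ β) := rfl
  rw [reducedCost, reducedCost, this, smul_dotProduct, Pi.smul_apply, smul_eq_mul, smul_eq_mul]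
  ring

/-- The linear part of the cost vector as a function of the parameter vector. -/
noncomputable def costLin (w : Fin d → ℝ) (k : Fin d × Fin d) : ℝ :=
  -(w k.1) * d * (I.N : ℝ) ^ 2

theorem cost_add (ε : ℝ) (μ w : Fin d → ℝ) : I.cost ε (μ + w) = I.cost ε μ + I.costLin w := by
  ext k
  simp only [cost, costLin, Pi.add_apply]
  ring

/-- The slacks of the constraints on the parameter vector `μ` that belong to the basis `β`. -/
noncomputable def slack (ε : ℝ) (β : Fin d → Fin d × Fin d) (μ : Fin d → ℝ) :
    ConstraintIdx d → ℝ :=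
  Sum.elim (I.reducedCost β (I.cost ε μ)) (Sum.elim μ (1 - μ))

@[simp] theorem slack_redIdx (ε : ℝ) (β : Fin d → Fin d × Fin d) (μ : Fin d → ℝ)
    (k : Fin d × Fin d) : I.slack ε β μ (redIdx k) = I.reducedCost β (I.cost ε μ) k := rfl

@[simp] theorem slack_zeroIdx (ε : ℝ) (β : Fin d → Fin d × Fin d) (μ : Fin d → ℝ)
    (i : Fin d) : I.slack ε β μ (zeroIdx i) = μ i := rfl

@[simp] theorem slack_oneIdx (ε : ℝ) (β : Fin d → Fin d × Fin d) (μ : Fin d → ℝ)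
    (i : Fin d) : I.slack ε β μ (oneIdx i) = 1 - μ i := rfl

/-- The linear part of the slacks. -/
noncomputable def slackLin (β : Fin d → Fin d × Fin d) :
    (Fin d → ℝ) →ₗ[ℝ] ConstraintIdx d → ℝ where
  toFun w := Sum.elim (I.reducedCost β (I.costLin w)) (Sum.elim w (-w))
  map_add' w w' := by
    have : I.costLin (w + w') = I.costLin w + I.costLin w' := by
      ext k
      simp only [costLin, Pi.add_apply]
      ring
    ext (k | i | i)
    · simp [this, reducedCost_add]
    · simp
    · simp only [neg_add_rev, Sum.elim_inr, Pi.add_apply, Pi.neg_apply]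
      ring
  map_smul' t w := by
    have : I.costLin (t • w) = t • I.costLin w := by
      ext k
      simp only [costLin, Pi.smul_apply, smul_eq_mul]
      ring
    ext (k | i | i)
    · simp [this, reducedCost_smul]
    · simp
    · simp

@[simp] theorem slackLin_redIdx (β : Fin d → Fin d × Fin d) (w : Fin d → ℝ)
    (k : Fin d × Fin d) : I.slackLin β w (redIdx k) = I.reducedCost β (I.costLin w) k := rfl

@[simp] theorem slackLin_zeroIdx (β : Fin d → Fin d × Fin d) (w : Fin d → ℝ)
    (i : Fin d) : I.slackLin β w (zeroIdx i) = w i := rfl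

@[simp] theorem slackLin_oneIdx (β : Fin d → Fin d × Fin d) (w : Fin d → ℝ)
    (i : Fin d) : I.slackLin β w (oneIdx i) = -w i := rfl

theorem slack_add (ε : ℝ) (β : Fin d → Fin d × Fin d) (μ w : Fin d → ℝ) (e : ConstraintIdx d) :
    I.slack ε β (μ + w) e = I.slack ε β μ e + I.slackLin β w e := by
  rcases e with k | i | i
  · simp [cost_add, reducedCost_add]
  · simp
  · simp only [slack_oneIdx, Pi.add_apply, slackLin_oneIdx]
    ring

theorem slack_add_smul (ε : ℝ) (β : Fin d → Fin d × Fin d) (μ w : Fin d → ℝ) (t : ℝ)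
    (e : ConstraintIdx d) :
    I.slack ε β (μ + t • w) e = I.slack ε β μ e + t * I.slackLin β w e := by
  rw [slack_add, map_smul, Pi.smul_apply, smul_eq_mul]

/-- The linear parts of the slacks with index in `s`. -/
noncomputable def slackRestrict (β : Fin d → Fin d × Fin d) (s : Finset (ConstraintIdx d)) :
    (Fin d → ℝ) →ₗ[ℝ] s → ℝ :=
  LinearMap.funLeft ℝ ℝ Subtype.val ∘ₗ I.slackLin β

theorem mem_ker_slackRestrict {β : Fin d → Fin d × Fin d} {s : Finset (ConstraintIdx d)}
    {w : Fin d → ℝ} :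
    w ∈ LinearMap.ker (I.slackRestrict β s) ↔ ∀ e ∈ s, I.slackLin β w e = 0 := by
  rw [LinearMap.mem_ker, funext_iff, Subtype.forall]
  rfl

variable {I} {ε : ℝ}

theorem setDim_slack_eq_zero {β : Fin d → Fin d × Fin d} {s : Finset (ConstraintIdx d)}
    {μ : Fin d → ℝ} (hμ : ∀ e ∈ s, I.slack ε β μ e = 0) :
    setDim {ν | ∀ e ∈ s, I.slack ε β ν e = 0} =
      Module.finrank ℝ (LinearMap.ker (I.slackRestrict β s)) := by
  have hμ' : μ ∈ {ν | ∀ e ∈ s, I.slack ε β ν e = 0} := hμ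
  rw [setDim, vectorSpan_eq_of_relative_interior (K := LinearMap.ker (I.slackRestrict β s)) hμ']
  · intro ν hν
    rw [mem_ker_slackRestrict]
    intro e he
    have := I.slack_add ε β μ (ν - μ) e
    rw [add_sub_cancel, hν e he, hμ e he] at this
    linarith
  · intro w hw
    rw [mem_ker_slackRestrict] at hw
    refine ⟨1, one_pos, fun e he => ?_⟩
    rw [slack_add_smul, hμ e he, hw e he]
    ring

theorem slack_system_eq (β : Fin d → Fin d × Fin d) (J : Finset (Fin d × Fin d))
    (I₀ I₁ : Finset (Fin d)) :
    {μ : Fin d → ℝ | (∀ k ∈ J, I.reducedCost β (I.cost ε μ) k = 0) ∧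
        (∀ i ∈ I₀, μ i = 0) ∧ ∀ i ∈ I₁, μ i = 1} =
      {ν | ∀ e ∈ J.disjSum (I₀.disjSum I₁), I.slack ε β ν e = 0} := by
  ext μ
  constructor
  · rintro ⟨h1, h2, h3⟩ (k | i | i) he
    · exact h1 k (inl_mem_disjSum.1 he)
    · exact h2 i (inl_mem_disjSum.1 (inr_mem_disjSum.1 he))
    · rw [slack_oneIdx, h3 i (inr_mem_disjSum.1 (inr_mem_disjSum.1 he)), sub_self]
  · intro h
    refine ⟨fun k hk => h (redIdx k) (inl_mem_disjSum.2 hk),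
      fun i hi => h (zeroIdx i) (inr_mem_disjSum.2 (inl_mem_disjSum.2 hi)), fun i hi => ?_⟩
    have := h (oneIdx i) (inr_mem_disjSum.2 (inr_mem_disjSum.2 hi))
    rw [slack_oneIdx] at this
    linarith

/-- For a suitable perturbation, the constraints that are tight at a parameter vector are
independent. -/
theorem IsSuitable.finrank_ker (hs : I.IsSuitable ε) {β : Fin d → Fin d × Fin d}
    (hβ : I.IsFeasibleBasis β) {s : Finset (ConstraintIdx d)} {μ : Fin d → ℝ}
    (h0 : ∀ e ∈ s, I.slack ε β μ e = 0) (hb : ∀ l, redIdx (β l) ∉ s) :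
    Module.finrank ℝ (LinearMap.ker (I.slackRestrict β s)) + s.card = d := by
  have hsum : s.toLeft.disjSum (s.toRight.toLeft.disjSum s.toRight.toRight) = s := by
    rw [toLeft_disjSum_toRight, toLeft_disjSum_toRight]
  have h := hs β hβ s.toLeft (by rintro _ hk ⟨l, rfl⟩; exact hb l (mem_toLeft.1 hk))
    s.toRight.toLeft s.toRight.toRight
  simp only at h
  rw [slack_system_eq, hsum] at h
  have h1 := h ⟨μ, h0⟩
  rw [setDim_slack_eq_zero h0] at h1
  have h2 := card_toLeft_add_card_toRight (u := s)
  have h3 := card_toLeft_add_card_toRight (u := s.toRight)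
  omega

/-- Rank-nullity turns the dimension formula into the freedom to prescribe the rates of change of
the tight slacks. -/
theorem IsSuitable.surjective (hs : I.IsSuitable ε) {β : Fin d → Fin d × Fin d}
    (hβ : I.IsFeasibleBasis β) {s : Finset (ConstraintIdx d)} {μ : Fin d → ℝ}
    (h0 : ∀ e ∈ s, I.slack ε β μ e = 0) (hb : ∀ l, redIdx (β l) ∉ s) :
    Function.Surjective (I.slackRestrict β s) := by
  rw [← LinearMap.range_eq_top]
  apply Submodule.eq_top_of_finrank_eq
  have h1 := hs.finrank_ker hβ h0 hb
  have h2 := (I.slackRestrict β s).finrank_range_add_finrank_ker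
  simp only [Module.finrank_fintype_fun_eq_card, Fintype.card_fin, Fintype.card_coe] at h2 ⊢
  omega

theorem slackLin_basis {β : Fin d → Fin d × Fin d} (hβ : I.IsFeasibleBasis β) (w : Fin d → ℝ)
    (l : Fin d) : I.slackLin β w (redIdx (β l)) = 0 :=
  I.reducedCost_basis hβ.1 _ l

theorem slack_basis {β : Fin d → Fin d × Fin d} (hβ : I.IsFeasibleBasis β) (μ : Fin d → ℝ)
    (l : Fin d) : I.slack ε β μ (redIdx (β l)) = 0 :=
  I.reducedCost_basis hβ.1 _ l

/-- `a` is the set of the tight constraints at `μ` for an optimal basis. -/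
def IsType (I : ColorInstance d) (ε : ℝ) (μ : Fin d → ℝ) (a : Finset (ConstraintIdx d)) : Prop :=
  ∃ β, I.IsFeasibleBasis β ∧ (∀ e, 0 ≤ I.slack ε β μ e) ∧ ∀ e, e ∈ a ↔ I.slack ε β μ e = 0

/-- The sets of tight constraints at the points of `M`. -/
def IsCell (I : ColorInstance d) (ε : ℝ) (a : Finset (ConstraintIdx d)) : Prop :=
  (∃ μ, I.IsType ε μ a) ∧ ∃ i, oneIdx i ∈ a

theorem slack_congr {β β' : Fin d → Fin d × Fin d} (hβ' : I.IsFeasibleBasis β') {μ : Fin d → ℝ}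
    (h : ∀ l, I.slack ε β μ (redIdx (β' l)) = 0) : I.slack ε β' μ = I.slack ε β μ := by
  rw [slack, slack, I.reducedCost_congr hβ'.1 h]

/-- Any basis of tight columns has the same reduced costs as the witnessing one, so it can replace
it. -/
theorem IsType.of_basis {μ : Fin d → ℝ} {a : Finset (ConstraintIdx d)} (h : I.IsType ε μ a)
    {β : Fin d → Fin d × Fin d} (hβ : I.IsFeasibleBasis β) (ha : ∀ l, redIdx (β l) ∈ a) :
    (∀ e, 0 ≤ I.slack ε β μ e) ∧ ∀ e, e ∈ a ↔ I.slack ε β μ e = 0 := by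
  obtain ⟨β', hβ', h1, h2⟩ := h
  rw [slack_congr hβ fun l => (h2 _).1 (ha l)]
  exact ⟨h1, h2⟩

theorem IsType.unique (hI : I.InGeneralPosition) {μ : Fin d → ℝ} {a a' : Finset (ConstraintIdx d)}
    (h : I.IsType ε μ a) (h' : I.IsType ε μ a') : a = a' := by
  obtain ⟨β, hβ, h1, h2⟩ := h
  obtain ⟨β', hβ', h1', h2'⟩ := h'
  have := hβ.reducedCost_eq_of_nonneg hI hβ' (fun k => h1 (redIdx k)) fun k => h1' (redIdx k)
  ext e
  rw [h2, h2', slack, slack, this]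

theorem IsType.exists_basis {μ : Fin d → ℝ} {a : Finset (ConstraintIdx d)} (h : I.IsType ε μ a) :
    ∃ β, I.IsFeasibleBasis β ∧ ∀ l, redIdx (β l) ∈ a := by
  obtain ⟨β, hβ, -, h2⟩ := h
  exact ⟨β, hβ, fun l => (h2 _).2 (slack_basis hβ μ l)⟩

theorem IsType.mem_zero_iff {μ : Fin d → ℝ} {a : Finset (ConstraintIdx d)} (h : I.IsType ε μ a)
    (i : Fin d) : zeroIdx i ∈ a ↔ μ i = 0 := by
  obtain ⟨β, -, -, h2⟩ := h
  exact h2 _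

theorem IsType.mem_one_iff {μ : Fin d → ℝ} {a : Finset (ConstraintIdx d)} (h : I.IsType ε μ a)
    (i : Fin d) : oneIdx i ∈ a ↔ μ i = 1 := by
  obtain ⟨β, -, -, h2⟩ := h
  rw [h2, slack_oneIdx, sub_eq_zero, eq_comm]

theorem IsType.le_one {μ : Fin d → ℝ} {a : Finset (ConstraintIdx d)} (h : I.IsType ε μ a)
    (i : Fin d) : μ i ≤ 1 := by
  obtain ⟨β, -, h1, -⟩ := h
  have := h1 (oneIdx i)
  rw [slack_oneIdx] at this
  linarith

/-- The indices of the basic columns. -/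
def basisIdx (β : Fin d → Fin d × Fin d) : Finset (ConstraintIdx d) :=
  univ.image fun l => redIdx (β l)

theorem mem_basisIdx {β : Fin d → Fin d × Fin d} {e : ConstraintIdx d} :
    e ∈ basisIdx β ↔ ∃ l, redIdx (β l) = e := by
  simp [basisIdx]

theorem IsFeasibleBasis.card_basisIdx {β : Fin d → Fin d × Fin d} (hβ : I.IsFeasibleBasis β) :
    (basisIdx β).card = d := by
  have : Function.Injective fun l => redIdx (β l) := Sum.inl_injective.comp hβ.injective
  rw [basisIdx, card_image_of_injective _ this, card_univ, Fintype.card_fin]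

/-- The `d` basic reduced costs vanish identically, so only the other `a.card - d` constraints cut
down the dimension from `d`. -/
theorem IsSuitable.finrank_ker_add_card (hs : I.IsSuitable ε) {β : Fin d → Fin d × Fin d}
    (hβ : I.IsFeasibleBasis β) {a : Finset (ConstraintIdx d)} {μ : Fin d → ℝ}
    (h0 : ∀ e ∈ a, I.slack ε β μ e = 0) (hb : ∀ l, redIdx (β l) ∈ a) :
    Module.finrank ℝ (LinearMap.ker (I.slackRestrict β a)) + a.card = 2 * d := by
  have hsub : basisIdx β ⊆ a := by
    intro e he
    obtain ⟨l, rfl⟩ := mem_basisIdx.1 he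
    exact hb l
  have h1 := hs.finrank_ker hβ (s := a \ basisIdx β) (fun e he => h0 e (mem_sdiff.1 he).1)
    fun l hl => (mem_sdiff.1 hl).2 (mem_basisIdx.2 ⟨l, rfl⟩)
  have h2 : LinearMap.ker (I.slackRestrict β (a \ basisIdx β)) =
      LinearMap.ker (I.slackRestrict β a) := by
    ext w
    rw [mem_ker_slackRestrict, mem_ker_slackRestrict]
    refine ⟨fun h e he => ?_, fun h e he => h e (mem_sdiff.1 he).1⟩
    by_cases heb : e ∈ basisIdx β
    · obtain ⟨l, rfl⟩ := mem_basisIdx.1 heb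
      exact slackLin_basis hβ w l
    · exact h e (mem_sdiff.2 ⟨he, heb⟩)
  rw [h2] at h1
  have h3 := card_sdiff_add_card_eq_card hsub
  rw [hβ.card_basisIdx] at h3
  omega

theorem IsType.card_le (hs : I.IsSuitable ε) {μ : Fin d → ℝ} {a : Finset (ConstraintIdx d)}
    (h : I.IsType ε μ a) : a.card ≤ 2 * d := by
  obtain ⟨β, hβ, -, h2⟩ := h
  have := hs.finrank_ker_add_card hβ (fun e he => (h2 e).1 he)
    fun l => (h2 _).2 (slack_basis hβ μ l)
  omega

/-- By general position, tight constraints can be relaxed independently. -/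
theorem IsCell.of_subset (hs : I.IsSuitable ε) {a a' : Finset (ConstraintIdx d)}
    (h : I.IsCell ε a) (hsub : a' ⊆ a) {β : Fin d → Fin d × Fin d} (hβ : I.IsFeasibleBasis β)
    (hb : ∀ l, redIdx (β l) ∈ a') (hone : ∃ i, oneIdx i ∈ a') : I.IsCell ε a' := by
  classical
  obtain ⟨⟨μ, hμ⟩, -⟩ := h
  obtain ⟨h1, h2⟩ := hμ.of_basis hβ fun l => hsub (hb l)
  -- A direction that keeps `a'` tight and opens the other constraints of `a` at unit speed. Basic
  -- indices are excluded because their slacks are identically zero.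
  obtain ⟨w, hw⟩ := hs.surjective hβ (s := a \ basisIdx β) (μ := μ)
    (fun e he => (h2 e).1 (mem_sdiff.1 he).1)
    (fun l hl => (mem_sdiff.1 hl).2 (mem_basisIdx.2 ⟨l, rfl⟩))
    (fun e => if (e : ConstraintIdx d) ∈ a' then 0 else 1)
  have hw' : ∀ e ∈ a, I.slackLin β w e = if e ∈ a' then 0 else 1 := by
    intro e he
    by_cases heb : e ∈ basisIdx β
    · obtain ⟨l, rfl⟩ := mem_basisIdx.1 heb
      rw [slackLin_basis hβ, if_pos (hb l)]
    · exact congrFun hw ⟨e, mem_sdiff.2 ⟨he, heb⟩⟩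
  obtain ⟨t, ht, hpos⟩ := exists_pos_forall_add_mul_pos (I.slack ε β μ) (I.slackLin β w)
    (fun e => e ∉ a) fun e he => lt_of_le_of_ne (h1 e) fun h0 => he ((h2 e).2 h0.symm)
  have hin : ∀ e ∈ a', I.slack ε β (μ + t • w) e = 0 := by
    intro e he
    rw [slack_add_smul, (h2 e).1 (hsub he), hw' e (hsub he), if_pos he]
    ring
  have hout : ∀ e, e ∉ a' → 0 < I.slack ε β (μ + t • w) e := by
    intro e he
    rw [slack_add_smul]
    by_cases hea : e ∈ a
    · rw [(h2 e).1 hea, hw' e hea, if_neg he]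
      linarith
    · exact hpos e hea
  refine ⟨⟨μ + t • w, β, hβ, fun e => ?_, fun e => ⟨hin e, fun h0 => ?_⟩⟩, hone⟩
  · by_cases he : e ∈ a'
    · exact (hin e he).ge
    · exact (hout e he).le
  · by_contra he
    exact (hout e he).ne' h0

theorem IsCell.of_between (hs : I.IsSuitable ε) {a p r : Finset (ConstraintIdx d)}
    (hp : I.IsCell ε p) (hr : I.IsCell ε r) (h1 : r ⊆ a) (h2 : a ⊆ p) : I.IsCell ε a := by
  obtain ⟨⟨μ, hμ⟩, i, hi⟩ := hr
  obtain ⟨β, hβ, hb⟩ := hμ.exists_basis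
  exact hp.of_subset hs h2 hβ (fun l => h1 (hb l)) ⟨i, h1 hi⟩

/-- From a point of a one-dimensional cell, the first slack to vanish in direction `w` marks the
endpoint. No second slack can vanish there, as a tight set has at most `2 * d` elements. The last
clause is the uniqueness of the endpoint on this side. -/
theorem exists_endpoint (hs : I.IsSuitable ε) {a : Finset (ConstraintIdx d)}
    (hone : ∃ i, oneIdx i ∈ a) (hcard : a.card + 1 = 2 * d) {β : Fin d → Fin d × Fin d}
    (hβ : I.IsFeasibleBasis β) {μ : Fin d → ℝ} (h1 : ∀ e, 0 ≤ I.slack ε β μ e)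
    (h2 : ∀ e, e ∈ a ↔ I.slack ε β μ e = 0) {w : Fin d → ℝ}
    (hw : ∀ e ∈ a, I.slackLin β w e = 0) (hneg : ∃ e, I.slackLin β w e < 0) :
    ∃ e₁, e₁ ∉ a ∧ I.slackLin β w e₁ < 0 ∧ I.IsCell ε (insert e₁ a) ∧
      ∀ e, e ∉ a → ∀ t : ℝ, 0 < t →
        (∀ e', e' ∈ insert e a ↔ I.slack ε β (μ + t • w) e' = 0) →
        (∀ e', 0 ≤ I.slack ε β (μ + t • w) e') → e = e₁ := by
  classical
  have hlt : ∀ e, I.slackLin β w e < 0 → e ∉ a := fun e he hea => he.ne (hw e hea)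
  have hposa : ∀ e, e ∉ a → 0 < I.slack ε β μ e := fun e he =>
    lt_of_le_of_ne (h1 e) fun h0 => he ((h2 e).2 h0.symm)
  obtain ⟨t, ht, hnn, e₁, he₁, he₁t⟩ := exists_first_zero (I.slack ε β μ) (I.slackLin β w) h1
    (fun e he => hposa e (hlt e he)) hneg
  refine ⟨e₁, hlt _ he₁, he₁, ?_, ?_⟩
  · set p := univ.filter fun e => I.slack ε β (μ + t • w) e = 0 with hp
    have htype : I.IsType ε (μ + t • w) p := by
      refine ⟨β, hβ, fun e => ?_, fun e => by simp [hp]⟩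
      rw [slack_add_smul]
      exact hnn e
    have hsub : insert e₁ a ⊆ p := by
      intro e he
      rw [hp, mem_filter, slack_add_smul]
      refine ⟨mem_univ e, ?_⟩
      rcases mem_insert.1 he with rfl | he
      · exact he₁t
      · rw [(h2 e).1 he, hw e he]
        ring
    have heq : insert e₁ a = p := eq_of_subset_of_card_le hsub (by
      rw [card_insert_of_notMem (hlt _ he₁), hcard]
      exact htype.card_le hs)
    obtain ⟨i, hi⟩ := hone
    exact ⟨⟨_, heq ▸ htype⟩, i, mem_insert_of_mem hi⟩
  · intro e he t' ht' hz hnn'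
    by_contra hne
    have g1 : 0 < I.slack ε β (μ + t' • w) e₁ := by
      refine lt_of_le_of_ne (hnn' e₁) fun h0 => ?_
      rcases mem_insert.1 ((hz e₁).2 h0.symm) with h | h
      · exact hne h.symm
      · exact hlt _ he₁ h
    have g2 := (hz e).1 (mem_insert_self e a)
    rw [slack_add_smul] at g1 g2
    have g3 := hnn e
    have g4 := hposa e he
    have g5 : I.slackLin β w e < 0 := by
      by_contra hcon
      push Not at hcon
      have := mul_nonneg ht'.le hcon
      linarith
    -- `e` is tight at `t'` and nonnegative at `t`, so `t ≤ t'`; `e₁` is tight at `t` and positive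
    -- at `t'`, so `t' < t`.
    nlinarith

/-- A cell of dimension one has exactly two vertices. -/
theorem IsCell.exists_two_vertices (hs : I.IsSuitable ε) {a : Finset (ConstraintIdx d)}
    (h : I.IsCell ε a) (hcard : a.card + 1 = 2 * d) :
    ∃ e₁ e₂, e₁ ≠ e₂ ∧ e₁ ∉ a ∧ e₂ ∉ a ∧
      ∀ e, e ∉ a → (I.IsCell ε (insert e a) ↔ e = e₁ ∨ e = e₂) := by
  classical
  obtain ⟨⟨μ, β, hβ, h1, h2⟩, hone⟩ := h
  have hb : ∀ l, redIdx (β l) ∈ a := fun l => (h2 _).2 (slack_basis hβ μ l)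
  have hfr := hs.finrank_ker_add_card hβ (fun e he => (h2 e).1 he) hb
  have hfr1 : Module.finrank ℝ (LinearMap.ker (I.slackRestrict β a)) = 1 := by omega
  obtain ⟨⟨w, hwK⟩, hw0, hspan⟩ := finrank_eq_one_iff'.1 hfr1
  have hw : ∀ e ∈ a, I.slackLin β w e = 0 := I.mem_ker_slackRestrict.1 hwK
  have hw0' : w ≠ 0 := fun h => hw0 (Subtype.ext h)
  obtain ⟨i, hi⟩ := Function.ne_iff.1 hw0'
  have hwi : w i ≠ 0 := hi
  -- The cube is bounded: a moving coordinate approaches one of its two bounds, in either direction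
  -- along the line.
  have hneg : ∃ e, I.slackLin β w e < 0 := by
    rcases lt_or_gt_of_ne hwi with h | h
    · exact ⟨zeroIdx i, h⟩
    · exact ⟨oneIdx i, by rw [slackLin_oneIdx]; linarith⟩
  have hneg' : ∃ e, I.slackLin β (-w) e < 0 := by
    rcases lt_or_gt_of_ne hwi with h | h
    · exact ⟨oneIdx i, by rw [slackLin_oneIdx, Pi.neg_apply]; linarith⟩
    · exact ⟨zeroIdx i, by rw [slackLin_zeroIdx, Pi.neg_apply]; linarith⟩
  obtain ⟨e₁, he₁, hs₁, hc₁, hu₁⟩ := exists_endpoint hs hone hcard hβ h1 h2 hw hneg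
  obtain ⟨e₂, he₂, hs₂, hc₂, hu₂⟩ := exists_endpoint hs hone hcard hβ h1 h2 (w := -w)
    (fun e he => by simp [hw e he]) hneg'
  refine ⟨e₁, e₂, ?_, he₁, he₂, fun e he => ⟨?_, ?_⟩⟩
  · rintro rfl
    rw [map_neg, Pi.neg_apply] at hs₂
    linarith
  · rintro ⟨⟨μ', hμ'⟩, -⟩
    obtain ⟨g1, g2⟩ := hμ'.of_basis hβ fun l => mem_insert_of_mem (hb l)
    have hK : μ' - μ ∈ LinearMap.ker (I.slackRestrict β a) := by
      rw [mem_ker_slackRestrict]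
      intro e' he'
      have := I.slack_add ε β μ (μ' - μ) e'
      rw [add_sub_cancel, (h2 e').1 he', (g2 e').1 (mem_insert_of_mem he')] at this
      linarith
    obtain ⟨t, ht⟩ := hspan ⟨_, hK⟩
    have ht' : t • w = μ' - μ := congrArg Subtype.val ht
    have hμ'' : μ' = μ + t • w := by rw [ht']; abel
    rcases lt_trichotomy t 0 with htn | rfl | htp
    · have hμ3 : μ' = μ + (-t) • (-w) := by rw [hμ'']; simp
      rw [hμ3] at g1 g2
      exact Or.inr (hu₂ e he (-t) (by linarith) g2 g1)
    · rw [zero_smul, add_zero] at hμ''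
      rw [hμ''] at g2
      exact absurd ((h2 e).2 ((g2 e).1 (mem_insert_self e a))) he
    · rw [hμ''] at g1 g2
      exact Or.inl (hu₁ e he t htp g2 g1)
  · rintro (rfl | rfl)
    · exact hc₁
    · exact hc₂

end ColorInstance

/-! ### Local structure of the cell complex -/

namespace ColorInstance

variable {d : ℕ} {I : ColorInstance d} {ε : ℝ}

/-- A feasible basic solution lives on tight columns. This is one of the three lower bounds
(columns, zero coordinates, upper bounds) that are compared with the cardinality of a cell. -/
theorem IsType.mul_support (hI : I.InGeneralPosition) {μ : Fin d → ℝ}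
    {a : Finset (ConstraintIdx d)} (h : I.IsType ε μ a) : d ≤ a.toLeft.card := by
  obtain ⟨β, hβ, hb⟩ := h.exists_basis
  refine hI.le_card_support hβ.basicSol_mem fun k hk => ?_
  by_cases hkβ : k ∈ Set.range β
  · obtain ⟨l, rfl⟩ := hkβ
    exact mem_toLeft.2 (hb l)
  · exact absurd (basicSol_of_notMem hkβ) hk

theorem card_eq_add_add (a : Finset (ConstraintIdx d)) :
    a.card = a.toLeft.card + a.toRight.toLeft.card + a.toRight.toRight.card := by
  have h2 := card_toLeft_add_card_toRight (u := a)
  have h3 := card_toLeft_add_card_toRight (u := a.toRight)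
  omega

/-- Every tight column lies in some optimal basis. -/
theorem IsType.exists_basis_mem (hI : I.InGeneralPosition) (hε : 0 < ε) {μ : Fin d → ℝ}
    {a : Finset (ConstraintIdx d)} (h : I.IsType ε μ a) {k : Fin d × Fin d}
    (hk : redIdx k ∈ a) :
    ∃ β, I.IsFeasibleBasis β ∧ (∀ l, redIdx (β l) ∈ a) ∧ k ∈ Set.range β := by
  obtain ⟨β, hβ, hb⟩ := h.exists_basis
  by_cases hkβ : k ∈ Set.range β
  · exact ⟨β, hβ, hb, hkβ⟩
  · obtain ⟨h1, h2⟩ := h.of_basis hβ hb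
    obtain ⟨l, ⟨β', hβ', hr⟩, -⟩ := hβ.exists_pivot hI (I.cost_pos hε h.le_one) hkβ ((h2 _).1 hk)
    refine ⟨β', hβ', fun l' => ?_, ?_⟩
    · have : β' l' ∈ insert k (Set.range β) \ {β l} := hr ▸ ⟨l', rfl⟩
      rcases this.1 with hl | ⟨j, hj⟩
      · rw [hl]; exact hk
      · rw [← hj]; exact hb j
    · rw [hr]
      exact ⟨Set.mem_insert _ _, fun hkl => hkβ ⟨l, hkl.symm⟩⟩

/-- The optimal face of a parameter vector in `M` does not use the colors of parameter zero. -/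
theorem IsCell.zero_notMem (hI : I.InGeneralPosition) (hε : 0 < ε)
    (hεN : ε ≤ ((I.N : ℝ) ^ 3)⁻¹) {a : Finset (ConstraintIdx d)} (h : I.IsCell ε a)
    {k : Fin d × Fin d} (hk : redIdx k ∈ a) : zeroIdx k.1 ∉ a := by
  obtain ⟨⟨μ, hμ⟩, i, hi⟩ := h
  obtain ⟨β, hβ, hb, l, rfl⟩ := hμ.exists_basis_mem hI hε hk
  rw [hμ.mem_zero_iff]
  exact hβ.color_ne_of_optimal hI hε hεN hμ.le_one ((hμ.mem_one_iff i).1 hi)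
    (fun k => (hμ.of_basis hβ hb).1 (redIdx k)) l

theorem IsCell.zero_notMem_of_one_mem {a : Finset (ConstraintIdx d)} (h : I.IsCell ε a)
    {i : Fin d} (hi : oneIdx i ∈ a) : zeroIdx i ∉ a := by
  obtain ⟨⟨μ, hμ⟩, -⟩ := h
  rw [hμ.mem_zero_iff, (hμ.mem_one_iff i).1 hi]
  exact one_ne_zero

/-- The indices from `t` on supply `d - t` zero coordinates and `s` supplies further ones; keeping
`t` on the right avoids truncated subtraction. -/
theorem le_card_toRight_toLeft {t : ℕ} {a : Finset (ConstraintIdx d)}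
    (hz : ∀ i : Fin d, t ≤ i → zeroIdx i ∈ a) (s : Finset (Fin d)) (hs : ∀ i ∈ s, (i : ℕ) < t)
    (hsa : ∀ i ∈ s, zeroIdx i ∈ a) : d + s.card ≤ a.toRight.toLeft.card + t := by
  classical
  have h1 : (univ.filter fun i : Fin d => t ≤ i) ∪ s ⊆ a.toRight.toLeft := by
    intro i hi
    rw [mem_toLeft, mem_toRight]
    rcases mem_union.1 hi with h | h
    · exact hz i (mem_filter.1 h).2
    · exact hsa i h
  have h2 := card_le_card h1
  rw [card_union_of_disjoint (disjoint_left.2 fun i hi hi' => by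
    have := hs i hi'
    have := (mem_filter.1 hi).2
    omega)] at h2
  have h3 : d ≤ (univ.filter fun i : Fin d => t ≤ (i : ℕ)).card + t := by
    have h4 := card_filter_add_card_filter_not (s := (univ : Finset (Fin d)))
      (fun i : Fin d => t ≤ (i : ℕ))
    have h5 : (univ.filter fun i : Fin d => ¬ t ≤ (i : ℕ)).card ≤ t := by
      calc _ = ((univ.filter fun i : Fin d => ¬ t ≤ (i : ℕ)).image (fun i : Fin d => (i : ℕ))).card :=
            (card_image_of_injective _ Fin.val_injective).symm
        _ ≤ (range t).card := card_le_card (by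
            intro n hn
            obtain ⟨i, hi, rfl⟩ := mem_image.1 hn
            have := (mem_filter.1 hi).2
            exact mem_range.2 (by omega))
        _ = t := card_range t
    rw [card_univ, Fintype.card_fin] at h4
    omega
  omega

/-- A face of codimension one in the boundary of `conv {e_i : i < t}` lies in one facet. -/
theorem IsCell.erase_iff_of_boundary (hI : I.InGeneralPosition) (hs : I.IsSuitable ε) {t : ℕ}
    {a : Finset (ConstraintIdx d)} (h : I.IsCell ε a) (hcard : a.card + t = 2 * d + 2)
    (hz : ∀ i : Fin d, t ≤ i → zeroIdx i ∈ a) {m : Fin d} (hm : (m : ℕ) < t)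
    (hma : zeroIdx m ∈ a) {e : ConstraintIdx d} (he : e ∈ a) :
    (I.IsCell ε (a.erase e) ∧ ∀ i : Fin d, t ≤ i → zeroIdx i ∈ a.erase e) ↔ e = zeroIdx m := by
  classical
  have hc := card_eq_add_add a
  obtain ⟨⟨μ, hμ⟩, j, hj⟩ := id h
  have hS := hμ.mul_support hI
  have hZ := le_card_toRight_toLeft hz {m} (by simpa using hm) (by simpa using hma)
  have hO : 0 < a.toRight.toRight.card := card_pos.2 ⟨j, mem_toRight.2 (mem_toRight.2 hj)⟩
  rw [card_singleton] at hZ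
  -- The lower bounds `d` (columns), `1` (upper bounds) and `d - t + 1` (zero coordinates) sum to
  -- `a.card`. They would all survive the erasure of a constraint other than `zeroIdx m`, which
  -- leaves one element too few.
  constructor
  · rintro ⟨hcell, hz'⟩
    have hc' := card_eq_add_add (a.erase e)
    rw [card_erase_of_mem he] at hc'
    obtain ⟨⟨μ', hμ'⟩, j', hj'⟩ := id hcell
    have hS' := hμ'.mul_support hI
    have hO' : 0 < (a.erase e).toRight.toRight.card :=
      card_pos.2 ⟨j', mem_toRight.2 (mem_toRight.2 hj')⟩
    by_contra hne
    have hZ' := le_card_toRight_toLeft hz' {m} (by simpa using hm)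
      (by simpa using ⟨Ne.symm hne, hma⟩)
    rw [card_singleton] at hZ'
    omega
  · rintro rfl
    obtain ⟨β, hβ, hb⟩ := hμ.exists_basis
    refine ⟨h.of_subset hs (erase_subset _ _) hβ
      (fun l => mem_erase.2 ⟨by simp, hb l⟩) ⟨j, mem_erase.2 ⟨by simp, hj⟩⟩, fun i hi => ?_⟩
    refine mem_erase.2 ⟨fun hi' => ?_, hz i hi⟩
    have : i = m := by simpa using hi'
    omega

/-- A face of codimension one in the interior of `conv {e_i : i < t}` lies in two facets. -/
theorem IsCell.erase_iff_of_interior (hI : I.InGeneralPosition) (hε : 0 < ε)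
    (hs : I.IsSuitable ε) {t : ℕ}
    {a : Finset (ConstraintIdx d)} (h : I.IsCell ε a) (hcard : a.card + t = 2 * d + 2) (htd : t ≤ d)
    (hz : ∀ i : Fin d, t ≤ i → zeroIdx i ∈ a) (hz' : ∀ i : Fin d, (i : ℕ) < t → zeroIdx i ∉ a) :
    ∃ e₁ e₂, e₁ ≠ e₂ ∧ e₁ ∈ a ∧ e₂ ∈ a ∧ ∀ e ∈ a,
      ((I.IsCell ε (a.erase e) ∧ ∀ i : Fin d, t ≤ i → zeroIdx i ∈ a.erase e) ↔
        e = e₁ ∨ e = e₂) := by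
  classical
  have hc := card_eq_add_add a
  obtain ⟨⟨μ, hμ⟩, j, hj⟩ := id h
  have hS := hμ.mul_support hI
  have hO : 0 < a.toRight.toRight.card := card_pos.2 ⟨j, mem_toRight.2 (mem_toRight.2 hj)⟩
  have hZ : a.toRight.toLeft.card + t = d := by
    have h1 : a.toRight.toLeft = univ.filter fun i : Fin d => ¬ (i : ℕ) < t := by
      ext i
      simp only [mem_toLeft, mem_toRight, mem_filter, mem_univ, true_and]
      exact ⟨fun hi hlt => hz' i hlt hi, fun hi => hz i (not_lt.1 hi)⟩
    have h4 := card_filter_add_card_filter_not (s := (univ : Finset (Fin d)))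
      (fun i : Fin d => (i : ℕ) < t)
    rw [← h1, card_univ, Fintype.card_fin, Fin.card_filter_val_lt, min_eq_right htd] at h4
    omega
  have hzer : ∀ e ∈ a, (∀ i, e ≠ zeroIdx i) → ∀ i : Fin d, t ≤ i → zeroIdx i ∈ a.erase e :=
    fun e _ hne i hi => mem_erase.2 ⟨(hne i).symm, hz i hi⟩
  have hnz : ∀ i, (I.IsCell ε (a.erase (zeroIdx i)) ∧
      ∀ i' : Fin d, t ≤ i' → zeroIdx i' ∈ a.erase (zeroIdx i)) → zeroIdx i ∈ a → False := by
    rintro i ⟨-, hi⟩ hia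
    have hti : t ≤ (i : ℕ) := by
      by_contra hlt
      exact hz' i (not_le.1 hlt) hia
    exact (mem_erase.1 (hi i hti)).1 rfl
  obtain ⟨β, hβ, hb⟩ := hμ.exists_basis
  -- Exactly `d - t` coordinates vanish, so columns and upper bounds number `d + 2` together: one
  -- more than the minimum, in one of two ways.
  rcases Nat.lt_or_ge 1 a.toRight.toRight.card with hO2 | hO1
  · -- two upper bounds are tight
    have hO2 : a.toRight.toRight.card = 2 := by omega
    have hS2 : a.toLeft.card = d := by omega
    obtain ⟨i₁, i₂, hne, hi⟩ := card_eq_two.1 hO2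
    have hmem : ∀ i, oneIdx i ∈ a ↔ i = i₁ ∨ i = i₂ := by
      intro i
      have : oneIdx i ∈ a ↔ i ∈ a.toRight.toRight := by rw [mem_toRight, mem_toRight]
      rw [this, hi]
      simp
    refine ⟨oneIdx i₁, oneIdx i₂, by simpa using hne, (hmem _).2 (Or.inl rfl),
      (hmem _).2 (Or.inr rfl), fun e he => ⟨fun hcell => ?_, ?_⟩⟩
    · rcases e with k | i | i
      · exfalso
        obtain ⟨⟨⟨μ', hμ'⟩, -⟩, -⟩ := hcell
        have hS' := hμ'.mul_support hI
        have hss : (a.erase (Sum.inl k)).toLeft ⊆ a.toLeft.erase k := by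
          intro k' hk'
          have := mem_erase.1 (mem_toLeft.1 hk')
          exact mem_erase.2 ⟨fun hkk => this.1 (by rw [hkk]), mem_toLeft.2 this.2⟩
        have := card_le_card hss
        rw [card_erase_of_mem (mem_toLeft.2 he)] at this
        have := hI.d_pos
        omega
      · exact (hnz i hcell he).elim
      · simpa using (hmem i).1 he
    · have key : ∀ i i', i ≠ i' → oneIdx i' ∈ a → oneIdx i ∈ a → (I.IsCell ε (a.erase (oneIdx i)) ∧
          ∀ i' : Fin d, t ≤ i' → zeroIdx i' ∈ a.erase (oneIdx i)) := by
        intro i i' hii hi' hia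
        exact ⟨h.of_subset hs (erase_subset _ _) hβ
          (fun l => mem_erase.2 ⟨by simp, hb l⟩)
          ⟨i', mem_erase.2 ⟨by simpa using hii.symm, hi'⟩⟩, hzer _ hia fun _ => by simp⟩
      rintro (rfl | rfl)
      · exact key i₁ i₂ hne ((hmem _).2 (Or.inr rfl)) he
      · exact key i₂ i₁ hne.symm ((hmem _).2 (Or.inl rfl)) he
  · -- the optimal face is an edge
    have hO1 : a.toRight.toRight.card = 1 := by omega
    have hS1 : a.toLeft.card = d + 1 := by omega
    obtain ⟨k, hk⟩ : ∃ k, redIdx k ∈ a ∧ k ∉ Set.range β := by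
      by_contra hcon
      push Not at hcon
      have : a.toLeft ⊆ univ.image β := fun k hk => by simpa using hcon k (mem_toLeft.1 hk)
      have := card_le_card this
      rw [card_image_of_injective _ hβ.injective, card_univ, Fintype.card_fin] at this
      omega
    have hSk : a.toLeft = insert k (univ.image β) := by
      symm
      apply eq_of_subset_of_card_le
      · intro k' hk'
        rw [mem_toLeft]
        rcases mem_insert.1 hk' with rfl | h'
        · exact hk.1
        · obtain ⟨l, -, rfl⟩ := mem_image.1 h'
          exact hb l
      · rw [card_insert_of_notMem (by simpa using hk.2), card_image_of_injective _ hβ.injective,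
          card_univ, Fintype.card_fin]
        omega
    have hmem : ∀ k', redIdx k' ∈ a ↔ k' = k ∨ k' ∈ Set.range β := by
      intro k'
      rw [← mem_toLeft, hSk]
      simp
    obtain ⟨h1, h2⟩ := hμ.of_basis hβ hb
    -- The tight columns are a basis together with `k`; the two end bases of this edge omit `k` and
    -- the pivot index `β l`.
    obtain ⟨l, ⟨β', hβ', hr⟩, hu⟩ := hβ.exists_pivot hI (I.cost_pos hε hμ.le_one) hk.2
      ((h2 _).1 hk.1)
    refine ⟨redIdx k, redIdx (β l), fun hkl => hk.2 ⟨l, (Sum.inl_injective hkl).symm⟩, hk.1, hb l,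
      fun e he => ⟨fun hcell => ?_, ?_⟩⟩
    · rcases e with k' | i | i
      · rcases (hmem k').1 he with rfl | ⟨l', rfl⟩
        · exact Or.inl rfl
        · right
          obtain ⟨⟨⟨μ', hμ'⟩, -⟩, -⟩ := hcell
          obtain ⟨β'', hβ'', hb''⟩ := hμ'.exists_basis
          rw [hu β'' l' hβ'' ?_]
          rintro _ ⟨j', rfl⟩
          have := mem_erase.1 (hb'' j')
          refine ⟨(hmem _).1 this.2, fun h' => this.1 ?_⟩
          rw [Set.mem_singleton_iff.1 h']
      · exact (hnz i hcell he).elim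
      · exfalso
        obtain ⟨⟨-, i', hi'⟩, -⟩ := hcell
        obtain ⟨i₀, hi₀⟩ := card_eq_one.1 hO1
        have hone : ∀ i, oneIdx i ∈ a → i = i₀ := by
          intro i hi
          have : i ∈ a.toRight.toRight := mem_toRight.2 (mem_toRight.2 hi)
          rw [hi₀] at this
          simpa using this
        have := mem_erase.1 hi'
        exact this.1 (by rw [hone i' this.2, hone i he])
    · rintro (rfl | rfl)
      · exact ⟨h.of_subset hs (erase_subset _ _) hβ
          (fun l => mem_erase.2 ⟨fun hl => hk.2 ⟨l, Sum.inl_injective hl⟩, hb l⟩)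
          ⟨j, mem_erase.2 ⟨by simp, hj⟩⟩, hzer _ hk.1 fun _ => by simp⟩
      · refine ⟨h.of_subset hs (erase_subset _ _) hβ' (fun l' => ?_)
          ⟨j, mem_erase.2 ⟨by simp, hj⟩⟩, hzer _ (hb l) fun _ => by simp⟩
        have : β' l' ∈ insert k (Set.range β) \ {β l} := hr ▸ ⟨l', rfl⟩
        exact mem_erase.2 ⟨fun hl => this.2 (Sum.inl_injective hl), (hmem _).2 this.1⟩

/-- For every parameter vector with entries at most one there is an optimal basis. -/
theorem InGeneralPosition.exists_isType (hI : I.InGeneralPosition) (hε : 0 < ε) {μ : Fin d → ℝ}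
    (h0 : ∀ i, 0 ≤ μ i) (h1 : ∀ i, μ i ≤ 1) : ∃ a, I.IsType ε μ a := by
  classical
  obtain ⟨β, hβ, hr⟩ := hI.exists_optimal_basis (I.cost_pos hε h1)
  refine ⟨univ.filter fun e => I.slack ε β μ e = 0, β, hβ, ?_, fun e => by simp⟩
  rintro (k | i | i)
  · exact hr k
  · exact h0 i
  · rw [slack_oneIdx]
    linarith [h1 i]

/-- There is exactly one cell at the vertex `e_0`. -/
theorem InGeneralPosition.existsUnique_vertex (hI : I.InGeneralPosition) (hε : 0 < ε)
    (hs : I.IsSuitable ε) : ∃! a : Finset (ConstraintIdx d), I.IsCell ε a ∧ a.card = 2 * d ∧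
      ∀ i : Fin d, 1 ≤ (i : ℕ) → zeroIdx i ∈ a := by
  classical
  set i₀ : Fin d := ⟨0, hI.d_pos⟩ with hi₀
  have hsingle : ∀ i : Fin d, 1 ≤ (i : ℕ) ↔ i ≠ i₀ := by
    intro i
    rw [Ne, Fin.ext_iff, hi₀]
    exact Nat.one_le_iff_ne_zero
  obtain ⟨a, ha⟩ := hI.exists_isType hε (μ := Pi.single i₀ 1)
    (fun i => by by_cases h : i = i₀ <;> simp [h]) (fun i => by by_cases h : i = i₀ <;> simp [h])
  have hone : oneIdx i₀ ∈ a := by rw [ha.mem_one_iff]; simp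
  have hz : ∀ i : Fin d, 1 ≤ (i : ℕ) → zeroIdx i ∈ a := by
    intro i hi
    rw [ha.mem_zero_iff]
    simp [(hsingle i).1 hi]
  refine ⟨a, ⟨⟨⟨_, ha⟩, i₀, hone⟩, ?_, hz⟩, ?_⟩
  -- The lower bounds `d`, `d - 1` and `1` already add up to the upper bound `2 * d`.
  · have h1 := ha.card_le hs
    have h2 := ha.mul_support hI
    have h3 := le_card_toRight_toLeft hz ∅ (by simp) (by simp)
    have h4 : 0 < a.toRight.toRight.card := card_pos.2 ⟨i₀, mem_toRight.2 (mem_toRight.2 hone)⟩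
    have h5 := card_eq_add_add a
    rw [card_empty] at h3
    omega
  · rintro a' ⟨⟨⟨μ', hμ'⟩, j, hj⟩, -, hz'⟩
    have hμ'0 : ∀ i, i ≠ i₀ → μ' i = 0 := fun i hi =>
      (hμ'.mem_zero_iff i).1 (hz' i ((hsingle i).2 hi))
    -- `e_0` is the only candidate for `μ'`, and a point has only one tight set.
    have hμ'1 : μ' = Pi.single i₀ 1 := by
      have hj1 := (hμ'.mem_one_iff j).1 hj
      have hji : j = i₀ := by
        by_contra hne
        rw [hμ'0 j hne] at hj1
        exact zero_ne_one hj1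
      ext i
      by_cases hi : i = i₀
      · rw [hi, Pi.single_eq_same, ← hj1, hji]
      · rw [hμ'0 i hi, Pi.single_eq_of_ne hi]
    rw [hμ'1] at hμ'
    exact hμ'.unique hI ha

end ColorInstance

/-! ### Parity lemmas and Sperner's lemma for flags -/

/-- If a family of functions contains, with each member, exactly one other member that differs from
it only at `i`, then it has even cardinality. -/
theorem even_card_of_two_updates {α X : Type*} [DecidableEq α] [DecidableEq X] [Fintype α]
    (s : Finset (α → X)) (i : α)
    (h : ∀ F ∈ s, ∃ x y, x ≠ y ∧ ∀ z, Function.update F i z ∈ s ↔ z = x ∨ z = y) :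
    Even s.card := by
  rcases s.eq_empty_or_nonempty with rfl | ⟨F₀, -⟩
  · simp
  -- The value at `i` is forgotten by overwriting it with a fixed one; each fiber has two elements.
  rw [card_eq_sum_card_fiberwise (f := fun F => Function.update F i (F₀ i))
    (t := s.image fun F => Function.update F i (F₀ i))
    fun F hF => by simpa using ⟨F, hF, rfl⟩]
  refine even_sum _ fun G hG => ?_
  obtain ⟨F, hF, rfl⟩ := mem_image.1 hG
  obtain ⟨x, y, hxy, hiff⟩ := h F hF
  have : (s.filter fun F' => Function.update F' i (F₀ i) = Function.update F i (F₀ i)) =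
      ({x, y} : Finset X).image (Function.update F i) := by
    ext F'
    simp only [mem_filter, mem_image, mem_insert, mem_singleton]
    constructor
    · rintro ⟨hF', heq⟩
      have hF'' : Function.update F i (F' i) = F' := by
        ext1 j
        by_cases hj : j = i
        · subst hj; simp
        · have := congrFun heq j
          simp only [Function.update_of_ne hj] at this ⊢
          exact this.symm
      exact ⟨F' i, (hiff _).1 (by rwa [hF'']), hF''⟩
    · rintro ⟨z, hz, rfl⟩
      exact ⟨(hiff z).2 hz, by simp⟩
  rw [this, card_image_of_injective _ (Function.update_injective F i), card_pair hxy]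
  exact even_two

/-- The number of positions whose removal leaves all the labels below `t` is odd exactly if all the
labels up to `t` occur. -/
theorem odd_card_doors_iff {t : ℕ} (L : Fin (t + 1) → ℕ) (hL : ∀ i, L i ≤ t) :
    Odd (univ.filter fun i => ∀ m < t, ∃ j, j ≠ i ∧ L j = m).card ↔ ∀ m ≤ t, ∃ i, L i = m := by
  set D := univ.filter fun i => ∀ m < t, ∃ j, j ≠ i ∧ L j = m with hD
  have hmem : ∀ i, i ∈ D ↔ ∀ m < t, ∃ j, j ≠ i ∧ L j = m := fun i => by simp [hD]
  -- Off a position `i` of `D`, the `t` other positions carry all `t` labels below `t`, so none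
  -- repeats.
  have hinj : ∀ i ∈ D, ∀ j j', j ≠ i → j' ≠ i → L j < t → L j = L j' → j = j' := by
    intro i hi j j' hj hj' hlt hjj
    have hs : Set.SurjOn L ((univ.erase i).filter fun j => L j < t : Finset (Fin (t + 1)))
        (range t) := by
      intro m hm
      obtain ⟨j, hj, rfl⟩ := (hmem i).1 hi m (by simpa using hm)
      exact ⟨j, by simpa [hj] using hm, rfl⟩
    refine injOn_of_surjOn_of_card_le L (fun j hj => ?_) hs ?_ (x₁ := j) (x₂ := j') ?_ ?_ hjj
    · simpa using (mem_filter.1 hj).2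
    · refine (card_le_card (filter_subset _ _)).trans ?_
      rw [card_erase_of_mem (mem_univ i), card_univ, Fintype.card_fin, card_range]
      omega
    · simp [hj, hlt]
    · simp [hj', ← hjj, hlt]
  constructor
  · intro hodd
    by_contra hfull
    obtain ⟨i, hi⟩ : D.Nonempty := card_pos.1 hodd.pos
    have hlt : L i < t := by
      refine lt_of_le_of_ne (hL i) fun h => hfull fun m hm => ?_
      rcases hm.lt_or_eq with hm | rfl
      · obtain ⟨j, -, hj⟩ := (hmem i).1 hi m hm
        exact ⟨j, hj⟩
      · exact ⟨i, h⟩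
    obtain ⟨j, hji, hj⟩ := (hmem i).1 hi _ hlt
    -- If not all labels occur, the label of `i` recurs exactly once, at `j`, and only these two
    -- positions are removable.
    have hDeq : D = {i, j} := by
      ext i'
      simp only [mem_insert, mem_singleton]
      constructor
      · intro hi'
        by_contra hne
        push Not at hne
        have hlt' : L i' < t := by
          refine lt_of_le_of_ne (hL i') fun h => hfull fun m hm => ?_
          rcases hm.lt_or_eq with hm | rfl
          · obtain ⟨j, -, hj⟩ := (hmem i).1 hi m hm
            exact ⟨j, hj⟩
          · exact ⟨i', h⟩
        obtain ⟨j', hj'1, hj'2⟩ := (hmem i').1 hi' _ hlt'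
        by_cases hj'i : j' = i
        · subst hj'i
          exact hne.2 (hinj _ hi i' j hne.1 hji hlt' (by rw [← hj'2, hj]))
        · exact hj'1 (hinj _ hi i' j' hne.1 hj'i hlt' hj'2.symm).symm
      · rintro (rfl | rfl)
        · exact hi
        · rw [hmem]
          intro m hm
          obtain ⟨j', hj'1, hj'2⟩ := (hmem i).1 hi m hm
          by_cases hj' : j' = i'
          · subst hj'
            exact ⟨i, hji.symm, by rw [← hj, hj'2]⟩
          · exact ⟨j', hj', hj'2⟩
    rw [hDeq, card_pair hji.symm] at hodd
    exact absurd hodd (by decide)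
  · intro hfull
    have hLinj : Function.Injective L := by
      have := injOn_of_surjOn_of_card_le (s := univ) (t := range (t + 1)) L
        (fun j _ => by simpa using Nat.lt_succ_of_le (hL j))
        (fun m hm => by
          obtain ⟨i, hi⟩ := hfull m (by simpa [Nat.lt_succ_iff] using hm)
          exact ⟨i, by simp, hi⟩) (by simp)
      intro a b hab
      exact this (by simp) (by simp) hab
    obtain ⟨i, hi⟩ := hfull t le_rfl
    have : D = {i} := by
      ext j
      rw [hmem, mem_singleton]
      constructor
      · intro hj
        rcases (hL j).lt_or_eq with h | h
        · obtain ⟨j', hne, hj'⟩ := hj _ h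
          exact absurd (hLinj hj') hne
        · exact hLinj (h.trans hi.symm)
      · rintro rfl m hm
        obtain ⟨j', hj'⟩ := hfull m hm.le
        exact ⟨j', fun h => by rw [h, hi] at hj'; omega, hj'⟩
    simp [this]

/-- The diamond property, which yields the two choices for an intermediate member of a flag. -/
theorem exists_two_between {E : Type*} [DecidableEq E] {r p : Finset E} (h : r ⊆ p)
    (hc : p.card = r.card + 2) :
    ∃ x y, x ≠ y ∧ ∀ s, (r ⊆ s ∧ s ⊆ p ∧ s.card = r.card + 1) ↔ s = x ∨ s = y := by
  obtain ⟨a, b, hab, heq⟩ := card_eq_two.1 (show (p \ r).card = 2 by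
    rw [card_sdiff_of_subset h]; omega)
  have ha : a ∈ p \ r := by simp [heq]
  have hb : b ∈ p \ r := by simp [heq]
  rw [mem_sdiff] at ha hb
  refine ⟨insert a r, insert b r, fun hins => ?_, fun s => ⟨?_, ?_⟩⟩
  · have : a ∈ insert b r := hins ▸ mem_insert_self a r
    rcases mem_insert.1 this with h' | h'
    · exact hab h'
    · exact ha.2 h'
  · rintro ⟨hrs, hsp, hcs⟩
    obtain ⟨e, he, rfl⟩ : ∃ e, e ∉ r ∧ insert e r = s := by
      obtain ⟨e, he⟩ := card_eq_one.1 (show (s \ r).card = 1 by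
        rw [card_sdiff_of_subset hrs]; omega)
      have hes : e ∈ s \ r := by simp [he]
      rw [mem_sdiff] at hes
      refine ⟨e, hes.2, ?_⟩
      rw [insert_eq, ← he, sdiff_union_of_subset hrs]
    have : e ∈ p \ r := mem_sdiff.2 ⟨hsp (mem_insert_self e r), he⟩
    rw [heq, mem_insert, mem_singleton] at this
    rcases this with rfl | rfl
    · exact Or.inl rfl
    · exact Or.inr rfl
  · rintro (rfl | rfl)
    · exact ⟨subset_insert _ _, insert_subset ha.1 h, card_insert_of_notMem ha.2⟩
    · exact ⟨subset_insert _ _, insert_subset hb.1 h, card_insert_of_notMem hb.2⟩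

/-- A polyhedral subdivision of a simplex with vertices indexed by `Fin d` whose cells are given by
the sets of their tight constraints, with a Sperner labeling of the cells. The cell `a` has dimension
`n - a.card`, and `z i` is the constraint that defines the facet opposite to the vertex `i`. -/
structure SpernerComplex (d : ℕ) (E : Type*) [DecidableEq E] where
  n : ℕ
  IsCell : Finset E → Prop
  z : Fin d → E
  label : Finset E → Fin d
  between : ∀ {a p r}, IsCell p → IsCell r → r ⊆ a → a ⊆ p → IsCell a
  edge : ∀ {a}, IsCell a → a.card + 1 = n → ∃ e₁ e₂, e₁ ≠ e₂ ∧ e₁ ∉ a ∧ e₂ ∉ a ∧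
    ∀ e, e ∉ a → (IsCell (insert e a) ↔ e = e₁ ∨ e = e₂)
  -- The cardinality makes `a` a cell of codimension one in the `(t - 1)`-dimensional face of the
  -- first `t` vertices. Erasing a constraint passes to a cell of one dimension more.
  boundary : ∀ {a} {t : ℕ}, IsCell a → a.card + t = n + 2 → (∀ i : Fin d, t ≤ i → z i ∈ a) →
    ∀ m : Fin d, (m : ℕ) < t → z m ∈ a → ∀ e ∈ a,
      ((IsCell (a.erase e) ∧ ∀ i : Fin d, t ≤ i → z i ∈ a.erase e) ↔ e = z m)
  interior : ∀ {a} {t : ℕ}, IsCell a → a.card + t = n + 2 → t ≤ d →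
    (∀ i : Fin d, t ≤ i → z i ∈ a) → (∀ i : Fin d, (i : ℕ) < t → z i ∉ a) →
    ∃ e₁ e₂, e₁ ≠ e₂ ∧ e₁ ∈ a ∧ e₂ ∈ a ∧ ∀ e ∈ a,
      ((IsCell (a.erase e) ∧ ∀ i : Fin d, t ≤ i → z i ∈ a.erase e) ↔ e = e₁ ∨ e = e₂)
  label_spec : ∀ {a}, IsCell a → z (label a) ∉ a
  vertex : ∃! a, IsCell a ∧ a.card = n ∧ ∀ i : Fin d, 1 ≤ (i : ℕ) → z i ∈ a

namespace SpernerComplex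

variable {d : ℕ} {E : Type*} [DecidableEq E] (K : SpernerComplex d E)

/-- A complete flag of cells of the face that is spanned by the first `t` vertices. -/
def IsFlag {t : ℕ} (F : Fin t → Finset E) : Prop :=
  (∀ i, K.IsCell (F i)) ∧ (∀ i, (F i).card + i = K.n) ∧ Antitone F ∧
    ∀ i (m : Fin d), t ≤ m → K.z m ∈ F i

/-- A flag of the face that is spanned by the first `t` vertices with all the `t` labels. -/
def IsFull {t : ℕ} (F : Fin t → Finset E) : Prop :=
  K.IsFlag F ∧ ∀ m < t, ∃ i, (K.label (F i) : ℕ) = m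

variable {K}

theorem IsFlag.label_lt {t : ℕ} {F : Fin t → Finset E} (h : K.IsFlag F) (i : Fin t) :
    (K.label (F i) : ℕ) < t := by
  by_contra hlt
  exact K.label_spec (h.1 i) (h.2.2.2 i _ (not_lt.1 hlt))

theorem isFlag_update_iff {t : ℕ} {F : Fin t → Finset E} (h : K.IsFlag F) (i : Fin t)
    (s : Finset E) : K.IsFlag (Function.update F i s) ↔ K.IsCell s ∧ s.card + i = K.n ∧
      (∀ j < i, s ⊆ F j) ∧ (∀ j > i, F j ⊆ s) ∧ ∀ m : Fin d, t ≤ m → K.z m ∈ s := by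
  constructor
  · rintro ⟨h1, h2, h3, h4⟩
    refine ⟨by simpa using h1 i, by simpa using h2 i, fun j hj => ?_, fun j hj => ?_,
      fun m hm => by simpa using h4 i m hm⟩
    · simpa [hj.ne] using h3 hj.le
    · simpa [hj.ne'] using h3 hj.le
  · rintro ⟨h1, h2, h3, h4, h5⟩
    refine ⟨fun j => ?_, fun j => ?_, fun j j' hjj => ?_, fun j m hm => ?_⟩
    · by_cases hj : j = i
      · subst hj; simpa using h1
      · simpa [hj] using h.1 j
    · by_cases hj : j = i
      · subst hj; simpa using h2
      · simpa [hj] using h.2.1 j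
    · by_cases hj : j = i <;> by_cases hj' : j' = i
      · rw [hj, hj']
      · subst hj
        simpa [hj'] using h4 j' (lt_of_le_of_ne hjj (Ne.symm hj'))
      · subst hj'
        simpa [hj] using h3 j (lt_of_le_of_ne hjj hj)
      · simpa [hj, hj'] using h.2.2.1 hjj
    · by_cases hj : j = i
      · subst hj; simpa using h5 m hm
      · simpa [hj] using h.2.2.2 j m hm

theorem exists_erase_of_subset {s p : Finset E} (h : s ⊆ p) (hc : s.card + 1 = p.card) :
    ∃ e ∈ p, p.erase e = s := by
  obtain ⟨e, he⟩ := card_eq_one.1 (show (p \ s).card = 1 by rw [card_sdiff_of_subset h]; omega)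
  have hes : e ∈ p \ s := by simp [he]
  rw [mem_sdiff] at hes
  refine ⟨e, hes.1, ?_⟩
  rw [erase_eq, ← he, Finset.sdiff_sdiff_eq_self h]

theorem exists_insert_of_subset {s p : Finset E} (h : s ⊆ p) (hc : s.card + 1 = p.card) :
    ∃ e, e ∉ s ∧ insert e s = p := by
  obtain ⟨e, he, rfl⟩ := exists_erase_of_subset h hc
  exact ⟨e, notMem_erase e p, insert_erase he⟩

/-- Below the top of a flag there are exactly two choices for each member. -/
theorem IsFlag.two_updates {k : ℕ} {F : Fin (k + 2) → Finset E} (h : K.IsFlag F)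
    (i : Fin (k + 1)) :
    ∃ x y, x ≠ y ∧ ∀ s, K.IsFlag (Function.update F i.castSucc s) ↔ s = x ∨ s = y := by
  have hr := h.2.1 i.succ
  have hri : (F i.succ).card + 1 + i = K.n := by
    rw [← hr, Fin.val_succ]; omega
  have hz : ∀ s, F i.succ ⊆ s → ∀ m : Fin d, k + 2 ≤ m → K.z m ∈ s :=
    fun s hs m hm => hs (h.2.2.2 _ m hm)
  have hup : ∀ s, F i.succ ⊆ s → ∀ j > i.castSucc, F j ⊆ s := by
    intro s hs j hj
    exact (h.2.2.1 (by
      rw [Fin.le_iff_val_le_val, Fin.val_succ]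
      have : (i : ℕ) < j := hj
      omega : i.succ ≤ j)).trans hs
  -- The bottom member is one of the two vertices of an edge; any other member below the top lies
  -- between two neighbors, where the diamond property applies.
  rcases Nat.eq_zero_or_pos (i : ℕ) with hi0 | hi0
  · obtain ⟨e₁, e₂, hne, h1, h2, hiff⟩ := K.edge (h.1 i.succ) (by omega)
    refine ⟨insert e₁ (F i.succ), insert e₂ (F i.succ), fun heq => ?_, fun s => ?_⟩
    · have : e₁ ∈ insert e₂ (F i.succ) := heq ▸ mem_insert_self _ _
      rcases mem_insert.1 this with h' | h'
      · exact hne h'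
      · exact h1 h'
    · rw [isFlag_update_iff h]
      constructor
      · rintro ⟨g1, g2, -, g4, -⟩
        have hsub := g4 i.succ Fin.castSucc_lt_succ
        rw [Fin.val_castSucc] at g2
        obtain ⟨e, he, rfl⟩ := exists_insert_of_subset hsub (by omega)
        rcases (hiff e he).1 g1 with rfl | rfl
        · exact Or.inl rfl
        · exact Or.inr rfl
      · have hlt : ∀ j : Fin (k + 2), ¬ j < i.castSucc := by
          intro j hj
          have : (j : ℕ) < i := hj
          omega
        rintro (rfl | rfl)
        · exact ⟨(hiff _ h1).2 (Or.inl rfl), by rw [card_insert_of_notMem h1]; simpa using hri,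
            fun j hj => absurd hj (hlt j), hup _ (subset_insert _ _), hz _ (subset_insert _ _)⟩
        · exact ⟨(hiff _ h2).2 (Or.inr rfl), by rw [card_insert_of_notMem h2]; simpa using hri,
            fun j hj => absurd hj (hlt j), hup _ (subset_insert _ _), hz _ (subset_insert _ _)⟩
  · set p : Fin (k + 2) := ⟨i - 1, by omega⟩ with hp
    have hpi : p < i.castSucc := by
      rw [Fin.lt_def, Fin.val_castSucc, hp]
      exact Nat.sub_lt hi0 one_pos
    have hpc := h.2.1 p
    have hpv : (p : ℕ) + 1 = i := by
      rw [hp]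
      exact Nat.sub_add_cancel hi0
    obtain ⟨x, y, hxy, hiff⟩ := exists_two_between
      (h.2.2.1 (hpi.le.trans (Fin.castSucc_lt_succ (i := i)).le)) (by omega)
    refine ⟨x, y, hxy, fun s => ?_⟩
    rw [← hiff, isFlag_update_iff h]
    constructor
    · rintro ⟨g1, g2, g3, g4, -⟩
      rw [Fin.val_castSucc] at g2
      exact ⟨g4 i.succ Fin.castSucc_lt_succ, g3 p hpi, by omega⟩
    · rintro ⟨g1, g2, g3⟩
      refine ⟨K.between (h.1 p) (h.1 i.succ) g1 g2, ?_, fun j hj => ?_, hup s g1, hz s g1⟩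
      · rw [Fin.val_castSucc]; omega
      · refine g2.trans (h.2.2.1 ?_)
        have : (j : ℕ) < i := hj
        rw [Fin.le_iff_val_le_val]
        omega

/-- The top member has only a lower neighbor, so its alternatives arise by relaxing one constraint
of that neighbor within the face. -/
theorem IsFlag.update_last_iff {k : ℕ} {F : Fin (k + 2) → Finset E} (h : K.IsFlag F)
    (s : Finset E) :
    K.IsFlag (Function.update F (Fin.last (k + 1)) s) ↔
      ∃ e ∈ F (Fin.last k).castSucc, (F (Fin.last k).castSucc).erase e = s ∧ K.IsCell s ∧
        ∀ m : Fin d, k + 2 ≤ m → K.z m ∈ s := by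
  have hc := h.2.1 (Fin.last k).castSucc
  rw [Fin.val_castSucc, Fin.val_last] at hc
  rw [isFlag_update_iff h]
  constructor
  · rintro ⟨g1, g2, g3, -, g5⟩
    rw [Fin.val_last] at g2
    obtain ⟨e, he, hs⟩ := exists_erase_of_subset
      (g3 (Fin.last k).castSucc (Fin.castSucc_lt_last _)) (by omega)
    exact ⟨e, he, hs, g1, g5⟩
  · rintro ⟨e, he, rfl, g1, g2⟩
    refine ⟨g1, ?_, fun j hj => (erase_subset _ _).trans (h.2.2.1 ?_),
      fun j hj => absurd hj (not_lt.2 (Fin.le_last j)), g2⟩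
    · rw [card_erase_of_mem he, Fin.val_last]
      have := card_pos.2 ⟨e, he⟩
      omega
    · have : (j : ℕ) < k + 1 := hj
      rw [Fin.le_iff_val_le_val, Fin.val_castSucc, Fin.val_last]
      omega

variable [Fintype E]

open Classical in
/-- The parity argument for Sperner's lemma. -/
theorem odd_card_isFull (K : SpernerComplex d E) (k : ℕ) (hk : k + 1 ≤ d) :
    Odd (univ.filter fun F : Fin (k + 1) → Finset E => K.IsFull F).card := by
  induction k with
  | zero =>
    obtain ⟨a, ⟨h1, h2, h3⟩, hu⟩ := K.vertex
    have : (univ.filter fun F : Fin 1 → Finset E => K.IsFull F) = {fun _ => a} := by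
      ext F
      simp only [mem_filter, mem_univ, true_and, mem_singleton]
      constructor
      · rintro ⟨g, -⟩
        ext1 i
        have := g.2.1 i
        rw [Fin.fin_one_eq_zero i] at this ⊢
        exact hu _ ⟨g.1 0, by simpa using this, g.2.2.2 0⟩
      · rintro rfl
        have hflag : K.IsFlag fun _ : Fin (0 + 1) => a :=
          ⟨fun _ => h1, fun i => by simpa using h2, fun _ _ _ => le_rfl, fun _ => h3⟩
        refine ⟨hflag, fun m hm => ⟨0, ?_⟩⟩
        have : (K.label a : ℕ) < 0 + 1 := hflag.label_lt 0
        change (K.label a : ℕ) = m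
        omega
    rw [this, card_singleton]
    exact odd_one
  | succ k ih =>
    -- `P i F`: the position `i` is a door of `F`, that is, the other members carry the labels `0,
    -- …, k`.
    set P : Fin (k + 2) → (Fin (k + 2) → Finset E) → Prop := fun i F =>
      ∀ m < k + 1, ∃ j, j ≠ i ∧ (K.label (F j) : ℕ) = m with hP
    set fl : Finset (Fin (k + 2) → Finset E) := univ.filter fun F => K.IsFlag F with hfl
    have hmemfl : ∀ F, F ∈ fl ↔ K.IsFlag F := fun F => by simp [hfl]
    have hPu : ∀ i F s, P i (Function.update F i s) ↔ P i F := by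
      intro i F s
      refine forall_congr' fun m => imp_congr_right fun _ => exists_congr fun j =>
        and_congr_right fun hj => ?_
      rw [Function.update_of_ne hj]
    -- Pairs of a flag and a door are counted twice. Counted by flags, their number has the parity
    -- of the number of full flags.
    have hdouble : ∑ F ∈ fl, (univ.filter fun i => P i F).card =
        ∑ i, (fl.filter fun F => P i F).card := by
      simp only [card_filter]
      exact sum_comm
    have hodd : ∀ F ∈ fl, (Odd (univ.filter fun i => P i F).card ↔ K.IsFull F) := by
      intro F hF
      have hF := (hmemfl F).1 hF
      have := odd_card_doors_iff (fun i => (K.label (F i) : ℕ))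
        (fun i => Nat.lt_succ_iff.1 (hF.label_lt i))
      rw [this]
      exact ⟨fun h => ⟨hF, fun m hm => h m (Nat.lt_succ_iff.1 hm)⟩,
        fun h m hm => h.2 m (Nat.lt_succ_iff.2 hm)⟩
    have hfull : (univ.filter fun F : Fin (k + 1 + 1) → Finset E => K.IsFull F) =
        fl.filter fun F => Odd (univ.filter fun i => P i F).card := by
      ext F
      rw [mem_filter, mem_filter]
      constructor
      · rintro ⟨-, h⟩
        have := (hmemfl F).2 h.1
        exact ⟨this, (hodd F this).2 h⟩
      · rintro ⟨h, h'⟩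
        exact ⟨mem_univ _, (hodd F h).1 h'⟩
    rw [hfull, ← odd_sum_iff_odd_card_odd, hdouble, Fin.sum_univ_castSucc]
    -- A door does not depend on the member at its own position, so exchanging that member pairs up
    -- the flags.
    have heven : Even (∑ i : Fin (k + 1), (fl.filter fun F => P i.castSucc F).card) := by
      refine even_sum _ fun i _ => even_card_of_two_updates _ i.castSucc fun F hF => ?_
      obtain ⟨hF, hPF⟩ := mem_filter.1 hF
      obtain ⟨x, y, hxy, hiff⟩ := ((hmemfl F).1 hF).two_updates i
      refine ⟨x, y, hxy, fun s => ?_⟩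
      rw [mem_filter, hmemfl, hPu, hiff]
      exact and_iff_left hPF
    -- For doors at the top, `B` says that the penultimate cell lies in the boundary of the face;
    -- otherwise its two cofaces pair up the flags.
    set B : (Fin (k + 2) → Finset E) → Prop := fun F =>
      ∃ m : Fin d, (m : ℕ) < k + 2 ∧ K.z m ∈ F (Fin.last k).castSucc with hB
    have hne : (Fin.last k).castSucc ≠ Fin.last (k + 1) := (Fin.castSucc_lt_last _).ne
    have hBu : ∀ F s, B (Function.update F (Fin.last (k + 1)) s) ↔ B F := by
      intro F s
      simp only [hB, Function.update_of_ne hne]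
    rw [← card_filter_add_card_filter_not (s := fl.filter fun F => P (Fin.last (k + 1)) F) B]
    have hcardp : ∀ F, K.IsFlag F → (F (Fin.last k).castSucc).card + (k + 2) = K.n + 2 := by
      intro F hF
      have := hF.2.1 (Fin.last k).castSucc
      rw [Fin.val_castSucc, Fin.val_last] at this
      omega
    have hint : Even ((fl.filter fun F => P (Fin.last (k + 1)) F).filter fun F => ¬ B F).card := by
      refine even_card_of_two_updates _ (Fin.last (k + 1)) fun F hF => ?_
      rw [mem_filter, mem_filter, hmemfl] at hF
      obtain ⟨⟨hF, hPF⟩, hBF⟩ := hF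
      obtain ⟨e₁, e₂, hne, h1, h2, hiff⟩ := K.interior (hF.1 (Fin.last k).castSucc)
        (hcardp F hF) hk (hF.2.2.2 _) fun i hi hz => hBF ⟨i, hi, hz⟩
      refine ⟨_, _, fun heq => hne (erase_injOn _ h1 h2 heq), fun s => ?_⟩
      rw [mem_filter, mem_filter, hmemfl, hPu, hBu, hF.update_last_iff]
      constructor
      · rintro ⟨⟨⟨e, he, rfl, g⟩, -⟩, -⟩
        rcases (hiff e he).1 g with rfl | rfl
        · exact Or.inl rfl
        · exact Or.inr rfl
      · rintro (rfl | rfl)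
        · exact ⟨⟨⟨e₁, h1, rfl, (hiff _ h1).2 (Or.inl rfl)⟩, hPF⟩, hBF⟩
        · exact ⟨⟨⟨e₂, h2, rfl, (hiff _ h2).2 (Or.inr rfl)⟩, hPF⟩, hBF⟩
    -- The members below the top contain the constraints of the penultimate one and carry the labels
    -- `0, …, k`, so the Sperner condition rules out every facet but the one opposite to the vertex
    -- `k + 1`.
    have hz : ∀ F, K.IsFlag F → P (Fin.last (k + 1)) F → ∀ m : Fin d, (m : ℕ) < k + 2 →
        K.z m ∈ F (Fin.last k).castSucc → (m : ℕ) = k + 1 := by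
      intro F hF hPF m hm hzm
      by_contra hmk
      obtain ⟨j, hj, hjm⟩ := hPF m (by omega)
      have hj' : j ≤ (Fin.last k).castSucc := by
        have h1 : (j : ℕ) ≠ k + 1 := fun h => hj (Fin.ext h)
        rw [Fin.le_iff_val_le_val, Fin.val_castSucc, Fin.val_last]
        omega
      refine K.label_spec (hF.1 j) (hF.2.2.1 hj' ?_)
      rwa [Fin.ext hjm]
    -- Forgetting the top member gives a full flag of that facet; the unique coface at the boundary
    -- recovers it.
    have hbd : ((fl.filter fun F => P (Fin.last (k + 1)) F).filter B).card =
        (univ.filter fun F : Fin (k + 1) → Finset E => K.IsFull F).card := by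
      have hlast : ∀ F, K.IsFlag F → P (Fin.last (k + 1)) F → B F →
          ∃ m : Fin d, (m : ℕ) = k + 1 ∧ K.z m ∈ F (Fin.last k).castSucc ∧
            F (Fin.last (k + 1)) = (F (Fin.last k).castSucc).erase (K.z m) := by
        rintro F hF hPF ⟨m, hm, hzm⟩
        refine ⟨m, hz F hF hPF m hm hzm, hzm, ?_⟩
        have hu := hF.update_last_iff (F (Fin.last (k + 1)))
        rw [Function.update_eq_self] at hu
        obtain ⟨e, he, hes, g⟩ := hu.1 hF
        rw [← hes] at g ⊢
        rw [(K.boundary (hF.1 _) (hcardp F hF) (hF.2.2.2 _) m hm hzm e he).1 g]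
      refine card_bij (fun F _ => fun i => F i.castSucc) ?_ ?_ ?_
      · intro F hF
        rw [mem_filter, mem_filter, hmemfl] at hF
        obtain ⟨⟨hF, hPF⟩, hBF⟩ := hF
        obtain ⟨m, hm, hzm, -⟩ := hlast F hF hPF hBF
        rw [mem_filter]
        refine ⟨mem_univ _, ⟨fun i => hF.1 _, fun i => by simpa using hF.2.1 i.castSucc,
          fun i j hij => hF.2.2.1 (by simpa using hij), fun i m' hm' => ?_⟩, fun m' hm' => ?_⟩
        · rcases hm'.lt_or_eq with h | h
          · exact hF.2.2.2 _ m' h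
          · have : m' = m := Fin.ext (by omega)
            rw [this]
            exact hF.2.2.1 (by simpa using Fin.le_last i) hzm
        · obtain ⟨j, hj, hjm⟩ := hPF m' hm'
          obtain ⟨j', rfl⟩ := Fin.exists_castSucc_eq.2 hj
          exact ⟨j', hjm⟩
      · intro F hF F' hF' heq
        rw [mem_filter, mem_filter, hmemfl] at hF hF'
        obtain ⟨⟨hF, hPF⟩, hBF⟩ := hF
        obtain ⟨⟨hF', hPF'⟩, hBF'⟩ := hF'
        obtain ⟨m, hm, -, h1⟩ := hlast F hF hPF hBF
        obtain ⟨m', hm', -, h1'⟩ := hlast F' hF' hPF' hBF'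
        have heq' : ∀ i : Fin (k + 1), F i.castSucc = F' i.castSucc := congrFun heq
        ext1 j
        refine Fin.lastCases ?_ (fun i => heq' i) j
        rw [h1, h1', heq', show m = m' from Fin.ext (hm.trans hm'.symm)]
      · intro G hG
        obtain ⟨hG, hGl⟩ := (mem_filter.1 hG).2
        set m : Fin d := ⟨k + 1, hk⟩ with hm
        have hzm : K.z m ∈ G (Fin.last k) := hG.2.2.2 _ m le_rfl
        have hc := hG.2.1 (Fin.last k)
        rw [Fin.val_last] at hc
        obtain ⟨hcell, hzz⟩ := (K.boundary (t := k + 2) (hG.1 (Fin.last k)) (by omega)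
          (fun i hi => hG.2.2.2 _ i (by omega)) m (Nat.lt_succ_self _) hzm _ hzm).2 rfl
        set F : Fin (k + 2) → Finset E := Fin.snoc (α := fun _ => Finset E) G
          ((G (Fin.last k)).erase (K.z m)) with hFdef
        have hFc : ∀ i : Fin (k + 1), F i.castSucc = G i := fun i => Fin.snoc_castSucc _ _ _
        have hFl : F (Fin.last (k + 1)) = (G (Fin.last k)).erase (K.z m) := Fin.snoc_last _ _
        have hF : K.IsFlag F := by
          refine ⟨fun j => ?_, fun j => ?_, fun i j hij => ?_, fun j m' hm' => ?_⟩
          · refine Fin.lastCases ?_ (fun i => ?_) j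
            · rw [hFl]; exact hcell
            · rw [hFc]; exact hG.1 i
          · refine Fin.lastCases ?_ (fun i => ?_) j
            · rw [hFl, card_erase_of_mem hzm, Fin.val_last]
              have := card_pos.2 ⟨_, hzm⟩
              omega
            · rw [hFc, Fin.val_castSucc]; exact hG.2.1 i
          · induction j using Fin.lastCases with
            | last =>
              induction i using Fin.lastCases with
              | last => exact le_rfl
              | cast i =>
                rw [hFl, hFc]
                exact (erase_subset _ _).trans (hG.2.2.1 (Fin.le_last i))
            | cast j =>
              induction i using Fin.lastCases with
              | last =>
                have : (k + 1 : ℕ) ≤ j := hij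
                omega
              | cast i =>
                rw [hFc, hFc]
                exact hG.2.2.1 (by simpa using hij)
          · refine Fin.lastCases ?_ (fun i => ?_) j
            · rw [hFl]; exact hzz m' hm'
            · rw [hFc]; exact hG.2.2.2 i m' (by omega)
        refine ⟨F, ?_, funext hFc⟩
        rw [mem_filter, mem_filter, hmemfl]
        refine ⟨⟨hF, fun m' hm' => ?_⟩, m, Nat.lt_succ_self _, by rw [hFc]; exact hzm⟩
        obtain ⟨i, hi⟩ := hGl m' hm'
        exact ⟨i.castSucc, (Fin.castSucc_lt_last i).ne, by rw [hFc]; exact hi⟩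
    rw [hbd]
    exact heven.add_odd ((ih (by omega)).add_even hint)

/-- Sperner's lemma for complete flags of cells. -/
theorem exists_isFull (K : SpernerComplex d E) (hd : 0 < d) :
    ∃ F : Fin d → Finset E, K.IsFull F := by
  classical
  obtain ⟨k, rfl⟩ : ∃ k, d = k + 1 := ⟨d - 1, by omega⟩
  obtain ⟨F, hF⟩ := card_pos.1 (K.odd_card_isFull k le_rfl).pos
  exact ⟨F, (mem_filter.1 hF).2⟩

end SpernerComplex

/-! ### Majority colors and the labeled complex of cells -/

theorem exists_isMajorityColor {d : ℕ} (hd : 0 < d) (s : Set (Fin d × Fin d)) :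
    ∃ i, IsMajorityColor s i := by
  classical
  obtain ⟨i₀, -, hi₀⟩ := (univ : Finset (Fin d)).exists_max_image (colorCount s)
    ⟨⟨0, hd⟩, mem_univ _⟩
  have hne : (univ.filter fun i => ∀ j, colorCount s j ≤ colorCount s i).Nonempty :=
    ⟨i₀, by simpa using hi₀⟩
  refine ⟨(univ.filter fun i => ∀ j, colorCount s j ≤ colorCount s i).min' hne, ?_, fun j hj => ?_⟩
  · exact (mem_filter.1 (min'_mem _ hne)).2
  · by_contra hcon
    push Not at hcon
    have hmax := (mem_filter.1 (min'_mem _ hne)).2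
    have : j ∈ univ.filter fun i => ∀ j, colorCount s j ≤ colorCount s i :=
      mem_filter.2 ⟨mem_univ _, fun j' => (hmax j').trans hcon⟩
    exact absurd hj (not_lt.2 (min'_le _ _ this))

theorem IsMajorityColor.unique {d : ℕ} {s : Set (Fin d × Fin d)} {i j : Fin d}
    (hi : IsMajorityColor s i) (hj : IsMajorityColor s j) : i = j := by
  rcases lt_trichotomy i j with h | h | h
  · exact absurd (hi.1 j) (not_le.2 (hj.2 i h))
  · exact h
  · exact absurd (hj.1 i) (not_le.2 (hi.2 j h))

theorem IsMajorityColor.exists_mem {d : ℕ} {s : Set (Fin d × Fin d)} {i : Fin d}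
    (hi : IsMajorityColor s i) (hs : s.Nonempty) : ∃ k ∈ s, k.1 = i := by
  obtain ⟨k, hk⟩ := hs
  have h1 : 0 < colorCount s k.1 := (Set.ncard_pos (Set.toFinite _)).2 ⟨k, hk, rfl⟩
  obtain ⟨k', hk', hk'i⟩ := (Set.ncard_pos (Set.toFinite _)).1 (h1.trans_le (hi.1 k.1))
  exact ⟨k', hk', hk'i⟩

namespace ColorInstance

variable {d : ℕ} {I : ColorInstance d} {ε : ℝ}

theorem IsCell.toLeft_nonempty (hI : I.InGeneralPosition) {a : Finset (ConstraintIdx d)}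
    (h : I.IsCell ε a) : a.toLeft.Nonempty := by
  obtain ⟨⟨μ, hμ⟩, -⟩ := h
  exact card_pos.1 (hI.d_pos.trans_le (hμ.mul_support hI))

/-- The majority color of a cell belongs to a nonzero parameter. -/
theorem IsCell.zero_notMem_majority (hI : I.InGeneralPosition) (hε : 0 < ε)
    (hεN : ε ≤ ((I.N : ℝ) ^ 3)⁻¹) {a : Finset (ConstraintIdx d)} (h : I.IsCell ε a) {i : Fin d}
    (hi : IsMajorityColor (a.toLeft : Set (Fin d × Fin d)) i) : zeroIdx i ∉ a := by
  obtain ⟨k, hk, rfl⟩ := hi.exists_mem (by simpa using h.toLeft_nonempty hI)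
  exact h.zero_notMem hI hε hεN (mem_toLeft.1 hk)

/-- The labeled complex of the parameter regions. -/
noncomputable def InGeneralPosition.spernerComplex (hI : I.InGeneralPosition) (hε : 0 < ε)
    (hεN : ε ≤ ((I.N : ℝ) ^ 3)⁻¹) (hs : I.IsSuitable ε) :
    SpernerComplex d (ConstraintIdx d) where
  n := 2 * d
  IsCell := I.IsCell ε
  z := zeroIdx
  label a := (exists_isMajorityColor hI.d_pos (a.toLeft : Set (Fin d × Fin d))).choose
  between hp hr h1 h2 := hp.of_between hs hr h1 h2
  edge h hc := h.exists_two_vertices hs hc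
  boundary h hc hz _ hm hma _ he := h.erase_iff_of_boundary hI hs hc hz hm hma he
  interior h hc ht hz hz' := h.erase_iff_of_interior hI hε hs hc ht hz hz'
  label_spec h := h.zero_notMem_majority hI hε hεN
    (exists_isMajorityColor hI.d_pos _).choose_spec
  vertex := hI.existsUnique_vertex hε hs

theorem InGeneralPosition.exists_full_flag (hI : I.InGeneralPosition) (hε : 0 < ε)
    (hεN : ε ≤ ((I.N : ℝ) ^ 3)⁻¹) (hs : I.IsSuitable ε) :
    ∃ F : Fin d → Finset (ConstraintIdx d), (∀ i, I.IsCell ε (F i)) ∧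
      (∀ i, (F i).card + i = 2 * d) ∧ Antitone F ∧
      ∀ c : Fin d, ∃ i, IsMajorityColor ((F i).toLeft : Set (Fin d × Fin d)) c := by
  obtain ⟨F, ⟨h1, h2, h3, -⟩, h5⟩ := (hI.spernerComplex hε hεN hs).exists_isFull hI.d_pos
  refine ⟨F, h1, h2, h3, fun c => ?_⟩
  obtain ⟨i, hi⟩ := h5 c c.2
  refine ⟨i, ?_⟩
  rw [← Fin.ext hi]
  exact (exists_isMajorityColor hI.d_pos ((F i).toLeft : Set (Fin d × Fin d))).choose_spec

end ColorInstance

/-! ### Dimensions, barycenters and the central projection -/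

/-- `X` lies in a hyperplane missing the origin, so a point of `X` is independent of the
differences. This relates dimensions to linear spans, which the central projection preserves. -/
theorem finrank_span_eq_finrank_vectorSpan_add_one {d : ℕ} {X : Set (Fin d → ℝ)}
    (hX : X.Nonempty) (h : (Fin d → ℝ) →ₗ[ℝ] ℝ) (hh : ∀ x ∈ X, h x = 1) :
    Module.finrank ℝ (Submodule.span ℝ X) = Module.finrank ℝ (vectorSpan ℝ X) + 1 := by
  obtain ⟨x, hx⟩ := hX
  have h0 : vectorSpan ℝ X ≤ LinearMap.ker h := by
    rw [vectorSpan_eq_span_vsub_set_right ℝ hx, Submodule.span_le]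
    rintro _ ⟨y, hy, rfl⟩
    simp [hh y hy, hh x hx]
  have hx0 : x ≠ 0 := by
    rintro rfl
    simpa using hh 0 hx
  have hsup : Submodule.span ℝ X = vectorSpan ℝ X ⊔ Submodule.span ℝ {x} := by
    apply le_antisymm
    · rw [Submodule.span_le]
      intro y hy
      have : y = (y - x) + x := by abel
      rw [this]
      exact Submodule.add_mem_sup (vsub_mem_vectorSpan ℝ hy hx) (Submodule.mem_span_singleton_self x)
    · rw [sup_le_iff, vectorSpan_eq_span_vsub_set_right ℝ hx, Submodule.span_le,
        Submodule.span_singleton_le_iff_mem]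
      refine ⟨?_, Submodule.subset_span hx⟩
      rintro _ ⟨y, hy, rfl⟩
      exact Submodule.sub_mem _ (Submodule.subset_span hy) (Submodule.subset_span hx)
  have hinf : vectorSpan ℝ X ⊓ Submodule.span ℝ {x} = ⊥ := by
    rw [Submodule.eq_bot_iff]
    rintro y ⟨hy1, hy2⟩
    obtain ⟨t, rfl⟩ := Submodule.mem_span_singleton.1 hy2
    have := h0 hy1
    rw [LinearMap.mem_ker, map_smul, hh x hx, smul_eq_mul, mul_one] at this
    rw [this, zero_smul]
  have := Submodule.finrank_sup_add_finrank_inf_eq (vectorSpan ℝ X) (Submodule.span ℝ {x})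
  rw [← hsup, hinf, finrank_bot, finrank_span_singleton hx0] at this
  exact this

/-- The barycenter is relatively interior: a nonnegative form vanishing at the mean of the vertices
vanishes at each vertex, hence on their hull, which is `q` by Krein–Milman. -/
theorem polytopeBarycenter_spec {d : ℕ} {ι : Type*} [Finite ι]
    (H : ι → (Fin d → ℝ) →ₗ[ℝ] ℝ) (σ : (Fin d → ℝ) →ₗ[ℝ] ℝ) (p : ι → Prop)
    {q : Set (Fin d → ℝ)}
    (hq : ∀ ν, ν ∈ q ↔ σ ν = 1 ∧ (∀ e, 0 ≤ H e ν) ∧ ∀ e, p e → H e ν = 0)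
    (hb : Bornology.IsBounded q) (hne : q.Nonempty) :
    polytopeBarycenter q ∈ q ∧
      ∀ e, H e (polytopeBarycenter q) = 0 → ∀ ν ∈ q, H e ν = 0 := by
  have hcont : ∀ f : (Fin d → ℝ) →ₗ[ℝ] ℝ, Continuous f :=
    fun f => f.continuous_of_finiteDimensional
  have hqeq : q = {ν | σ ν = 1} ∩ ((⋂ e, {ν | 0 ≤ H e ν}) ∩ ⋂ e, ⋂ (_ : p e), {ν | H e ν = 0}) := by
    ext ν
    simp [hq]
  have hclosed : IsClosed q := by
    rw [hqeq]
    refine (isClosed_eq (hcont _) continuous_const).inter (IsClosed.inter ?_ ?_)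
    · exact isClosed_iInter fun e => isClosed_le continuous_const (hcont _)
    · exact isClosed_iInter fun e => isClosed_iInter fun _ =>
        isClosed_eq (hcont _) continuous_const
  have hconv : Convex ℝ q := by
    intro x hx y hy s t hs ht hst
    rw [hq] at hx hy ⊢
    refine ⟨?_, fun e => ?_, fun e he => ?_⟩
    · simp [hx.1, hy.1, hst]
    · simp only [map_add, map_smul, smul_eq_mul]
      have := hx.2.1 e
      have := hy.2.1 e
      positivity
    · simp [hx.2.2 e he, hy.2.2 e he]
  have hcomp : IsCompact q := Metric.isCompact_of_isClosed_isBounded hclosed hb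
  have hfin : (q.extremePoints ℝ).Finite := by
    -- An extreme point is determined by its tight forms: if `y` has the same ones, the segment from
    -- `y` to `x` extends beyond `x`.
    refine Set.Finite.of_injOn (f := fun ν => {e | H e ν = 0}) (t := Set.univ)
      (fun _ _ => Set.mem_univ _) ?_ Set.finite_univ
    intro x hx y hy hxy
    have hxy' : ∀ e, H e x = 0 ↔ H e y = 0 := fun e => by
      have := congrArg (fun s : Set ι => e ∈ s) hxy
      simpa using this
    obtain ⟨hx1, hx2, hx3⟩ := (hq x).1 hx.1
    obtain ⟨hy1, hy2, hy3⟩ := (hq y).1 hy.1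
    obtain ⟨t, ht, hpos⟩ := exists_pos_forall_add_mul_pos (fun e => H e x) (fun e => H e (x - y))
      (fun e => H e x ≠ 0) fun e he => lt_of_le_of_ne (hx2 e) (Ne.symm he)
    have hz : x + t • (x - y) ∈ q := by
      rw [hq]
      refine ⟨by simp [hx1, hy1], fun e => ?_, fun e he => ?_⟩
      · by_cases h0 : H e x = 0
        · simp [h0, (hxy' e).1 h0]
        · rw [map_add, map_smul]
          exact (hpos e h0).le
      · simp [hx3 e he, hy3 e he]
    have hmem : x ∈ openSegment ℝ (x + t • (x - y)) y := by
      refine ⟨1 / (1 + t), t / (1 + t), by positivity, by positivity, by field_simp, ?_⟩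
      ext i
      simp only [Pi.add_apply, Pi.smul_apply, Pi.sub_apply, smul_eq_mul]
      field_simp
      ring
    exact ((mem_extremePoints.1 hx).2 _ hz _ hy.1 hmem).2.symm
  have hhull : q = convexHull ℝ (q.extremePoints ℝ) := by
    conv_lhs => rw [← closure_convexHull_extremePoints hcomp hconv]
    exact (hfin.isCompact_convexHull (𝕜 := ℝ)).isClosed.closure_eq
  have hext : (q.extremePoints ℝ).Nonempty := hcomp.extremePoints_nonempty hne
  have hn : 0 < ((q.extremePoints ℝ).ncard : ℝ) := by
    exact_mod_cast (Set.ncard_pos hfin).2 hext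
  have hbary : polytopeBarycenter q =
      ∑ v ∈ hfin.toFinset, ((q.extremePoints ℝ).ncard : ℝ)⁻¹ • v := by
    rw [polytopeBarycenter, finsum_mem_eq_finite_toFinset_sum _ hfin, smul_sum]
  refine ⟨?_, fun e he => ?_⟩
  · rw [hbary]
    refine hconv.sum_mem (fun _ _ => by positivity) ?_ fun v hv =>
      (hfin.mem_toFinset.1 hv).1
    rw [sum_const, ← Set.ncard_eq_toFinset_card _ hfin, nsmul_eq_mul, mul_inv_cancel₀ hn.ne']
  · rw [hbary, map_sum] at he
    have h0 : ∀ v ∈ q.extremePoints ℝ, H e v = 0 := by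
      intro v hv
      have hnn : ∀ v ∈ hfin.toFinset,
          0 ≤ H e (((q.extremePoints ℝ).ncard : ℝ)⁻¹ • v) := by
        intro v hv
        rw [map_smul, smul_eq_mul]
        exact mul_nonneg (inv_nonneg.2 hn.le) (((hq v).1 (hfin.mem_toFinset.1 hv).1).2.1 e)
      have := (sum_eq_zero_iff_of_nonneg hnn).1 he v (hfin.mem_toFinset.2 hv)
      rw [map_smul, smul_eq_mul] at this
      exact (mul_eq_zero.1 this).resolve_left (inv_ne_zero hn.ne')
    have hsub : convexHull ℝ (q.extremePoints ℝ) ⊆ {ν | H e ν = 0} :=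
      convexHull_min h0 (convex_hyperplane (H e).isLinear 0)
    intro ν hν
    rw [hhull] at hν
    exact hsub hν

theorem sum_abs_pos {d : ℕ} {μ : Fin d → ℝ} (hμ : μ ≠ 0) : 0 < ∑ i, |μ i| := by
  obtain ⟨i, hi⟩ := Function.ne_iff.1 hμ
  exact sum_pos' (fun i _ => abs_nonneg _) ⟨i, mem_univ i, abs_pos.2 hi⟩

theorem ne_zero_of_mem_cubeM {d : ℕ} {μ : Fin d → ℝ} (hμ : μ ∈ cubeM d) : μ ≠ 0 := by
  rintro rfl
  have := hμ.2
  rw [norm_zero] at this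
  exact zero_ne_one this

/-- Points of `M` have maximum norm one, so the norm of the image is the scaling factor. -/
theorem simplexProj_injOn (d : ℕ) : Set.InjOn (simplexProj (d := d)) (cubeM d) := by
  intro μ hμ ν hν h
  have h1 := sum_abs_pos (ne_zero_of_mem_cubeM hμ)
  have h2 := sum_abs_pos (ne_zero_of_mem_cubeM hν)
  have h3 := congrArg norm h
  simp only [simplexProj] at h h3
  rw [norm_smul, norm_smul, hμ.2, hν.2, mul_one, mul_one, norm_inv, norm_inv,
    Real.norm_of_nonneg h1.le, Real.norm_of_nonneg h2.le] at h3
  rw [h3] at h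
  exact smul_right_injective _ (inv_ne_zero h2.ne') h

theorem facesM_subset {d : ℕ} {g : Set (Fin d → ℝ)} (hg : g ∈ facesM d) : g ⊆ cubeM d := by
  obtain ⟨I₀, I₁, -, ⟨i, hi⟩, rfl⟩ := hg
  rintro μ ⟨h0, h1, -, h3⟩
  refine ⟨h0, le_antisymm ((pi_norm_le_iff_of_nonneg zero_le_one).2 fun j => ?_) ?_⟩
  · rw [Real.norm_of_nonneg (h0 j)]
    exact h1 j
  · have := norm_le_pi_norm μ i
    rwa [h3 i hi, norm_one] at this

theorem span_image_simplexProj {d : ℕ} {X : Set (Fin d → ℝ)} (hX : X ⊆ cubeM d) :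
    Submodule.span ℝ (simplexProj '' X) = Submodule.span ℝ X := by
  apply le_antisymm
  · rw [Submodule.span_le]
    rintro _ ⟨μ, hμ, rfl⟩
    exact Submodule.smul_mem _ _ (Submodule.subset_span hμ)
  · rw [Submodule.span_le]
    intro μ hμ
    have h := sum_abs_pos (ne_zero_of_mem_cubeM (hX hμ))
    have : μ = (∑ i, |μ i|) • simplexProj μ := by
      rw [simplexProj, smul_smul, mul_inv_cancel₀ h.ne', one_smul]
    rw [SetLike.mem_coe, this]
    exact Submodule.smul_mem _ _ (Submodule.subset_span ⟨μ, hμ, rfl⟩)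

theorem sum_simplexProj {d : ℕ} {μ : Fin d → ℝ} (hμ : μ ∈ cubeM d) : ∑ i, simplexProj μ i = 1 := by
  have h := sum_abs_pos (ne_zero_of_mem_cubeM hμ)
  have h1 : ∑ i, |μ i| = ∑ i, μ i := sum_congr rfl fun i _ => abs_of_nonneg (hμ.1 i)
  simp only [simplexProj, Pi.smul_apply, smul_eq_mul]
  rw [← mul_sum, ← h1, inv_mul_cancel₀ h.ne']

/-- The central projection preserves the dimensions of the sets in the facets of the cube. -/
theorem setDim_image_simplexProj {d : ℕ} {X : Set (Fin d → ℝ)} (hX : X ⊆ cubeM d)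
    (hne : X.Nonempty) {i : Fin d} (hi : ∀ μ ∈ X, μ i = 1) :
    setDim (simplexProj '' X) = setDim X := by
  have h1 := finrank_span_eq_finrank_vectorSpan_add_one hne (LinearMap.proj i) hi
  have h2 := finrank_span_eq_finrank_vectorSpan_add_one (hne.image simplexProj)
    (∑ i, LinearMap.proj i) (by
      rintro _ ⟨μ, hμ, rfl⟩
      simpa using sum_simplexProj (hX hμ))
  rw [span_image_simplexProj hX] at h2
  rw [setDim, setDim]
  omega

/-! ### Cells versus pairs of faces -/

namespace ColorInstance

variable {d : ℕ} {I : ColorInstance d} {ε : ℝ}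

/-- The face of the polyhedron that belongs to a cell. -/
def cellFace (I : ColorInstance d) (a : Finset (ConstraintIdx d)) : Set (Fin d × Fin d → ℝ) :=
  {x | x ∈ I.polyhedron ∧ ∀ k, x k ≠ 0 → redIdx k ∈ a}

/-- The face of the cube that belongs to a cell. -/
def cubeFace (a : Finset (ConstraintIdx d)) : Set (Fin d → ℝ) :=
  {μ | 0 ≤ μ ∧ μ ≤ 1 ∧ (∀ i ∈ a.toRight.toLeft, μ i = 0) ∧ ∀ i ∈ a.toRight.toRight, μ i = 1}

/-- The set of parameter vectors that belongs to a cell. -/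
def closedCell (I : ColorInstance d) (ε : ℝ) (a : Finset (ConstraintIdx d)) : Set (Fin d → ℝ) :=
  I.paramRegion ε (I.cellFace a) ∩ cubeFace a

theorem mem_paramRegion {f : Set (Fin d × Fin d → ℝ)} {μ : Fin d → ℝ} :
    μ ∈ I.paramRegion ε f ↔ ∀ x ∈ f, I.IsOptimal (I.cost ε μ) x := Iff.rfl

theorem IsFeasibleBasis.basicSol_mem_cellFace {β : Fin d → Fin d × Fin d}
    (hβ : I.IsFeasibleBasis β) {a : Finset (ConstraintIdx d)} (hb : ∀ l, redIdx (β l) ∈ a) :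
    I.basicSol β ∈ I.cellFace a := by
  refine ⟨hβ.basicSol_mem, fun k hk => ?_⟩
  by_cases hkβ : k ∈ Set.range β
  · obtain ⟨l, rfl⟩ := hkβ
    exact hb l
  · exact absurd (basicSol_of_notMem hkβ) hk

/-- A nonbasic tight column can enter the positive basic solution in a small amount, so the face
really uses every column of the cell. -/
theorem faceSupport_cellFace (hI : I.InGeneralPosition) {β : Fin d → Fin d × Fin d}
    (hβ : I.IsFeasibleBasis β) {a : Finset (ConstraintIdx d)} (hb : ∀ l, redIdx (β l) ∈ a) :
    faceSupport (I.cellFace a) = a.toLeft := by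
  ext k
  rw [mem_coe, mem_toLeft]
  constructor
  · rintro ⟨x, hx, hk⟩
    exact hx.2 k hk
  · intro hk
    by_cases hkβ : k ∈ Set.range β
    · obtain ⟨l, rfl⟩ := hkβ
      exact ⟨_, hβ.basicSol_mem_cellFace hb, (hβ.basicSol_pos hI l).ne'⟩
    · obtain ⟨x, hx, hxk, -, hz⟩ := hβ.exists_enter hI hkβ
      refine ⟨x, ⟨hx, fun j hj => ?_⟩, hxk.ne'⟩
      by_cases hjβ : j ∈ Set.range β
      · obtain ⟨l, rfl⟩ := hjβ
        exact hb l
      · by_cases hjk : j = k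
        · rw [hjk]; exact hk
        · exact absurd (hz j hjβ hjk) hj

theorem mem_paramRegion_cellFace (hI : I.InGeneralPosition) {β : Fin d → Fin d × Fin d}
    (hβ : I.IsFeasibleBasis β) {a : Finset (ConstraintIdx d)} (hb : ∀ l, redIdx (β l) ∈ a)
    {μ : Fin d → ℝ} :
    μ ∈ I.paramRegion ε (I.cellFace a) ↔ (∀ k, 0 ≤ I.reducedCost β (I.cost ε μ) k) ∧
      ∀ k, redIdx k ∈ a → I.reducedCost β (I.cost ε μ) k = 0 := by
  rw [mem_paramRegion]
  constructor
  · intro h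
    have hr := hβ.reducedCost_nonneg hI (h _ (hβ.basicSol_mem_cellFace hb))
    refine ⟨hr, fun k hk => ?_⟩
    have hk' : k ∈ faceSupport (I.cellFace a) := by
      rw [faceSupport_cellFace hI hβ hb]
      simpa using hk
    obtain ⟨x, hx, hxk⟩ := hk'
    exact ((hβ.isOptimal_iff hr).1 (h x hx)).2 k hxk
  · rintro ⟨hr, hz⟩ x ⟨hx, hxa⟩
    exact (hβ.isOptimal_iff hr).2 ⟨hx, fun k hk => hz k (hxa k hk)⟩

theorem mem_closedCell (hI : I.InGeneralPosition) {β : Fin d → Fin d × Fin d}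
    (hβ : I.IsFeasibleBasis β) {a : Finset (ConstraintIdx d)} (hb : ∀ l, redIdx (β l) ∈ a)
    {μ : Fin d → ℝ} : μ ∈ I.closedCell ε a ↔
      (∀ e, 0 ≤ I.slack ε β μ e) ∧ ∀ e ∈ a, I.slack ε β μ e = 0 := by
  rw [closedCell, Set.mem_inter_iff, mem_paramRegion_cellFace hI hβ hb]
  constructor
  · rintro ⟨⟨h1, h2⟩, h3, h4, h5, h6⟩
    refine ⟨?_, ?_⟩
    · rintro (k | i | i)
      · exact h1 k
      · exact h3 i
      · exact sub_nonneg.2 (h4 i)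
    · rintro (k | i | i) he
      · exact h2 k he
      · exact h5 i (mem_toLeft.2 (mem_toRight.2 he))
      · exact sub_eq_zero.2 (h6 i (mem_toRight.2 (mem_toRight.2 he))).symm
  · rintro ⟨h1, h2⟩
    refine ⟨⟨fun k => h1 (redIdx k), fun k hk => h2 _ hk⟩, fun i => h1 (zeroIdx i), fun i => ?_,
      fun i hi => h2 (zeroIdx i) (mem_toRight.1 (mem_toLeft.1 hi)), fun i hi => ?_⟩
    · exact sub_nonneg.1 (h1 (oneIdx i))
    · exact (sub_eq_zero.1 (h2 (oneIdx i) (mem_toRight.1 (mem_toRight.1 hi)))).symm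

theorem IsType.mem_closedCell (hI : I.InGeneralPosition) {μ : Fin d → ℝ}
    {a a' : Finset (ConstraintIdx d)} (h : I.IsType ε μ a) (hsub : a' ⊆ a)
    {β : Fin d → Fin d × Fin d} (hβ : I.IsFeasibleBasis β) (hb : ∀ l, redIdx (β l) ∈ a') :
    μ ∈ I.closedCell ε a' := by
  obtain ⟨h1, h2⟩ := h.of_basis hβ fun l => hsub (hb l)
  exact (ColorInstance.mem_closedCell hI hβ hb).2 ⟨h1, fun e he => (h2 e).1 (hsub he)⟩

theorem IsCell.subset_of_mem (hI : I.InGeneralPosition) {μ : Fin d → ℝ}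
    {a a' : Finset (ConstraintIdx d)} (ha' : I.IsCell ε a') (h : I.IsType ε μ a)
    (hμ : μ ∈ I.closedCell ε a') : a' ⊆ a := by
  obtain ⟨⟨μ', hμ'⟩, -⟩ := ha'
  obtain ⟨β, hβ, hb⟩ := hμ'.exists_basis
  obtain ⟨h1, h2⟩ := (mem_closedCell hI hβ hb).1 hμ
  classical
  have htype : I.IsType ε μ (univ.filter fun e => I.slack ε β μ e = 0) :=
    ⟨β, hβ, h1, fun e => by simp⟩
  rw [h.unique hI htype]
  exact fun e he => mem_filter.2 ⟨mem_univ e, h2 e he⟩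

theorem IsCell.cubeFace_mem {a : Finset (ConstraintIdx d)} (h : I.IsCell ε a) :
    cubeFace a ∈ facesM d := by
  obtain ⟨i, hi⟩ := h.2
  refine ⟨a.toRight.toLeft, a.toRight.toRight, disjoint_left.2 fun j hj hj' => ?_,
    ⟨i, mem_toRight.2 (mem_toRight.2 hi)⟩, rfl⟩
  exact h.zero_notMem_of_one_mem (mem_toRight.1 (mem_toRight.1 hj'))
    (mem_toRight.1 (mem_toLeft.1 hj))

theorem IsCell.closedCell_subset {a : Finset (ConstraintIdx d)} (h : I.IsCell ε a) :
    I.closedCell ε a ⊆ cubeM d := fun _ hμ => facesM_subset h.cubeFace_mem hμ.2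

/-- The exposing functional is the negative cost at any parameter vector whose tight set is `a`. -/
theorem IsCell.isFace {a : Finset (ConstraintIdx d)}
    (h : I.IsCell ε a) : I.IsFace (I.cellFace a) := by
  obtain ⟨⟨μ, hμ⟩, -⟩ := h
  obtain ⟨β, hβ, hb⟩ := hμ.exists_basis
  obtain ⟨h1, h2⟩ := hμ.of_basis hβ hb
  refine ⟨⟨_, hβ.basicSol_mem_cellFace hb⟩, fun _ =>
    ⟨-(∑ k, I.cost ε μ k • ContinuousLinearMap.proj (R := ℝ) (φ := fun _ => ℝ) k), ?_⟩⟩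
  ext x
  have hiff := hβ.isOptimal_iff (c := I.cost ε μ) (fun k => h1 (redIdx k)) (x := x)
  have hface : x ∈ I.cellFace a ↔ I.IsOptimal (I.cost ε μ) x := by
    rw [hiff]
    exact and_congr_right fun _ => forall_congr' fun k => imp_congr_right fun _ => h2 _
  rw [hface]
  simp [IsOptimal]

theorem IsCell.cellFace_mem (hI : I.InGeneralPosition) {a : Finset (ConstraintIdx d)}
    (h : I.IsCell ε a) : I.cellFace a ∈ I.facesF ε := by
  refine ⟨h.isFace, ?_⟩
  obtain ⟨⟨μ, hμ⟩, -⟩ := id h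
  obtain ⟨β, hβ, hb⟩ := hμ.exists_basis
  have := hμ.mem_closedCell hI subset_rfl hβ hb
  exact ⟨μ, this.1, h.closedCell_subset this⟩

/-- A face of the polyhedron is determined by its support. -/
theorem IsFace.eq_support {f : Set (Fin d × Fin d → ℝ)} (hf : I.IsFace f) :
    f = {x | x ∈ I.polyhedron ∧ ∀ k, x k ≠ 0 → k ∈ faceSupport f} := by
  obtain ⟨⟨x₀, hx₀⟩, hexp⟩ := hf
  obtain ⟨l, hl⟩ := hexp ⟨x₀, hx₀⟩
  have hmem : ∀ x, x ∈ f ↔ x ∈ I.polyhedron ∧ ∀ y ∈ I.polyhedron, l y ≤ l x := by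
    intro x
    rw [hl]
    rfl
  classical
  have hconv : Convex ℝ f := by
    have hP : Convex ℝ I.polyhedron := by
      intro x hx y hy s t hs ht hst
      rw [mem_polyhedron] at hx hy ⊢
      refine ⟨?_, fun k => ?_⟩
      · simp only [Pi.add_apply, Pi.smul_apply, smul_eq_mul, add_smul, mul_smul, sum_add_distrib,
          ← smul_sum, hx.1, hy.1]
        rw [← add_smul, hst, one_smul]
      · have := hx.2 k
        have := hy.2 k
        simp only [Pi.zero_apply, Pi.add_apply, Pi.smul_apply, smul_eq_mul] at *
        positivity
    exact IsExposed.convex hexp hP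
  choose! g hg hgk using fun k (hk : k ∈ faceSupport f) => hk
  set c : Fin d × Fin d → Fin d × Fin d → ℝ := fun k => if k ∈ faceSupport f then g k else x₀
  have hc : ∀ k, c k ∈ f := by
    intro k
    by_cases hk : k ∈ faceSupport f
    · simpa [c, hk] using hg k hk
    · simpa [c, hk] using hx₀
  have hcP : ∀ k j, 0 ≤ c k j := fun k => (I.mem_polyhedron.1 ((hmem _).1 (hc k)).1).2
  rcases isEmpty_or_nonempty (Fin d × Fin d) with hE | hE
  · ext x
    rw [Subsingleton.elim x x₀]
    exact ⟨fun h => ⟨((hmem _).1 h).1, fun k => isEmptyElim k⟩, fun _ => hx₀⟩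
  set n : ℝ := (Fintype.card (Fin d × Fin d) : ℝ) with hn
  have hn0 : 0 < n := by
    rw [hn]
    exact_mod_cast Fintype.card_pos
  -- The average of points witnessing the support is a point of `f` that is positive on the whole
  -- support.
  set z : Fin d × Fin d → ℝ := ∑ k, n⁻¹ • c k with hz
  have hzf : z ∈ f := hconv.sum_mem (fun _ _ => by positivity)
    (by rw [sum_const, card_univ, nsmul_eq_mul, ← hn, mul_inv_cancel₀ hn0.ne']) fun k _ => hc k
  have hzpos : ∀ k ∈ faceSupport f, 0 < z k := by
    intro k hk
    have h1 : 0 < c k k := lt_of_le_of_ne (hcP k k) (by simpa [c, hk] using (hgk k hk).symm)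
    rw [hz, Finset.sum_apply]
    refine sum_pos' (fun j _ => ?_) ⟨k, mem_univ k, ?_⟩
    · have := hcP j k
      simp only [Pi.smul_apply, smul_eq_mul]
      positivity
    · simp only [Pi.smul_apply, smul_eq_mul]
      positivity
  obtain ⟨hzP, hzmax⟩ := (hmem z).1 hzf
  obtain ⟨hzb, hz0⟩ := I.mem_polyhedron.1 hzP
  ext x
  constructor
  · exact fun hx => ⟨((hmem x).1 hx).1, fun k hk => ⟨x, hx, hk⟩⟩
  · rintro ⟨hx, hxs⟩
    obtain ⟨hxb, hx0⟩ := I.mem_polyhedron.1 hx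
    -- A short step from `z` away from `x` is feasible, so maximality of `l` at `z` gives `l z ≤ l
    -- x`.
    obtain ⟨t, ht, hpos⟩ := exists_pos_forall_add_mul_pos z (z - x) (· ∈ faceSupport f) hzpos
    have hw : z + t • (z - x) ∈ I.polyhedron := by
      refine I.mem_polyhedron.2 ⟨?_, fun k => ?_⟩
      · simp [add_smul, sub_smul, sum_add_distrib, mul_smul, ← smul_sum, hxb, hzb]
      · by_cases hk : k ∈ faceSupport f
        · exact (hpos k hk).le
        · have h1 : x k = 0 := by
            by_contra h
            exact hk (hxs k h)
          have h2 : z k = 0 := by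
            by_contra h
            exact hk ⟨z, hzf, h⟩
          simp [h1, h2]
    have h1 := hzmax _ hw
    rw [map_add, map_smul, map_sub, smul_eq_mul] at h1
    have h2 : 0 ≤ l x - l z := by
      by_contra hcon
      push Not at hcon
      have := mul_pos ht (neg_pos.2 hcon)
      linarith
    exact (hmem x).2 ⟨hx, fun y hy => (hzmax y hy).trans (by linarith)⟩

/-- The pairs of faces with a common parameter vector come from cells. -/
theorem exists_isCell (hI : I.InGeneralPosition) (hs : I.IsSuitable ε)
    {f : Set (Fin d × Fin d → ℝ)} (hf : I.IsFace f) {g : Set (Fin d → ℝ)} (hg : g ∈ facesM d)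
    (hne : (I.paramRegion ε f ∩ g).Nonempty) :
    ∃ a, I.IsCell ε a ∧ f = I.cellFace a ∧ g = cubeFace a := by
  classical
  obtain ⟨I₀, I₁, -, ⟨i, hi⟩, hgeq⟩ := id hg
  set a : Finset (ConstraintIdx d) := (faceSupport f).toFinset.disjSum (I₀.disjSum I₁) with ha
  have hfa : f = I.cellFace a := by
    refine hf.eq_support.trans ?_
    ext x
    simp [cellFace, ha]
  have hga : g = cubeFace a := by
    rw [hgeq]
    simp [cubeFace, ha]
  refine ⟨a, ?_, hfa, hga⟩
  obtain ⟨x, hx⟩ := hf.1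
  rw [hfa] at hx
  obtain ⟨β, hβ, hβx⟩ := hI.exists_feasibleBasis hx.1
  have hb : ∀ l, redIdx (β l) ∈ a := fun l => hx.2 _ (hβx l)
  have hone : oneIdx i ∈ a := by simpa [ha] using hi
  obtain ⟨μ, hμ⟩ := hne
  rw [hfa, hga] at hμ
  obtain ⟨h1, h2⟩ := (mem_closedCell hI hβ hb).1 hμ
  -- More than `a` may be tight at `μ`, but `a` contains a basis and an upper bound, so the surplus
  -- can be relaxed.
  have hsub : a ⊆ univ.filter fun e => I.slack ε β μ e = 0 :=
    fun e he => mem_filter.2 ⟨mem_univ e, h2 e he⟩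
  have hcell : I.IsCell ε (univ.filter fun e => I.slack ε β μ e = 0) :=
    ⟨⟨μ, β, hβ, h1, fun e => by simp⟩, i, hsub hone⟩
  exact hcell.of_subset hs hsub hβ hb ⟨i, hone⟩

theorem paramRegionProj_inter (f : Set (Fin d × Fin d → ℝ)) {g : Set (Fin d → ℝ)}
    (hg : g ∈ facesM d) :
    I.paramRegionProj ε f ∩ simplexProj '' g = simplexProj '' (I.paramRegion ε f ∩ g) := by
  rw [paramRegionProj, ← (simplexProj_injOn d).image_inter Set.inter_subset_right
    (facesM_subset hg), Set.inter_assoc, Set.inter_eq_self_of_subset_right (facesM_subset hg)]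

theorem IsCell.closedCell_nonempty (hI : I.InGeneralPosition) {a : Finset (ConstraintIdx d)}
    (h : I.IsCell ε a) : (I.closedCell ε a).Nonempty := by
  obtain ⟨⟨μ, hμ⟩, -⟩ := h
  obtain ⟨β, hβ, hb⟩ := hμ.exists_basis
  exact ⟨μ, hμ.mem_closedCell hI subset_rfl hβ hb⟩

theorem mem_complexQ_iff (hI : I.InGeneralPosition) (hs : I.IsSuitable ε)
    {q : Set (Fin d → ℝ)} :
    q ∈ I.complexQ ε ↔ ∃ a, I.IsCell ε a ∧ q = simplexProj '' I.closedCell ε a := by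
  constructor
  · rintro ⟨hne, f, hf, g, hg, rfl⟩
    obtain ⟨a, ha, rfl, rfl⟩ := exists_isCell hI hs hf.1 hg (Set.image_nonempty.1 hne)
    exact ⟨a, ha, rfl⟩
  · rintro ⟨a, ha, rfl⟩
    exact ⟨(ha.closedCell_nonempty hI).image _, _, ha.cellFace_mem hI, _, ha.cubeFace_mem, rfl⟩

/-- The barycenter of the projection of a cell. -/
noncomputable def cellBarycenter (I : ColorInstance d) (ε : ℝ) (a : Finset (ConstraintIdx d)) :
    Fin d → ℝ :=
  polytopeBarycenter (simplexProj '' I.closedCell ε a)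

theorem isBarycenterOf_iff (hI : I.InGeneralPosition) (hs : I.IsSuitable ε) {v : Fin d → ℝ}
    {f : Set (Fin d × Fin d → ℝ)} {g : Set (Fin d → ℝ)} :
    I.IsBarycenterOf ε v f g ↔ ∃ a, I.IsCell ε a ∧ v = I.cellBarycenter ε a ∧
      f = I.cellFace a ∧ g = simplexProj '' cubeFace a := by
  constructor
  · rintro ⟨hf, ⟨g', hg', rfl⟩, hne, rfl⟩
    rw [paramRegionProj_inter f hg'] at hne ⊢
    obtain ⟨a, ha, rfl, rfl⟩ := exists_isCell hI hs hf.1 hg' (Set.image_nonempty.1 hne)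
    exact ⟨a, ha, rfl, rfl, rfl⟩
  · rintro ⟨a, ha, rfl, rfl, rfl⟩
    refine ⟨ha.cellFace_mem hI, ⟨_, ha.cubeFace_mem, rfl⟩, ?_⟩
    rw [paramRegionProj_inter _ ha.cubeFace_mem]
    exact ⟨(ha.closedCell_nonempty hI).image _, rfl⟩

theorem IsCell.setDim_closedCell (hI : I.InGeneralPosition) (hs : I.IsSuitable ε)
    {a : Finset (ConstraintIdx d)} (h : I.IsCell ε a) :
    setDim (I.closedCell ε a) + a.card = 2 * d := by
  obtain ⟨⟨μ, hμ⟩, -⟩ := h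
  obtain ⟨β, hβ, hb⟩ := hμ.exists_basis
  obtain ⟨h1, h2⟩ := hμ.of_basis hβ hb
  have hmem {ν : Fin d → ℝ} := mem_closedCell (ε := ε) (μ := ν) hI hβ hb
  rw [← hs.finrank_ker_add_card hβ (fun e he => (h2 e).1 he) hb, setDim,
    vectorSpan_eq_of_relative_interior (hμ.mem_closedCell hI subset_rfl hβ hb)]
  · intro ν hν
    rw [mem_ker_slackRestrict]
    intro e he
    have := I.slack_add ε β μ (ν - μ) e
    rw [add_sub_cancel, (h2 e).1 he, (hmem.1 hν).2 e he] at this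
    linarith
  · intro w hw
    rw [mem_ker_slackRestrict] at hw
    obtain ⟨t, ht, hpos⟩ := exists_pos_forall_add_mul_pos (I.slack ε β μ) (I.slackLin β w)
      (fun e => e ∉ a) fun e he => lt_of_le_of_ne (h1 e) fun h0 => he ((h2 e).2 h0.symm)
    have hz : ∀ e ∈ a, I.slack ε β (μ + t • w) e = 0 := by
      intro e he
      rw [slack_add_smul, (h2 e).1 he, hw e he]
      ring
    refine ⟨t, ht, hmem.2 ⟨fun e => ?_, hz⟩⟩
    by_cases he : e ∈ a
    · exact (hz e he).ge
    · rw [slack_add_smul]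
      exact (hpos e he).le

theorem IsCell.setDim_image (hI : I.InGeneralPosition) (hs : I.IsSuitable ε)
    {a : Finset (ConstraintIdx d)} (h : I.IsCell ε a) :
    setDim (simplexProj '' I.closedCell ε a) + a.card = 2 * d := by
  obtain ⟨i, hi⟩ := h.2
  rw [setDim_image_simplexProj h.closedCell_subset (h.closedCell_nonempty hI) (i := i),
    h.setDim_closedCell hI hs]
  intro μ hμ
  exact hμ.2.2.2.2 i (mem_toRight.2 (mem_toRight.2 hi))

/-- The slack of a constraint, homogenized by the coordinate `i₀`. -/
noncomputable def slackHom (I : ColorInstance d) (ε : ℝ) (β : Fin d → Fin d × Fin d) (i₀ : Fin d)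
    (e : ConstraintIdx d) : (Fin d → ℝ) →ₗ[ℝ] ℝ :=
  LinearMap.proj e ∘ₗ I.slackLin β + I.slack ε β 0 e • LinearMap.proj i₀

theorem slackHom_apply (β : Fin d → Fin d × Fin d) (i₀ : Fin d)
    (e : ConstraintIdx d) (ν : Fin d → ℝ) :
    I.slackHom ε β i₀ e ν = I.slackLin β ν e + I.slack ε β 0 e * ν i₀ := rfl

theorem slackHom_eq_slack (β : Fin d → Fin d × Fin d) {i₀ : Fin d} (e : ConstraintIdx d)
    {μ : Fin d → ℝ} (hμ : μ i₀ = 1) : I.slackHom ε β i₀ e μ = I.slack ε β μ e := by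
  have := I.slack_add ε β 0 μ e
  rw [zero_add] at this
  rw [slackHom_apply, hμ, this]
  ring

/-- The barycenter of the projection of a cell is the projection of a point in the relative
interior of the cell. -/
theorem IsCell.cellBarycenter_spec (hI : I.InGeneralPosition) {a : Finset (ConstraintIdx d)}
    (h : I.IsCell ε a) :
    ∃ μ ∈ cubeM d, I.IsType ε μ a ∧ I.cellBarycenter ε a = simplexProj μ := by
  obtain ⟨⟨μ₀, hμ₀⟩, i₀, hi₀⟩ := id h
  obtain ⟨β, hβ, hb⟩ := hμ₀.exists_basis
  have hmem {ν : Fin d → ℝ} := mem_closedCell (ε := ε) (μ := ν) hI hβ hb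
  have hone : ∀ μ ∈ I.closedCell ε a, μ i₀ = 1 := fun μ hμ =>
    hμ.2.2.2.2 i₀ (mem_toRight.2 (mem_toRight.2 hi₀))
  set σ : (Fin d → ℝ) →ₗ[ℝ] ℝ := ∑ i, LinearMap.proj i with hσ
  have hσa : ∀ ν, σ ν = ∑ i, ν i := fun ν => by simp [hσ]
  -- On `μ i₀ = 1` slacks agree with linear forms, which the projection only rescales by a positive
  -- factor. Conversely, the forms of the bounds give `0 ≤ ν i ≤ ν i₀`, so `ν i₀ > 0` and dividing
  -- by it returns to the cell.
  have hq : ∀ ν, ν ∈ simplexProj '' I.closedCell ε a ↔ σ ν = 1 ∧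
      (∀ e, 0 ≤ I.slackHom ε β i₀ e ν) ∧ ∀ e, e ∈ a → I.slackHom ε β i₀ e ν = 0 := by
    intro ν
    constructor
    · rintro ⟨μ, hμ, rfl⟩
      have hM := h.closedCell_subset hμ
      have hs := sum_abs_pos (ne_zero_of_mem_cubeM hM)
      obtain ⟨g1, g2⟩ := hmem.1 hμ
      have hH : ∀ e, I.slackHom ε β i₀ e (simplexProj μ) = (∑ i, |μ i|)⁻¹ * I.slack ε β μ e := by
        intro e
        rw [simplexProj, map_smul, slackHom_eq_slack β e (hone μ hμ), smul_eq_mul]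
      refine ⟨by rw [hσa, sum_simplexProj hM], fun e => ?_, fun e he => ?_⟩
      · rw [hH]
        exact mul_nonneg (inv_nonneg.2 hs.le) (g1 e)
      · rw [hH, g2 e he, mul_zero]
    · rintro ⟨g0, g1, g2⟩
      rw [hσa] at g0
      have hν0 : ∀ i, 0 ≤ ν i := by
        intro i
        have := g1 (zeroIdx i)
        rw [slackHom_apply] at this
        simpa using this
      have hν1 : ∀ i, ν i ≤ ν i₀ := by
        intro i
        have := g1 (oneIdx i)
        rw [slackHom_apply] at this
        simpa using this
      have hpos : 0 < ν i₀ := by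
        refine lt_of_le_of_ne (hν0 i₀) fun h0 => ?_
        have : ∑ i, ν i = 0 := sum_eq_zero fun i _ => le_antisymm (h0 ▸ hν1 i) (hν0 i)
        rw [g0] at this
        exact one_ne_zero this
      have hμ1 : ((ν i₀)⁻¹ • ν) i₀ = 1 := by
        rw [Pi.smul_apply, smul_eq_mul, inv_mul_cancel₀ hpos.ne']
      have hH : ∀ e, I.slack ε β ((ν i₀)⁻¹ • ν) e = (ν i₀)⁻¹ * I.slackHom ε β i₀ e ν := by
        intro e
        rw [← slackHom_eq_slack β e hμ1, map_smul, smul_eq_mul]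
      refine ⟨(ν i₀)⁻¹ • ν, hmem.2 ⟨fun e => ?_, fun e he => ?_⟩, ?_⟩
      · rw [hH]
        exact mul_nonneg (inv_nonneg.2 hpos.le) (g1 e)
      · rw [hH, g2 e he, mul_zero]
      · have : ∑ i, |((ν i₀)⁻¹ • ν) i| = (ν i₀)⁻¹ := by
          have habs : ∀ i, |((ν i₀)⁻¹ • ν) i| = (ν i₀)⁻¹ * ν i := fun i =>
            abs_of_nonneg (mul_nonneg (inv_nonneg.2 hpos.le) (hν0 i))
          simp only [habs]
          rw [← mul_sum, g0, mul_one]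
        rw [simplexProj, this, inv_inv, smul_smul, mul_inv_cancel₀ hpos.ne', one_smul]
  have hbdd : Bornology.IsBounded (simplexProj '' I.closedCell ε a) := by
    refine (Metric.isBounded_Icc (0 : Fin d → ℝ) 1).subset ?_
    rintro _ ⟨μ, hμ, rfl⟩
    have hM := h.closedCell_subset hμ
    have hnn : ∀ i, 0 ≤ simplexProj μ i := fun i =>
      mul_nonneg (inv_nonneg.2 (sum_nonneg fun _ _ => abs_nonneg _)) (hM.1 i)
    refine ⟨hnn, fun i => ?_⟩
    rw [Pi.one_apply, ← sum_simplexProj hM]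
    exact single_le_sum (fun j _ => hnn j) (mem_univ i)
  obtain ⟨⟨μ, hμ, hμv⟩, hbary⟩ := polytopeBarycenter_spec (fun e => I.slackHom ε β i₀ e) σ
    (fun e => e ∈ a) hq hbdd ((h.closedCell_nonempty hI).image _)
  have hM := h.closedCell_subset hμ
  obtain ⟨g1, g2⟩ := hmem.1 hμ
  obtain ⟨f1, f2⟩ := hμ₀.of_basis hβ hb
  have hμ₀c := hμ₀.mem_closedCell hI subset_rfl hβ hb
  refine ⟨μ, hM, ⟨β, hβ, g1, fun e => ⟨g2 e, fun h0 => ?_⟩⟩, hμv.symm⟩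
  -- A form vanishing at the barycenter vanishes on the whole cell, in particular at `μ₀`, where
  -- exactly `a` is tight.
  rw [f2]
  have h1 := hbary e (by
    rw [← hμv, simplexProj, map_smul, slackHom_eq_slack β e (hone μ hμ), h0, smul_zero])
    _ ⟨μ₀, hμ₀c, rfl⟩
  rw [simplexProj, map_smul, slackHom_eq_slack β e (hone μ₀ hμ₀c), smul_eq_mul] at h1
  exact (mul_eq_zero.1 h1).resolve_left (inv_ne_zero
    (sum_abs_pos (ne_zero_of_mem_cubeM (h.closedCell_subset hμ₀c))).ne')

theorem cellBarycenter_injOn (hI : I.InGeneralPosition) {a a' : Finset (ConstraintIdx d)}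
    (h : I.IsCell ε a) (h' : I.IsCell ε a') (heq : I.cellBarycenter ε a = I.cellBarycenter ε a') :
    a = a' := by
  obtain ⟨μ, hμ, ht, hv⟩ := h.cellBarycenter_spec hI
  obtain ⟨μ', hμ', ht', hv'⟩ := h'.cellBarycenter_spec hI
  have : μ = μ' := simplexProj_injOn d hμ hμ' (by rw [← hv, ← hv', heq])
  subst this
  exact ht.unique hI ht'

theorem IsCell.subset_of_image_subset (hI : I.InGeneralPosition)
    {a a' : Finset (ConstraintIdx d)} (h : I.IsCell ε a) (h' : I.IsCell ε a')
    (hsub : simplexProj '' I.closedCell ε a ⊆ simplexProj '' I.closedCell ε a') : a' ⊆ a := by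
  obtain ⟨⟨μ, hμ⟩, -⟩ := id h
  obtain ⟨β, hβ, hb⟩ := hμ.exists_basis
  have hmem := hμ.mem_closedCell hI subset_rfl hβ hb
  obtain ⟨μ', hμ', heq⟩ := hsub ⟨μ, hmem, rfl⟩
  have : μ' = μ := simplexProj_injOn d (h'.closedCell_subset hμ') (h.closedCell_subset hmem) heq
  subst this
  exact h'.subset_of_mem hI hμ hμ'

theorem closedCell_anti (hI : I.InGeneralPosition) {a a' : Finset (ConstraintIdx d)}
    (h' : I.IsCell ε a') (hsub : a' ⊆ a) : I.closedCell ε a ⊆ I.closedCell ε a' := by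
  obtain ⟨⟨μ, hμ⟩, -⟩ := h'
  obtain ⟨β, hβ, hb⟩ := hμ.exists_basis
  intro ν hν
  obtain ⟨h1, h2⟩ := (mem_closedCell hI hβ fun l => hsub (hb l)).1 hν
  exact (mem_closedCell hI hβ hb).2 ⟨h1, fun e he => h2 e (hsub he)⟩

end ColorInstance

/-! ### Small perturbations are suitable -/

namespace ColorInstance

variable {d : ℕ} {I : ColorInstance d}

/-- The position of a column among all the columns. -/
def columnNumber (k : Fin d × Fin d) : ℕ := (k.1 : ℕ) * d + (k.2 : ℕ) + 1

theorem columnNumber_injective : Function.Injective (columnNumber (d := d)) := by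
  rintro ⟨i, j⟩ ⟨i', j'⟩ h
  have h1 : (i : ℕ) * d + j = i' * d + j' := Nat.succ_injective h
  have hd : 0 < d := i.pos
  have hi := congrArg (· / d) h1
  have hj := congrArg (· % d) h1
  simp only [Nat.mul_comm _ d, Nat.mul_add_div hd, Nat.div_eq_of_lt j.2, Nat.div_eq_of_lt j'.2,
    Nat.mul_add_mod, Nat.mod_eq_of_lt j.2, Nat.mod_eq_of_lt j'.2] at hi hj
  exact Prod.ext (Fin.ext hi) (Fin.ext hj)

open Polynomial in
/-- The cost of a column for the parameter vector zero as a polynomial in the perturbation. -/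
noncomputable def costPoly (I : ColorInstance d) (k : Fin d × Fin d) : ℝ[X] :=
  C (1 + d * (I.N : ℝ) ^ 2) + X ^ columnNumber k

open Polynomial in
/-- The slacks of the parameter vector zero as polynomials in the perturbation. -/
noncomputable def slackPoly (I : ColorInstance d) (β : Fin d → Fin d × Fin d) :
    ConstraintIdx d → ℝ[X] :=
  Sum.elim
    (fun k => I.costPoly k -
      ∑ l, C ((I.A.submatrix id β)⁻¹.mulVec (I.column k) l) * I.costPoly (β l))
    (Sum.elim 0 1)

theorem eval_slackPoly (ε : ℝ) (β : Fin d → Fin d × Fin d) (e : ConstraintIdx d) :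
    (I.slackPoly β e).eval ε = I.slack ε β 0 e := by
  have hc : ∀ k, (I.costPoly k).eval ε = I.cost ε 0 k := by
    intro k
    simp [costPoly, cost, columnNumber]
  rcases e with k | i | i
  · simp only [slackPoly, Sum.elim_inl, Polynomial.eval_sub, Polynomial.eval_finsetSum,
      Polynomial.eval_mul, Polynomial.eval_C, hc, slack_redIdx, reducedCost, dotProduct,
      Function.comp_apply]
    congr 1
    exact sum_congr rfl fun l _ => mul_comm _ _
  · simp [slackPoly]
  · simp [slackPoly]

/-- The power of `ε` of a nonbasic column enters only its own reduced cost: any other involves just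
its own column and the basis, whose exponents are different. -/
theorem coeff_slackPoly {β : Fin d → Fin d × Fin d} {k : Fin d × Fin d} (hk : k ∉ Set.range β)
    (e : ConstraintIdx d) :
    (I.slackPoly β e).coeff (columnNumber k) = if e = redIdx k then 1 else 0 := by
  have hn : columnNumber k ≠ 0 := Nat.succ_ne_zero _
  have hc : ∀ j, (I.costPoly j).coeff (columnNumber k) = if j = k then 1 else 0 := by
    intro j
    rw [costPoly, Polynomial.coeff_add, Polynomial.coeff_C, if_neg hn, zero_add,
      Polynomial.coeff_X_pow]
    by_cases h : j = k
    · simp [h]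
    · rw [if_neg h, if_neg fun h' => h (columnNumber_injective h'.symm)]
  have hβ : ∀ l, β l ≠ k := fun l h => hk ⟨l, h⟩
  rcases e with j | i | i
  · simp only [slackPoly, Sum.elim_inl, Polynomial.coeff_sub, Polynomial.finsetSum_coeff,
      Polynomial.coeff_C_mul, hc, if_neg (hβ _), mul_zero, sum_const_zero, sub_zero,
      Sum.inl.injEq]
  · simp [slackPoly]
  · simp [slackPoly, Polynomial.coeff_one, hn]

/-- If the linear parts of the slacks are dependent, then for all but finitely many
perturbations the slacks do not vanish together. -/
theorem eventually_no_solution {β : Fin d → Fin d × Fin d} {s : Finset (ConstraintIdx d)}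
    (hs : ∀ k, redIdx k ∈ s → k ∉ Set.range β) (hd : ∀ i, zeroIdx i ∈ s → oneIdx i ∉ s)
    (hdep : ¬ LinearIndependent ℝ
      fun e : s => (LinearMap.proj (e : ConstraintIdx d) ∘ₗ I.slackLin β : Module.Dual ℝ (Fin d → ℝ))) :
    ∀ᶠ ε in nhdsWithin (0 : ℝ) (Set.Ioi 0), ¬ ∃ μ, ∀ e ∈ s, I.slack ε β μ e = 0 := by
  classical
  obtain ⟨c, hc, e₀, he₀⟩ := Fintype.not_linearIndependent_iff.1 hdep
  have hcw : ∀ w, ∑ e : s, c e * I.slackLin β w e = 0 := by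
    intro w
    have := LinearMap.congr_fun hc w
    simpa using this
  -- The relation involves a column: bounds alone are independent when no coordinate has both of
  -- them in `s`, as unit vectors show.
  obtain ⟨k, hk, hck⟩ : ∃ k, ∃ hk : redIdx k ∈ s, c ⟨redIdx k, hk⟩ ≠ 0 := by
    by_contra hcon
    push Not at hcon
    have key : ∀ i, ∀ w : Fin d → ℝ, w = Pi.single i 1 → ∀ e : s, c e ≠ 0 →
        (I.slackLin β w e ≠ 0 ↔ (e : ConstraintIdx d) = zeroIdx i ∨ (e : ConstraintIdx d) = oneIdx i) := by
      rintro i w rfl ⟨e, he⟩ hce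
      rcases e with k | j | j
      · exact absurd (hcon k he) hce
      · simp [Pi.single_apply]
      · simp [Pi.single_apply]
    obtain ⟨i, hi⟩ : ∃ i, (e₀ : ConstraintIdx d) = zeroIdx i ∨ (e₀ : ConstraintIdx d) = oneIdx i := by
      rcases e₀ with ⟨k | j | j, he⟩
      · exact absurd (hcon k he) he₀
      · exact ⟨j, Or.inl rfl⟩
      · exact ⟨j, Or.inr rfl⟩
    have h1 := hcw (Pi.single i 1)
    rw [sum_eq_single e₀] at h1
    · exact mul_ne_zero he₀ ((key i _ rfl e₀ he₀).2 hi) h1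
    · intro e _ hne
      by_contra h0
      have hce : c e ≠ 0 := left_ne_zero_of_mul h0
      have he := (key i _ rfl e hce).1 (right_ne_zero_of_mul h0)
      rcases hi with hi | hi <;> rcases he with he | he
      · exact hne (Subtype.ext (he.trans hi.symm))
      · exact hd i (hi ▸ e₀.2) (he ▸ e.2)
      · exact hd i (he ▸ e.2) (hi ▸ e₀.2)
      · exact hne (Subtype.ext (he.trans hi.symm))
    · simp
  -- Combining the slacks by the relation eliminates `μ`; a common zero makes `ε` a root of `p`,
  -- whose coefficient at the power of column `k` is `c k ≠ 0`.
  set p : Polynomial ℝ := ∑ e : s, Polynomial.C (c e) * I.slackPoly β e with hp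
  have hp0 : p ≠ 0 := by
    intro h0
    have := congrArg (fun q : Polynomial ℝ => q.coeff (columnNumber k)) h0
    simp only [hp, Polynomial.finsetSum_coeff, Polynomial.coeff_C_mul,
      coeff_slackPoly (hs k hk), Polynomial.coeff_zero] at this
    rw [sum_eq_single ⟨redIdx k, hk⟩] at this
    · simp [hck] at this
    · intro e _ he
      rw [if_neg fun h => he (Subtype.ext h), mul_zero]
    · simp
  have hroots : ∀ᶠ ε in nhdsWithin (0 : ℝ) (Set.Ioi 0), p.eval ε ≠ 0 := by
    have hfin : (p.rootSet ℝ).Finite := p.rootSet_finite ℝ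
    have h1 : ∀ᶠ ε in nhdsWithin (0 : ℝ) {0}ᶜ, ε ∉ p.rootSet ℝ := by
      have := (hfin.subset (Set.sdiff_subset (t := {0}))).isClosed.isOpen_compl.mem_nhds
        (x := (0 : ℝ)) (by simp)
      rw [eventually_nhdsWithin_iff]
      filter_upwards [this] with ε h1 h2 h3
      exact h1 ⟨h3, h2⟩
    refine (h1.filter_mono (nhdsWithin_mono _ fun ε hε => ne_of_gt hε)).mono fun ε hε h0 => hε ?_
    rw [Polynomial.mem_rootSet]
    exact ⟨hp0, by simpa using h0⟩
  refine hroots.mono fun ε hε => ?_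
  rintro ⟨μ, hμ⟩
  apply hε
  have h1 : ∑ e : s, c e * I.slack ε β μ e = 0 := sum_eq_zero fun e _ => by rw [hμ e e.2, mul_zero]
  have h2 : ∀ e : s, c e * I.slack ε β μ e = c e * I.slack ε β 0 e + c e * I.slackLin β μ e := by
    intro e
    have := I.slack_add ε β 0 μ e
    rw [zero_add] at this
    rw [this]
    ring
  rw [sum_congr rfl fun e _ => h2 e, sum_add_distrib, hcw μ, add_zero] at h1
  simpa [hp, Polynomial.eval_finsetSum, eval_slackPoly] using h1

theorem finrank_ker_of_linearIndependent {β : Fin d → Fin d × Fin d}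
    {s : Finset (ConstraintIdx d)}
    (h : LinearIndependent ℝ
      fun e : s => (LinearMap.proj (e : ConstraintIdx d) ∘ₗ I.slackLin β : Module.Dual ℝ (Fin d → ℝ))) :
    Module.finrank ℝ (LinearMap.ker (I.slackRestrict β s)) + s.card = d := by
  have h1 : Module.finrank ℝ (LinearMap.range (I.slackRestrict β s)) = s.card := by
    rw [LinearMap.range_eq_top.2, finrank_top, Module.finrank_fintype_fun_eq_card,
      Fintype.card_coe]
    rw [← LinearMap.dualMap_injective_iff, injective_iff_map_eq_zero]
    intro φ hφ
    rw [Fintype.linearIndependent_iff] at h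
    have h2 := h (fun e => φ fun j => if e = j then 1 else 0) (by
      refine LinearMap.ext fun w => ?_
      have h3 := LinearMap.congr_fun hφ w
      rw [LinearMap.dualMap_apply, φ.pi_apply_eq_sum_univ] at h3
      simpa [slackRestrict, LinearMap.funLeft, mul_comm] using h3)
    refine LinearMap.ext fun x => ?_
    rw [φ.pi_apply_eq_sum_univ]
    simp [h2]
  have h2 := (I.slackRestrict β s).finrank_range_add_finrank_ker
  rw [h1, Module.finrank_fintype_fun_eq_card, Fintype.card_fin] at h2
  omega

/-- All sufficiently small perturbations are suitable. -/
theorem exists_forall_isSuitable (I : ColorInstance d) :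
    ∃ ε₀ : ℝ, 0 < ε₀ ∧ ∀ ε : ℝ, 0 < ε → ε < ε₀ → I.IsSuitable ε := by
  classical
  have key : ∀ (β : Fin d → Fin d × Fin d) (J : Finset (Fin d × Fin d)) (I₀ I₁ : Finset (Fin d)),
      ∀ᶠ ε in nhdsWithin (0 : ℝ) (Set.Ioi 0), (∀ k ∈ J, k ∉ Set.range β) →
        let S : Set (Fin d → ℝ) := {μ | (∀ k ∈ J, I.reducedCost β (I.cost ε μ) k = 0) ∧
          (∀ i ∈ I₀, μ i = 0) ∧ ∀ i ∈ I₁, μ i = 1}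
        S.Nonempty → setDim S + (J.card + I₀.card + I₁.card) = d := by
    intro β J I₀ I₁
    simp only [slack_system_eq]
    set s : Finset (ConstraintIdx d) := J.disjSum (I₀.disjSum I₁) with hs
    have hcard : s.card = J.card + I₀.card + I₁.card := by
      rw [hs, card_disjSum, card_disjSum, add_assoc]
    rw [← hcard]
    by_cases hli : LinearIndependent ℝ
      fun e : s => (LinearMap.proj (e : ConstraintIdx d) ∘ₗ I.slackLin β : Module.Dual ℝ (Fin d → ℝ))
    · refine Filter.Eventually.of_forall ?_
      rintro ε - ⟨μ, hμ⟩
      rw [setDim_slack_eq_zero hμ]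
      exact finrank_ker_of_linearIndependent hli
    · by_cases hJ : ∀ k ∈ J, k ∉ Set.range β
      · by_cases hd : ∀ i, zeroIdx i ∈ s → oneIdx i ∉ s
        · have hsJ : ∀ k, redIdx k ∈ s → k ∉ Set.range β := fun k hk =>
            hJ k (by simpa [hs] using hk)
          refine (eventually_no_solution hsJ hd hli).mono ?_
          rintro ε hε - ⟨μ, hμ⟩
          exact absurd ⟨μ, hμ⟩ hε
        · push Not at hd
          obtain ⟨i, hi0, hi1⟩ := hd
          refine Filter.Eventually.of_forall ?_
          rintro ε - ⟨μ, hμ⟩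
          have h0 := hμ _ hi0
          have h1 := hμ _ hi1
          rw [slack_zeroIdx] at h0
          rw [slack_oneIdx, h0] at h1
          norm_num at h1
      · exact Filter.Eventually.of_forall fun ε h => absurd h hJ
  have hall := Filter.eventually_all.2 fun β => Filter.eventually_all.2 fun J =>
    Filter.eventually_all.2 fun I₀ => Filter.eventually_all.2 fun I₁ => key β J I₀ I₁
  obtain ⟨ε₀, hε₀, hsub⟩ := mem_nhdsGT_iff_exists_Ioo_subset.1 hall
  exact ⟨ε₀, hε₀, fun ε h0 h1 β _ J hJ I₀ I₁ => hsub ⟨h0, h1⟩ β J I₀ I₁ hJ⟩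

end ColorInstance

/-! ### The colorful Carathéodory theorem for cones -/

/-- A finitely generated cone is closed. -/
theorem isClosed_hull_range {d : ℕ} {ι : Type*} [Fintype ι] (v : ι → Fin d → ℝ) :
    IsClosed {p | RayEmbraces (Set.range v) p} := by
  classical
  -- By conic Carathéodory the cone is a finite union of cones over independent subfamilies, each a
  -- closed embedding of an orthant.
  have key : {p | RayEmbraces (Set.range v) p} =
      ⋃ s : {s : Finset ι // ∀ z : ι → ℝ, (∀ i, i ∉ s → z i = 0) → ∑ i, z i • v i = 0 → z = 0},
        (Fintype.linearCombination ℝ fun i : (s : Finset ι) => v i) '' {x | 0 ≤ x} := by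
    ext p
    simp only [Set.mem_ofPred_eq, Set.mem_iUnion]
    constructor
    · intro hp
      obtain ⟨x, hx, rfl⟩ := (rayEmbraces_range_iff v p).1 hp
      obtain ⟨y, hy, -, hyx, hind⟩ := exists_nonneg_independent_support v x hx
      refine ⟨⟨univ.filter fun i => y i ≠ 0, fun z hz => hind z fun i hi => hz i (by simp [hi])⟩,
        fun i => y i, fun i => hy i, ?_⟩
      rw [← hyx, Fintype.linearCombination_apply,
        sum_coe_sort (univ.filter fun i => y i ≠ 0) fun i => y i • v i]
      refine sum_subset (subset_univ _) fun i _ hi => ?_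
      have : y i = 0 := by simpa using hi
      rw [this, zero_smul]
    · rintro ⟨s, x, hx, rfl⟩
      rw [Fintype.linearCombination_apply]
      exact rayEmbraces_of_sum _ x hx fun i _ => ⟨i, rfl⟩
  rw [key]
  refine isClosed_iUnion_of_finite fun s => ?_
  have hker : LinearMap.ker (Fintype.linearCombination ℝ fun i : (s : Finset ι) => v i) = ⊥ := by
    rw [LinearMap.ker_eq_bot']
    intro x hx
    rw [Fintype.linearCombination_apply] at hx
    have := s.2 (fun i => if h : i ∈ (s : Finset ι) then x ⟨i, h⟩ else 0)
      (fun i hi => by simp [hi]) (by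
        refine Eq.trans ?_ hx
        rw [← sum_subset (subset_univ (s : Finset ι)) (fun i _ hi => by simp [hi]),
          ← sum_coe_sort]
        exact sum_congr rfl fun i _ => by simp)
    ext i
    simpa using congrFun this i
  exact (LinearMap.isClosedEmbedding_of_injective hker).isClosedMap _ isClosed_Ici

/-- A vector that ray-embraces a point to which it is acute, together with the nearest point,
improves the distance. -/
theorem exists_closer {d : ℕ} (p u q : Fin d → ℝ) (h : 0 < (q - p) ⬝ᵥ u) :
    ∃ t : ℝ, 0 < t ∧ t ≤ 1 ∧
      (q - (p + t • u)) ⬝ᵥ (q - (p + t • u)) < (q - p) ⬝ᵥ (q - p) := by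
  have hu : 0 ≤ u ⬝ᵥ u := sum_nonneg fun i _ => mul_self_nonneg _
  set r := q - p with hr
  have hexp : ∀ t : ℝ, (q - (p + t • u)) ⬝ᵥ (q - (p + t • u)) =
      r ⬝ᵥ r - t * (2 * (r ⬝ᵥ u) - t * (u ⬝ᵥ u)) := by
    intro t
    have : q - (p + t • u) = r - t • u := by rw [hr]; abel
    rw [this]
    simp only [sub_dotProduct, dotProduct_sub, smul_dotProduct, dotProduct_smul, smul_eq_mul,
      dotProduct_comm u r]
    ring
  have hpos : 0 < 1 + u ⬝ᵥ u + r ⬝ᵥ u := by positivity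
  -- This step `t` satisfies `t ≤ 1` and `t (u ⬝ᵥ u) ≤ r ⬝ᵥ u`, so the squared distance drops by at
  -- least `t (r ⬝ᵥ u)`.
  have h2 : 0 < (r ⬝ᵥ u) / (1 + u ⬝ᵥ u + r ⬝ᵥ u) := div_pos h hpos
  refine ⟨_, h2, ?_, ?_⟩
  · rw [div_le_one hpos]
    linarith
  · rw [hexp]
    have h1 : (r ⬝ᵥ u) / (1 + u ⬝ᵥ u + r ⬝ᵥ u) * (u ⬝ᵥ u) ≤ r ⬝ᵥ u := by
      rw [div_mul_eq_mul_div, div_le_iff₀ hpos]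
      nlinarith
    nlinarith

/-- The conic colorful Carathéodory theorem for finite color classes. -/
theorem colorful_caratheodory_finite {d : ℕ} {κ : Fin d → Type} [∀ i, Fintype (κ i)]
    [∀ i, Nonempty (κ i)] (v : ∀ i, κ i → Fin d → ℝ) (b : Fin d → ℝ)
    (h : ∀ i, RayEmbraces (Set.range (v i)) b) :
    ∃ c : ∀ i, κ i, RayEmbraces (Set.range fun i => v i (c i)) b := by
  classical
  set D : (Fin d → ℝ) → ℝ := fun p => (b - p) ⬝ᵥ (b - p) with hD
  have hDcont : Continuous D := by
    simp only [hD, dotProduct]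
    fun_prop
  have hnear : ∀ c : ∀ i, κ i, ∃ p, RayEmbraces (Set.range fun i => v i (c i)) p ∧
      ∀ p', RayEmbraces (Set.range fun i => v i (c i)) p' → D p ≤ D p' := by
    intro c
    have hcoco : Filter.Tendsto D (Filter.cocompact _) Filter.atTop := by
      have h1 : ∀ p, ‖p - b‖ ^ 2 ≤ D p := by
        intro p
        obtain hd | hd := isEmpty_or_nonempty (Fin d)
        · rw [Subsingleton.elim (p - b) 0, norm_zero, zero_pow two_ne_zero]
          exact sum_nonneg fun i _ => mul_self_nonneg _
        · obtain ⟨i, hi⟩ : ∃ i, ‖p - b‖ = ‖(p - b) i‖ := by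
            obtain ⟨i, -, hi⟩ := exists_max_image univ (fun i => ‖(p - b) i‖) univ_nonempty
            exact ⟨i, le_antisymm ((pi_norm_le_iff_of_nonneg (norm_nonneg _)).2
              fun j => hi j (mem_univ j)) (norm_le_pi_norm _ i)⟩
          rw [hi, Real.norm_eq_abs, sq_abs]
          have : (b - p) i * (b - p) i ≤ D p :=
            single_le_sum (f := fun i => (b - p) i * (b - p) i)
              (fun i _ => mul_self_nonneg _) (mem_univ i)
          simp only [Pi.sub_apply] at this ⊢
          linarith
      refine Filter.tendsto_atTop_mono h1 ?_
      refine (Filter.tendsto_pow_atTop two_ne_zero).comp ?_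
      have : (fun p : Fin d → ℝ => ‖p - b‖) = fun p => dist p b := by
        ext p
        rw [dist_eq_norm]
      rw [this]
      exact tendsto_dist_right_cocompact_atTop b
    obtain ⟨p, hp, hmin⟩ := hDcont.continuousOn.exists_isMinOn'
      (isClosed_hull_range fun i => v i (c i)) (x₀ := 0) (Submodule.zero_mem (PointedCone.hull ℝ _))
      ((hcoco.eventually_ge_atTop (D 0)).filter_mono inf_le_left)
    exact ⟨p, hp, fun p' hp' => hmin hp'⟩
  choose p hp hmin using hnear
  -- Bárány's argument: take the colorful cone nearest to `b`. If it misses `b`, exchanging one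
  -- color brings it closer.
  obtain ⟨c, -, hc⟩ := exists_min_image (univ : Finset (∀ i, κ i)) (fun c => D (p c))
    ⟨fun i => Classical.arbitrary _, mem_univ _⟩
  refine ⟨c, ?_⟩
  set r := b - p c with hr
  have hle : ∀ i, r ⬝ᵥ v i (c i) ≤ 0 := by
    intro i
    by_contra hcon
    push Not at hcon
    obtain ⟨t, ht, -, hlt⟩ := exists_closer _ _ _ hcon
    refine absurd (hmin c (p c + t • v i (c i)) ?_) (not_le.2 hlt)
    exact Submodule.add_mem _ (hp c)
      ((PointedCone.hull ℝ _).smul_mem ht.le (Submodule.subset_span ⟨i, rfl⟩))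
  have horth : 0 ≤ r ⬝ᵥ p c := by
    by_contra hcon
    push Not at hcon
    obtain ⟨t, ht, ht1, hlt⟩ := exists_closer (p c) (-(p c)) b (by rw [dotProduct_neg]; linarith)
    refine absurd (hmin c (p c + t • -(p c)) ?_) (not_le.2 hlt)
    have : p c + t • -(p c) = (1 - t) • p c := by
      rw [smul_neg, sub_smul, one_smul]; abel
    rw [this]
    exact (PointedCone.hull ℝ _).smul_mem (by linarith) (hp c)
  by_cases hr0 : r = 0
  · rw [show b = p c from sub_eq_zero.1 hr0]
    exact hp c
  exfalso
  have hrr : 0 < r ⬝ᵥ r := by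
    obtain ⟨i, hi⟩ := Function.ne_iff.1 hr0
    exact sum_pos' (fun j _ => mul_self_nonneg _) ⟨i, mem_univ i, mul_self_pos.2 hi⟩
  have hrb : 0 < r ⬝ᵥ b := by
    have : b = r + p c := by rw [hr]; abel
    rw [this, dotProduct_add]
    linarith
  obtain ⟨x, hx, hxp⟩ := (rayEmbraces_range_iff _ _).1 (hp c)
  obtain ⟨y, hy, -, hyx, hind⟩ := exists_nonneg_independent_support (fun i => v i (c i)) x hx
  have hyr : ∀ i, y i * (r ⬝ᵥ v i (c i)) = 0 := by
    have hsum : ∑ i, y i * (r ⬝ᵥ v i (c i)) = r ⬝ᵥ p c := by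
      rw [← hxp, ← hyx, dotProduct_sum]
      exact sum_congr rfl fun i _ => by rw [dotProduct_smul, smul_eq_mul]
    have hnp : ∀ i ∈ univ, y i * (r ⬝ᵥ v i (c i)) ≤ 0 := fun i _ =>
      mul_nonpos_of_nonneg_of_nonpos (hy i) (hle i)
    have h0 : ∑ i, y i * (r ⬝ᵥ v i (c i)) = 0 :=
      le_antisymm (sum_nonpos hnp) (hsum ▸ horth)
    exact fun i => (sum_eq_zero_iff_of_nonpos hnp).1 h0 i (mem_univ i)
  -- Generators with nonzero coefficient are orthogonal to `r ≠ 0`, so they cannot be `d`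
  -- independent ones; some color `i` is not needed for `p c`.
  obtain ⟨i, hi⟩ : ∃ i, y i = 0 := by
    by_contra hcon
    push Not at hcon
    have hli : LinearIndependent ℝ fun i => v i (c i) := by
      rw [Fintype.linearIndependent_iff]
      intro g hg
      exact congrFun (hind g (fun i hi => absurd hi (hcon i)) hg)
    have hM : IsUnit (Matrix.of fun i => v i (c i)) :=
      Matrix.linearIndependent_rows_iff_isUnit.1 hli
    have : Matrix.mulVec (Matrix.of fun i => v i (c i)) r = Matrix.mulVec (Matrix.of fun i => v i (c i)) 0 := by
      ext i
      rw [Matrix.mulVec_zero]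
      change v i (c i) ⬝ᵥ r = 0
      rw [dotProduct_comm]
      exact (mul_eq_zero.1 (hyr i)).resolve_left (hcon i)
    exact hr0 (Matrix.mulVec_injective_of_isUnit hM this)
  obtain ⟨z, hz, hzb⟩ := (rayEmbraces_range_iff _ _).1 (h i)
  obtain ⟨j, hj⟩ : ∃ j, 0 < r ⬝ᵥ v i j := by
    by_contra hcon
    push Not at hcon
    rw [← hzb, dotProduct_sum] at hrb
    refine absurd hrb (not_lt.2 (sum_nonpos fun j _ => ?_))
    rw [dotProduct_smul, smul_eq_mul]
    exact mul_nonpos_of_nonneg_of_nonpos (hz j) (hcon j)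
  obtain ⟨t, ht, -, hlt⟩ := exists_closer _ _ _ hj
  -- The exchange keeps `p c` in the cone and adds a generator at an acute angle to `r`.
  set c' := Function.update c i j with hc'
  have hmem : RayEmbraces (Set.range fun i => v i (c' i)) (p c + t • v i j) := by
    refine Submodule.add_mem _ ?_ ((PointedCone.hull ℝ _).smul_mem ht.le
      (Submodule.subset_span ⟨i, by simp [hc']⟩))
    rw [← hxp, ← hyx]
    refine rayEmbraces_of_sum _ y hy fun i' hi' => ⟨i', ?_⟩
    have hne : i' ≠ i := fun h => hi' (h ▸ hi)
    simp [hc', hne]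
  have h1 := hmin c' _ hmem
  have h2 := hc c' (mem_univ _)
  exact absurd (h2.trans h1) (not_le.2 hlt)

/-- The conic colorful Carathéodory theorem. -/
theorem colorful_caratheodory {d : ℕ} (C : Fin d → Set (Fin d → ℝ)) (b : Fin d → ℝ)
    (hC : ∀ i, (C i).Nonempty) (h : ∀ i, RayEmbraces (C i) b) :
    ∃ c : Fin d → Fin d → ℝ, (∀ i, c i ∈ C i) ∧ RayEmbraces (Set.range c) b := by
  classical
  have hfin : ∀ i, ∃ T : Finset (Fin d → ℝ), (T : Set (Fin d → ℝ)) ⊆ C i ∧ T.Nonempty ∧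
      RayEmbraces (T : Set (Fin d → ℝ)) b := by
    intro i
    obtain ⟨x, hx⟩ := hC i
    obtain ⟨T, hT, hTb⟩ := Submodule.mem_span_finite_of_mem_span (h i)
    refine ⟨insert x T, ?_, insert_nonempty x T, rayEmbraces_mono (by simp) hTb⟩
    rw [coe_insert]
    exact Set.insert_subset hx hT
  choose T hT hne hTb using hfin
  obtain ⟨n, e⟩ : ∃ n : Fin d → ℕ, ∀ i, Nonempty (Fin (n i) ≃ T i) :=
    ⟨fun i => (T i).card, fun i => ⟨(T i).equivFin.symm⟩⟩
  have e' := fun i => (e i).some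
  have : ∀ i, Nonempty (Fin (n i)) := fun i =>
    (e' i).symm.nonempty_congr.1 ((hne i).to_subtype)
  obtain ⟨c, hc⟩ := colorful_caratheodory_finite (fun i (j : Fin (n i)) => (e' i j : Fin d → ℝ)) b
    fun i => rayEmbraces_mono (fun x hx => ⟨(e' i).symm ⟨x, hx⟩, by simp⟩) (hTb i)
  exact ⟨_, fun i => hT i (e' i (c i)).2, hc⟩

/-! ### From majority colors to a colorful choice -/

theorem colorCount_mono {d : ℕ} {s t : Set (Fin d × Fin d)} (h : s ⊆ t) (c : Fin d) :
    colorCount s c ≤ colorCount t c :=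
  Set.ncard_le_ncard (Set.inter_subset_inter_left _ h) (Set.toFinite _)

/-- Removing indices of other colors does not change the majority color. -/
theorem IsMajorityColor.of_subset {d : ℕ} {s t : Set (Fin d × Fin d)} {c : Fin d}
    (h : IsMajorityColor t c) (hst : s ⊆ t) (hc : ∀ k ∈ t, k ∉ s → k.1 ≠ c) :
    IsMajorityColor s c := by
  have heq : colorCount t c ≤ colorCount s c := Set.ncard_le_ncard (fun k hk => by
    refine ⟨?_, hk.2⟩
    by_contra hks
    exact hc k hk.1 hks hk.2) (Set.toFinite _)
  exact ⟨fun j => (colorCount_mono hst j).trans ((h.1 j).trans heq),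
    fun j hj => (colorCount_mono hst j).trans_lt ((h.2 j hj).trans_le heq)⟩

theorem sum_colorCount {d : ℕ} (s : Finset (Fin d × Fin d)) :
    ∑ c, colorCount (s : Set (Fin d × Fin d)) c = s.card := by
  classical
  rw [card_eq_sum_card_fiberwise (f := Prod.fst) (t := univ) fun _ _ => by simp]
  refine sum_congr rfl fun c _ => ?_
  rw [colorCount, ← Set.ncard_coe_finset]
  congr 1
  ext k
  simp

/-- If a decreasing sequence of `d` index sets, in each step of which at most one index is removed,
has all the colors as majority colors, then its last member, if it has at most `d` elements, is a
colorful choice. -/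
theorem isColorfulChoice_of_majority {k : ℕ} (S : Fin (k + 1) → Finset (Fin (k + 1) × Fin (k + 1)))
    (hS : Antitone S) (hcard : ∀ i : Fin k, (S i.castSucc).card ≤ (S i.succ).card + 1)
    (hlast : (S (Fin.last k)).card = k + 1)
    (hmaj : ∀ c, ∃ i, IsMajorityColor (S i : Set (Fin (k + 1) × Fin (k + 1))) c) :
    IsColorfulChoice (S (Fin.last k) : Set (Fin (k + 1) × Fin (k + 1))) := by
  classical
  choose g hg using hmaj
  -- A set has only one majority color, so the colors match the sets bijectively and consecutive
  -- majorities differ.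
  have hginj : Function.Injective g := fun c c' h => (hg c).unique (h ▸ hg c')
  have hgsurj : Function.Surjective g := Finite.surjective_of_injective hginj
  -- If no index of the old majority color were removed, that color would stay the majority.
  have hstep : ∀ i : Fin k, ∃ κ, g κ.1 = i.castSucc ∧ S i.castSucc ⊆ insert κ (S i.succ) := by
    intro i
    obtain ⟨c, hc⟩ := hgsurj i.castSucc
    have hsub : S i.succ ⊆ S i.castSucc := hS (Fin.castSucc_lt_succ).le
    obtain ⟨κ, hκ, hκ', hκc⟩ : ∃ κ ∈ S i.castSucc, κ ∉ S i.succ ∧ κ.1 = c := by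
      by_contra hcon
      push Not at hcon
      obtain ⟨c', hc'⟩ := hgsurj i.succ
      have h1 : IsMajorityColor (S i.succ : Set (Fin (k + 1) × Fin (k + 1))) c :=
        (hc ▸ hg c).of_subset (by exact_mod_cast hsub) fun κ h1 h2 =>
          hcon κ (by exact_mod_cast h1) (by exact_mod_cast h2)
      have h2 : c = c' := h1.unique (hc' ▸ hg c')
      rw [h2, hc'] at hc
      exact (Fin.castSucc_lt_succ (i := i)).ne' hc
    refine ⟨κ, by rw [hκc, hc], ?_⟩
    have hins : insert κ (S i.succ) ⊆ S i.castSucc := insert_subset hκ hsub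
    rw [eq_of_subset_of_card_le hins (by rw [card_insert_of_notMem hκ']; exact hcard i)]
  choose κ hκ hκS using hstep
  set B := S (Fin.last k) with hB
  have hmem : ∀ i, ∀ x ∈ S i, x ∈ B ∨ ∃ j, x = κ j := by
    intro i
    induction i using Fin.reverseInduction with
    | last => exact fun x hx => Or.inl hx
    | cast i ih =>
      intro x hx
      rcases mem_insert.1 (hκS i hx) with h | h
      · exact Or.inr ⟨i, h⟩
      · exact ih x h
  -- The removed indices have pairwise different colors, so each color loses at most one index on
  -- the way to `B`.
  have hcount : ∀ i c, colorCount (S i : Set (Fin (k + 1) × Fin (k + 1))) c ≤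
      colorCount (B : Set (Fin (k + 1) × Fin (k + 1))) c + 1 := by
    intro i c
    have hsub : (S i : Set (Fin (k + 1) × Fin (k + 1))) ∩ {x | x.1 = c} ⊆
        ((B : Set (Fin (k + 1) × Fin (k + 1))) ∩ {x | x.1 = c}) ∪ {x | x.1 = c ∧ ∃ j, x = κ j} := by
      rintro x ⟨hx, hxc⟩
      rcases hmem i x (by exact_mod_cast hx) with h | h
      · exact Or.inl ⟨by exact_mod_cast h, hxc⟩
      · exact Or.inr ⟨hxc, h⟩
    refine (Set.ncard_le_ncard hsub (Set.toFinite _)).trans ((Set.ncard_union_le _ _).trans ?_)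
    refine Nat.add_le_add_left (Set.ncard_le_one_iff_subsingleton.2 ?_) _
    rintro _ ⟨h1, j, rfl⟩ _ ⟨h2, j', rfl⟩
    have : j.castSucc = j'.castSucc := by rw [← hκ j, ← hκ j', h1, h2]
    rw [Fin.castSucc_injective k this]
  have hle : ∀ c c', colorCount (B : Set (Fin (k + 1) × Fin (k + 1))) c' ≤
      colorCount (B : Set (Fin (k + 1) × Fin (k + 1))) c + 1 := fun c c' =>
    (colorCount_mono (by exact_mod_cast hS (Fin.le_last (g c))) c').trans
      (((hg c).1 c').trans (hcount _ c))
  have hsum := sum_colorCount B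
  rw [hlast] at hsum
  have hsum1 : ∑ _c : Fin (k + 1), 1 = k + 1 := by simp
  -- A missing color would bound every count by one and bring the total below `k + 1`.
  have hpos : ∀ c, 1 ≤ colorCount (B : Set (Fin (k + 1) × Fin (k + 1))) c := by
    intro c
    by_contra hcon
    have hlt : ∑ c, colorCount (B : Set (Fin (k + 1) × Fin (k + 1))) c < ∑ _c : Fin (k + 1), 1 :=
      sum_lt_sum (fun c' _ => by have := hle c c'; omega) ⟨c, mem_univ c, by omega⟩
    omega
  have hone := (sum_eq_sum_iff_of_le fun c _ => hpos c).1 (hsum1.trans hsum.symm)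
  intro c
  obtain ⟨x, hx⟩ := Set.ncard_eq_one.1 (hone c (mem_univ c)).symm
  have hx' : ∀ y, y ∈ (B : Set (Fin (k + 1) × Fin (k + 1))) ∧ y.1 = c ↔ y = x := fun y =>
    Set.ext_iff.1 hx y
  exact ⟨x, (hx' x).2 rfl, fun y hy => (hx' y).1 hy⟩

/-! ### Simplices of the subdivision and the final assembly -/

namespace ColorInstance

variable {d : ℕ} {I : ColorInstance d} {ε : ℝ}

theorem hasLabel_iff (hI : I.InGeneralPosition) (hs : I.IsSuitable ε)
    {a : Finset (ConstraintIdx d)} (ha : I.IsCell ε a) {i : Fin d} :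
    I.HasLabel ε (I.cellBarycenter ε a) i ↔ IsMajorityColor (a.toLeft : Set (Fin d × Fin d)) i := by
  have hsupp : faceSupport (I.cellFace a) = a.toLeft := by
    obtain ⟨⟨μ, hμ⟩, -⟩ := id ha
    obtain ⟨β, hβ, hb⟩ := hμ.exists_basis
    exact faceSupport_cellFace hI hβ hb
  constructor
  · rintro ⟨f, g, hfg, hmaj⟩
    obtain ⟨a', ha', hv, rfl, rfl⟩ := (isBarycenterOf_iff hI hs).1 hfg
    rwa [← cellBarycenter_injOn hI ha ha' hv, hsupp] at hmaj
  · intro h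
    exact ⟨_, _, (isBarycenterOf_iff hI hs).2 ⟨a, ha, rfl, rfl, rfl⟩, by rwa [hsupp]⟩

/-- The simplices of the subdivision are given by chains of cells. -/
theorem exists_chain (hI : I.InGeneralPosition) (hs : I.IsSuitable ε)
    {σ : Finset (Fin d → ℝ)} (hσ : σ ∈ I.sdQ ε) :
    ∃ (k : ℕ) (F : Fin (k + 1) → Finset (ConstraintIdx d)), (∀ i, I.IsCell ε (F i)) ∧
      Antitone F ∧ (∀ i j, i < j → (F j).card < (F i).card) ∧
      (σ : Set (Fin d → ℝ)) = Set.range fun i => I.cellBarycenter ε (F i) := by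
  obtain ⟨k, q, hq, hmono, hdim, hσ⟩ := hσ
  choose F hF hqF using fun i => (mem_complexQ_iff hI hs).1 (hq i)
  refine ⟨k, F, hF, fun i j hij => ?_, fun i j hij => ?_, ?_⟩
  · have := hmono.monotone hij
    rw [hqF i, hqF j] at this
    exact (hF i).subset_of_image_subset hI (hF j) this
  · have h1 := hdim hij
    have h2 := (hF i).setDim_image hI hs
    have h3 := (hF j).setDim_image hI hs
    simp only [hqF] at h1
    omega
  · rw [hσ]
    simp only [hqF]
    rfl

theorem exists_cell_of_mem (hI : I.InGeneralPosition) (hs : I.IsSuitable ε)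
    {σ : Finset (Fin d → ℝ)} (hσ : σ ∈ I.sdQ ε) {v : Fin d → ℝ} (hv : v ∈ σ) :
    ∃ a, I.IsCell ε a ∧ v = I.cellBarycenter ε a := by
  obtain ⟨k, F, hF, -, -, hσF⟩ := exists_chain hI hs hσ
  have : v ∈ (σ : Set (Fin d → ℝ)) := hv
  rw [hσF] at this
  obtain ⟨i, rfl⟩ := this
  exact ⟨F i, hF i, rfl⟩

theorem IsCell.lt_card (hI : I.InGeneralPosition) {a : Finset (ConstraintIdx d)}
    (ha : I.IsCell ε a) : d < a.card := by
  obtain ⟨⟨μ, hμ⟩, i, hi⟩ := ha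
  have h1 := hμ.mul_support hI
  have h2 := card_eq_add_add a
  have h3 : 0 < a.toRight.toRight.card := card_pos.2 ⟨i, mem_toRight.2 (mem_toRight.2 hi)⟩
  omega

theorem hasLabel_spec (hI : I.InGeneralPosition) (hs : I.IsSuitable ε)
    {a : Finset (ConstraintIdx d)} (ha : I.IsCell ε a) :
    (∃! p : Set (Fin d × Fin d → ℝ) × Set (Fin d → ℝ),
      I.IsBarycenterOf ε (I.cellBarycenter ε a) p.1 p.2) ∧
    ∃! i : Fin d, I.HasLabel ε (I.cellBarycenter ε a) i := by
  refine ⟨⟨(I.cellFace a, simplexProj '' cubeFace a),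
    (isBarycenterOf_iff hI hs).2 ⟨a, ha, rfl, rfl, rfl⟩, ?_⟩, ?_⟩
  · rintro ⟨f, g⟩ hfg
    obtain ⟨a', ha', hv, h1, h2⟩ := (isBarycenterOf_iff hI hs).1 hfg
    rw [cellBarycenter_injOn hI ha ha' hv]
    exact Prod.ext h1 h2
  · obtain ⟨i, hi⟩ := exists_isMajorityColor hI.d_pos (a.toLeft : Set (Fin d × Fin d))
    exact ⟨i, (hasLabel_iff hI hs ha).2 hi, fun j hj => ((hasLabel_iff hI hs ha).1 hj).unique hi⟩

/-- The labeling is a Sperner labeling. -/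
theorem label_mem_of_mem_convexHull (hI : I.InGeneralPosition) (hs : I.IsSuitable ε) (hε : 0 < ε)
    (hεN : ε ≤ ((I.N : ℝ) ^ 3)⁻¹) {a : Finset (ConstraintIdx d)} (ha : I.IsCell ε a) {i : Fin d}
    (hi : I.HasLabel ε (I.cellBarycenter ε a) i) {T : Finset (Fin d)}
    (hT : I.cellBarycenter ε a ∈
      convexHull ℝ ((fun j => (Pi.single j 1 : Fin d → ℝ)) '' (T : Set (Fin d)))) : i ∈ T := by
  by_contra hiT
  have hsub : convexHull ℝ ((fun j => (Pi.single j 1 : Fin d → ℝ)) '' (T : Set (Fin d))) ⊆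
      {x | (LinearMap.proj i : (Fin d → ℝ) →ₗ[ℝ] ℝ) x = 0} := by
    refine convexHull_min ?_ (convex_hyperplane (LinearMap.isLinear _) 0)
    rintro _ ⟨j, hj, rfl⟩
    have hne : i ≠ j := fun h => hiT (h ▸ hj)
    simp [hne]
  have h0 : I.cellBarycenter ε a i = 0 := hsub hT
  obtain ⟨μ, hμ, ht, hv⟩ := ha.cellBarycenter_spec hI
  rw [hv, simplexProj, Pi.smul_apply, smul_eq_mul] at h0
  refine ha.zero_notMem_majority hI hε hεN ((hasLabel_iff hI hs ha).1 hi) ?_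
  rw [ht.mem_zero_iff]
  exact (mul_eq_zero.1 h0).resolve_left (inv_ne_zero (sum_abs_pos (ne_zero_of_mem_cubeM hμ)).ne')

theorem exists_fullyLabeled (hI : I.InGeneralPosition) (hs : I.IsSuitable ε) (hε : 0 < ε)
    (hεN : ε ≤ ((I.N : ℝ) ^ 3)⁻¹) : ∃ σ ∈ I.sdQ ε, σ.card = d ∧ I.FullyLabeled ε σ := by
  classical
  obtain ⟨F, hF, hcard, hanti, hmaj⟩ := hI.exists_full_flag hε hεN hs
  have hdim : ∀ i, setDim (simplexProj '' I.closedCell ε (F i)) = i := by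
    intro i
    have h1 := (hF i).setDim_image hI hs
    have h2 := hcard i
    omega
  have hinj : Function.Injective fun i => I.cellBarycenter ε (F i) := by
    intro i j hij
    have h := cellBarycenter_injOn hI (hF i) (hF j) hij
    have h1 := hcard i
    have h2 := hcard j
    rw [h] at h1
    exact Fin.ext (by omega)
  refine ⟨univ.image fun i => I.cellBarycenter ε (F i), ?_, ?_, fun c => ?_⟩
  · obtain ⟨k, rfl⟩ : ∃ k, d = k + 1 := ⟨d - 1, by have := hI.d_pos; omega⟩
    refine ⟨k, fun i => simplexProj '' I.closedCell ε (F i),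
      fun i => (mem_complexQ_iff hI hs).2 ⟨F i, hF i, rfl⟩, fun i j hij => ?_, fun i j hij => ?_, ?_⟩
    · refine lt_of_le_of_ne (Set.image_mono (closedCell_anti hI (hF j) (hanti hij.le))) fun h => ?_
      have h1 := congrArg setDim h
      simp only [hdim] at h1
      exact hij.ne (Fin.ext h1)
    · simp only [hdim]
      exact hij
    · rw [coe_image, coe_univ, Set.image_univ]
      rfl
  · rw [card_image_of_injective _ hinj, card_univ, Fintype.card_fin]
  · obtain ⟨i, hi⟩ := hmaj c
    exact ⟨_, mem_image_of_mem _ (mem_univ i), (hasLabel_iff hI hs (hF i)).2 hi⟩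

theorem IsFace.rayEmbraces {f : Set (Fin d × Fin d → ℝ)} (hf : I.IsFace f) :
    RayEmbraces (I.column '' faceSupport f) I.b := by
  obtain ⟨x, hx⟩ := hf.1
  have hxP : x ∈ I.polyhedron := by
    rw [hf.eq_support] at hx
    exact hx.1
  obtain ⟨hxb, hx0⟩ := I.mem_polyhedron.1 hxP
  rw [← hxb]
  exact rayEmbraces_of_sum _ x hx0 fun k hk => ⟨k, ⟨x, hx, hk⟩, rfl⟩

/-- The top vertex of a fully-labeled simplex gives a colorful choice. -/
theorem colorful_of_fullyLabeled (hI : I.InGeneralPosition) (hs : I.IsSuitable ε)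
    {σ : Finset (Fin d → ℝ)} (hσ : σ ∈ I.sdQ ε) (hσd : σ.card = d) (hfull : I.FullyLabeled ε σ) :
    (∃ v ∈ σ, ∃ f g, I.IsBarycenterOf ε v f g ∧
      setDim (I.paramRegionProj ε f ∩ g) + 1 = d) ∧
    ∀ v ∈ σ, ∀ f g, I.IsBarycenterOf ε v f g →
      setDim (I.paramRegionProj ε f ∩ g) + 1 = d →
        IsColorfulChoice (faceSupport f) ∧ RayEmbraces (I.column '' faceSupport f) I.b := by
  classical
  obtain ⟨k, F, hF, hanti, hcard, hσF⟩ := exists_chain hI hs hσ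
  have hle : ∀ i, (F i).card ≤ 2 * d := fun i => by
    obtain ⟨⟨μ, hμ⟩, -⟩ := hF i
    exact hμ.card_le hs
  have hlt : ∀ i, d < (F i).card := fun i => (hF i).lt_card hI
  -- `r i` is the dimension of the `i`-th cell. With `d` vertices, strict monotonicity makes `r` the
  -- identity, so the flag is complete.
  let r : Fin (k + 1) → Fin d := fun i => ⟨2 * d - (F i).card, by
    have := hlt i
    have := hI.d_pos
    omega⟩
  have hr : StrictMono r := by
    intro i j hij
    have h1 := hcard i j hij
    have h2 := hle i
    exact Fin.lt_def.2 (by simp only [r]; omega)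
  have hkd : k + 1 ≤ d := by simpa using Fintype.card_le_of_injective r hr.injective
  have hσeq : σ = univ.image fun i => I.cellBarycenter ε (F i) := by
    apply coe_injective
    rw [hσF, coe_image, coe_univ, Set.image_univ]
  have hdk : d ≤ k + 1 := by
    rw [← hσd, hσeq]
    exact card_image_le.trans (by simp)
  obtain rfl : d = k + 1 := le_antisymm hdk hkd
  have hrid : ∀ i, r i = i := fun i => congrFun (StrictMono.range_inj hr strictMono_id |>.1 (by
    rw [Set.range_id, (Finite.surjective_of_injective hr.injective).range_eq])) i
  have hcard' : ∀ i, (F i).card + i = 2 * (k + 1) := by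
    intro i
    have h1 : 2 * (k + 1) - (F i).card = i := congrArg Fin.val (hrid i)
    have h2 := hle i
    omega
  have hdim : ∀ a, I.IsCell ε a →
      setDim (I.paramRegionProj ε (I.cellFace a) ∩ simplexProj '' cubeFace a) + a.card =
        2 * (k + 1) := by
    intro a ha
    rw [paramRegionProj_inter _ ha.cubeFace_mem]
    exact ha.setDim_image hI hs
  have hmemσ : ∀ i, I.cellBarycenter ε (F i) ∈ σ := fun i => by
    rw [hσeq]
    exact mem_image_of_mem _ (mem_univ i)
  have hlast := hcard' (Fin.last k)
  rw [Fin.val_last] at hlast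
  refine ⟨⟨_, hmemσ (Fin.last k), _, _,
    (isBarycenterOf_iff hI hs).2 ⟨_, hF (Fin.last k), rfl, rfl, rfl⟩, ?_⟩, ?_⟩
  · have := hdim _ (hF (Fin.last k))
    omega
  · intro v hv f g hfg hfgd
    refine ⟨?_, hfg.1.1.rayEmbraces⟩
    obtain ⟨a, ha, rfl, rfl, rfl⟩ := (isBarycenterOf_iff hI hs).1 hfg
    rw [hσeq] at hv
    obtain ⟨i, -, hi⟩ := mem_image.1 hv
    have hai : F i = a := cellBarycenter_injOn hI (hF i) ha hi
    subst hai
    have hi : i = Fin.last k := by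
      have h1 := hdim _ ha
      have h2 := hcard' i
      exact Fin.ext (by rw [Fin.val_last]; omega)
    subst hi
    obtain ⟨⟨μ, hμ⟩, j, hj⟩ := id ha
    obtain ⟨β, hβ, hb⟩ := hμ.exists_basis
    rw [faceSupport_cellFace hI hβ hb]
    -- The top cell has `d + 1` constraints, hence exactly one upper bound and exactly `d` columns.
    have h1 := hμ.mul_support hI
    have h2 := card_eq_add_add (F (Fin.last k))
    have h3 : 0 < (F (Fin.last k)).toRight.toRight.card :=
      card_pos.2 ⟨j, mem_toRight.2 (mem_toRight.2 hj)⟩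
    refine isColorfulChoice_of_majority (fun i => (F i).toLeft)
      (fun i j hij x hx => mem_toLeft.2 (hanti hij (mem_toLeft.1 hx))) (fun i => ?_)
      (by omega) fun c => ?_
    · have h4 := hcard' i.castSucc
      have h5 := hcard' i.succ
      rw [Fin.val_castSucc] at h4
      rw [Fin.val_succ] at h5
      have h6 := card_toLeft_add_card_toRight (u := F i.castSucc)
      have h7 := card_toLeft_add_card_toRight (u := F i.succ)
      have h8 : (F i.succ).toRight ⊆ (F i.castSucc).toRight := fun x hx =>
        mem_toRight.2 (hanti (Fin.castSucc_lt_succ).le (mem_toRight.1 hx))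
      have h9 := card_le_card h8
      omega
    · obtain ⟨v, hv, hvc⟩ := hfull c
      rw [hσeq] at hv
      obtain ⟨i, -, rfl⟩ := mem_image.1 hv
      exact ⟨i, (hasLabel_iff hI hs (hF i)).1 hvc⟩

end ColorInstance

theorem mainTheorem2 :
    (∀ (d : ℕ) (I : ColorInstance d), I.InGeneralPosition →
      -- suitable perturbations exist
      (∃ ε₀ : ℝ, 0 < ε₀ ∧ ∀ ε : ℝ, 0 < ε → ε < ε₀ → I.IsSuitable ε) ∧
      ∀ ε : ℝ, 0 < ε → ε ≤ ((I.N : ℝ) ^ 3)⁻¹ → I.IsSuitable ε →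
        -- the labeling of the vertices is well defined
        (∀ σ ∈ I.sdQ ε, ∀ v ∈ σ,
          (∃! p : Set (Fin d × Fin d → ℝ) × Set (Fin d → ℝ), I.IsBarycenterOf ε v p.1 p.2) ∧
          ∃! i : Fin d, I.HasLabel ε v i) ∧
        -- it is a Sperner labeling
        (∀ σ ∈ I.sdQ ε, ∀ v ∈ σ, ∀ i : Fin d, I.HasLabel ε v i → ∀ T : Finset (Fin d),
          v ∈ convexHull ℝ ((fun j => (Pi.single j 1 : Fin d → ℝ)) '' (T : Set (Fin d))) →
            i ∈ T) ∧
        -- there is a fully-labeled simplex of dimension `d - 1`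
        (∃ σ ∈ I.sdQ ε, σ.card = d ∧ I.FullyLabeled ε σ) ∧
        -- the top vertex of every such simplex gives a colorful choice that ray-embraces `b`
        (∀ σ ∈ I.sdQ ε, σ.card = d → I.FullyLabeled ε σ →
          (∃ v ∈ σ, ∃ f g, I.IsBarycenterOf ε v f g ∧
            setDim (I.paramRegionProj ε f ∩ g) + 1 = d) ∧
          ∀ v ∈ σ, ∀ f g, I.IsBarycenterOf ε v f g →
            setDim (I.paramRegionProj ε f ∩ g) + 1 = d →
              IsColorfulChoice (faceSupport f) ∧
              RayEmbraces (I.column '' faceSupport f) I.b)) ∧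
    -- the cone version of the colorful Caratheodory theorem
    (∀ (d : ℕ) (C : Fin d → Set (Fin d → ℝ)) (b : Fin d → ℝ), (∀ i, (C i).Nonempty) →
      (∀ i, RayEmbraces (C i) b) →
        ∃ c : Fin d → Fin d → ℝ, (∀ i, c i ∈ C i) ∧ RayEmbraces (Set.range c) b) := by
  refine ⟨fun d I hI => ⟨I.exists_forall_isSuitable, fun ε hε hεN hs => ⟨?_, ?_, ?_, ?_⟩⟩,
    fun d C b hC h => colorful_caratheodory C b hC h⟩
  · intro σ hσ v hv
    obtain ⟨a, ha, rfl⟩ := ColorInstance.exists_cell_of_mem hI hs hσ hv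
    exact ColorInstance.hasLabel_spec hI hs ha
  · intro σ hσ v hv i hi T hT
    obtain ⟨a, ha, rfl⟩ := ColorInstance.exists_cell_of_mem hI hs hσ hv
    exact ColorInstance.label_mem_of_mem_convexHull hI hs hε hεN ha hi hT
  · exact ColorInstance.exists_fullyLabeled hI hs hε hεN
  · exact fun σ hσ hσd hfull => ColorInstance.colorful_of_fullyLabeled hI hs hσ hσd hfull
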